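/- For an integer $n \ge 1$ and real $\beta > 0$, let $H_\beta$ (the $\beta$-Hermite ensemble of size $n$) be the probability law on $\mathbb{R}^n$ with density $$\frac{1}{Z_{n,\beta}} \prod_{1 \le j < k \le n} |\lambda_j - \lambda_k|^{\beta}\, \exp\Bigl(-\frac{\beta}{4} \sum_{k=1}^n \lambda_k^2\Bigr)$$ with respect to Lebesgue measure, where $Z_{n,\beta}$ is the normalizing constant, and let $\lambda_{\max}(H_\beta) = \max_{1 \le k \le n} \lambda_k$ for $(\lambda_1, \dots, \lambda_n)$ distributed according to $H_\beta$. **Theorem 1.** There is a numerical constant $C > 0$ such that for all integers $n \ge 1$, all real $\beta \ge 1$ and all real $0 < \varepsilon \le 1$, $$\mathbb{P}\bigl(\lambda_{\max}(H_\beta) \ge 2\sqrt{n}\,(1+\varepsilon)\bigr) \le C\, e^{-\beta n \varepsilon^{3/2}/C}$$ and $$\mathbb{P}\bigl(\lambda_{\max}(H_\beta) \le 2\sqrt{n}\,(1-\varepsilon)\bigr) \le C^{\beta}\, e^{-\beta n^2 \varepsilon^{3}/C}.$$ -/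

import Mathlib

open MeasureTheory

noncomputable section

namespace BetaHermite

/-- The unnormalized joint density
`∏_{j < k} |x_j - x_k|^β * exp (-(β / 4) * ∑ k, x_k ^ 2)` on `ℝⁿ`. -/
def weight (β : ℝ) (n : ℕ) (x : Fin n → ℝ) : ℝ :=
  (∏ j : Fin n, ∏ k ∈ Finset.Ioi j, |x j - x k| ^ β) *
    Real.exp (-(β / 4) * ∑ k : Fin n, x k ^ 2)

/-- The normalizing constant `Z_{n, β}`. -/
def partitionFunction (β : ℝ) (n : ℕ) : ℝ := ∫ x : Fin n → ℝ, weight β n x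

/-- The `β`-Hermite ensemble of size `n`: the law on `ℝⁿ` whose density with respect to
Lebesgue measure is `weight β n / Z_{n, β}`. -/
def ensemble (β : ℝ) (n : ℕ) : Measure (Fin n → ℝ) :=
  volume.withDensity fun x => ENNReal.ofReal (weight β n x / partitionFunction β n)

/-- The largest of the points `x_1, …, x_n` (for `n ≥ 1`). -/
def lambdaMax {n : ℕ} (x : Fin n → ℝ) : ℝ := ⨆ k, x k

/-! Sanity check: the ensemble is a probability measure for `β > 0`. -/

lemma weight_nonneg (β : ℝ) (n : ℕ) (x : Fin n → ℝ) : 0 ≤ weight β n x := by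
  unfold weight; positivity

lemma continuous_weight {β : ℝ} (hβ : 0 < β) (n : ℕ) : Continuous (weight β n) := by
  unfold weight
  refine Continuous.mul ?_ (by fun_prop)
  refine continuous_finsetProd _ fun j _ => continuous_finsetProd _ fun k _ => ?_
  exact Continuous.rpow_const (by fun_prop) fun _ => Or.inr hβ.le

lemma weight_le {β : ℝ} (hβ : 0 < β) (n : ℕ) (x : Fin n → ℝ) :
    weight β n x ≤ ∏ k : Fin n,
      (1 + |x k|) ^ (2 * n * β) * Real.exp (-(β / 4) * x k ^ 2) := by
  have h1 : ∀ j k : Fin n, 1 ≤ ((1 + |x j|) * (1 + |x k|)) ^ β := fun j k =>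
    Real.one_le_rpow (by
      nlinarith [abs_nonneg (x j), abs_nonneg (x k),
        mul_nonneg (abs_nonneg (x j)) (abs_nonneg (x k))]) hβ.le
  have h2 : ∀ j k : Fin n, |x j - x k| ^ β ≤ ((1 + |x j|) * (1 + |x k|)) ^ β := fun j k =>
    Real.rpow_le_rpow (abs_nonneg _) (by
      nlinarith [abs_sub (x j) (x k), abs_nonneg (x j), abs_nonneg (x k),
        mul_nonneg (abs_nonneg (x j)) (abs_nonneg (x k))]) hβ.le
  have h3 : (∏ j : Fin n, ∏ k ∈ Finset.Ioi j, |x j - x k| ^ β) ≤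
      ∏ j : Fin n, ∏ k : Fin n, ((1 + |x j|) * (1 + |x k|)) ^ β := by
    refine Finset.prod_le_prod (fun j _ => by positivity) fun j _ => ?_
    have h : (∏ k ∈ Finset.Ioi j, |x j - x k| ^ β) =
        ∏ k : Fin n, if k ∈ Finset.Ioi j then |x j - x k| ^ β else 1 := by
      rw [Finset.prod_ite_mem, Finset.univ_inter]
    rw [h]
    refine Finset.prod_le_prod (fun k _ => ?_) fun k _ => ?_
    · split_ifs <;> positivity
    · split_ifs
      exacts [h2 j k, h1 j k]
  have h4 : (∏ j : Fin n, ∏ k : Fin n, ((1 + |x j|) * (1 + |x k|)) ^ β) =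
      ∏ k : Fin n, (1 + |x k|) ^ (2 * n * β) := by
    have : ∀ j k : Fin n, ((1 + |x j|) * (1 + |x k|)) ^ β =
        (1 + |x j|) ^ β * (1 + |x k|) ^ β := fun j k =>
      Real.mul_rpow (by positivity) (by positivity)
    simp only [this, Finset.prod_mul_distrib, Finset.prod_const, Finset.card_univ,
      Fintype.card_fin]
    rw [Finset.prod_pow, ← mul_pow, ← Finset.prod_mul_distrib, ← Finset.prod_pow]
    refine Finset.prod_congr rfl fun k _ => ?_
    have hk : 0 < 1 + |x k| := by positivity
    rw [← Real.rpow_add hk, ← Real.rpow_natCast, ← Real.rpow_mul hk.le]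
    congr 1; ring
  rw [Finset.prod_mul_distrib, ← h4, ← Real.exp_sum, ← Finset.mul_sum]
  exact mul_le_mul_of_nonneg_right h3 (Real.exp_pos _).le

lemma integrable_factor {β s : ℝ} (hβ : 0 < β) (hs : 0 ≤ s) :
    Integrable fun t : ℝ => (1 + |t|) ^ s * Real.exp (-(β / 4) * t ^ 2) := by
  have hi : Integrable fun t : ℝ => Real.exp (-(β / 8) * t ^ 2) :=
    integrable_exp_neg_mul_sq (by positivity)
  have hc : Continuous fun t : ℝ => (1 + |t|) ^ s :=
    Continuous.rpow_const (by fun_prop) fun _ => Or.inr hs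
  refine (hi.const_mul (Real.exp (s ^ 2 * (2 / β)))).mono'
    (hc.mul (by fun_prop)).aestronglyMeasurable (Filter.Eventually.of_forall fun t => ?_)
  rw [Real.norm_of_nonneg (by positivity), ← Real.exp_add]
  calc _ ≤ Real.exp (s * |t|) * Real.exp (-(β / 4) * t ^ 2) := by
        gcongr
        calc (1 + |t|) ^ s ≤ (Real.exp |t|) ^ s :=
              Real.rpow_le_rpow (by positivity) (by linarith [Real.add_one_le_exp |t|]) hs
          _ = _ := by rw [← Real.exp_mul, mul_comm]
    _ ≤ _ := by
        rw [← Real.exp_add, Real.exp_le_exp]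
        have h : s ^ 2 * (2 / β) + -(β / 8) * t ^ 2 - (s * |t| + -(β / 4) * t ^ 2) =
            2 / β * (s - β / 4 * |t|) ^ 2 := by
          rw [← sq_abs t]; field_simp; ring
        have : 0 ≤ 2 / β * (s - β / 4 * |t|) ^ 2 := by positivity
        linarith

lemma integrable_weight {β : ℝ} (hβ : 0 < β) (n : ℕ) : Integrable (weight β n) := by
  have h : Integrable fun x : Fin n → ℝ => ∏ k : Fin n,
      (1 + |x k|) ^ (2 * n * β) * Real.exp (-(β / 4) * x k ^ 2) :=
    Integrable.fintype_prod fun _ => integrable_factor hβ (by positivity)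
  refine h.mono' (continuous_weight hβ n).aestronglyMeasurable
    (Filter.Eventually.of_forall fun x => ?_)
  rw [Real.norm_of_nonneg (weight_nonneg β n x)]
  exact weight_le hβ n x

lemma partitionFunction_pos {β : ℝ} (hβ : 0 < β) (n : ℕ) : 0 < partitionFunction β n := by
  refine integral_pos_of_integrable_nonneg_nonzero (x := fun k : Fin n => (k : ℝ))
    (continuous_weight hβ n) (integrable_weight hβ n) (weight_nonneg β n) (ne_of_gt ?_)
  refine mul_pos (Finset.prod_pos fun j _ => Finset.prod_pos fun k hk => ?_) (Real.exp_pos _)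
  refine Real.rpow_pos_of_pos (abs_pos.2 (sub_ne_zero.2 fun h => ?_)) _
  exact (Finset.mem_Ioi.1 hk).ne (Fin.ext (Nat.cast_injective (R := ℝ) h))

theorem isProbabilityMeasure_ensemble {β : ℝ} (hβ : 0 < β) (n : ℕ) :
    IsProbabilityMeasure (ensemble β n) := by
  constructor
  have hZ := partitionFunction_pos hβ n
  rw [ensemble, withDensity_apply _ MeasurableSet.univ, Measure.restrict_univ,
    ← ofReal_integral_eq_lintegral_ofReal ((integrable_weight hβ n).div_const _)
      (Filter.Eventually.of_forall fun x => div_nonneg (weight_nonneg β n x) hZ.le),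
    integral_div]
  change ENNReal.ofReal (partitionFunction β n / partitionFunction β n) = 1
  rw [div_self hZ.ne', ENNReal.ofReal_one]

end BetaHermite

end

/-!
Edge bounds for the `β`-Hermite ensemble, by way of a scalar Markov chain.

*Reduction to a chain.* Attach to the points `x_i` of the ensemble of size `m + 1` independent
weights `w_i`, gamma distributed with shape and rate `β / 2`, and consider the rational function
`R(z) = ∑ w_i / (z - x_i)`. Its zeros `y` interlace the `x_i`, and for `s = ∑ w_i` one has
`R(z) = s * ∏ (z - y_j) / ∏ (z - x_i) = s / (z - a - ∑ r_j / (z - y_j))`.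
Both `(y, s) ↦ w` at fixed `x` and `x ↦ (a, r)` at fixed `y` are changes of variables whose
Jacobians are row and column rescalings of the same Cauchy matrix bordered by ones, so that the
densities combine exactly (`lintegral_weight_succ`): the `y_j` with weights `r_j` form the weighted
ensemble of size `m`, while `a` is an independent Gaussian of variance `2 / β` and `s` an
independent gamma variable of shape `(m + 1) β / 2`. This is the tridiagonal model of the ensemble,
obtained without matrices. All points are below `t` exactly when this holds for the `y_j` and the
pivot `d = t - a - ∑ r_j / (t - y_j)` is positive. Iterating, the probability that `λ_max < t` is
the survival probability of the chain `f ↦ s_k / (t - a_k - f)`, killed when the denominator is not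
positive (`ensemble_lambdaMax_lt`).

*Upper tail.* With `ε = h²` and `κ = β n ε / 4`, the potential `exp (-κ (d / √n - 1))` of the pivot
is a supermartingale up to an error: in the mean, `δ = d / √n - 1` moves by the Riccati step
`δ ↦ (δ + q²) / (1 + δ)`, which increases it as long as `δ ≤ q`, and for larger `δ` the potential is
already of order `exp (-κ q)`. Here `q² = ε + (n - k) / n` at step `k`, and the errors telescope
against `exp (-κ q / 4)`, which at `k = n` is `exp (-β n ε ^ (3/2) / 16)`
(`exp_riccati_le`, `riccati_error_le`, `one_le_survival_add`).

*Lower tail.* Survival means that `t` minus the tridiagonal matrix is positive definite, hence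
positive at any fixed test vector `v`. Markov's inequality for the exponential of this quadratic
form can be carried out along the chain, and the Gaussian and gamma variables then contribute
independent explicit factors (`survival_le`). For `v` a tent of width of order `n ε` at the largest
indices and an optimal multiple `θ`, the product is `exp (-c β n² ε³)` (`survival_le_exp`), provided
that `n² ε³` is large. In the remaining ranges of the parameters the bounds are trivial for a large
constant.
-/

noncomputable section

namespace BetaHermite

open Polynomial in
/-- The monic polynomial with roots `x_i`. -/
def rootPoly {n : ℕ} (x : Fin n → ℝ) : ℝ[X] := ∏ i, (X - C (x i))

/-- Strict interlacing `x_0 < y_0 < x_1 < ⋯ < y_{m-1} < x_m`. -/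
def Interlace {m : ℕ} (x : Fin (m + 1) → ℝ) (y : Fin m → ℝ) : Prop :=
  ∀ i : Fin m, x i.castSucc < y i ∧ y i < x i.succ

/-- The residues at `x_i` of the rational function `s * ∏ (z - y_j) / ∏ (z - x_i)`. -/
def residue {m : ℕ} (x : Fin (m + 1) → ℝ) (y : Fin m → ℝ) (s : ℝ) (i : Fin (m + 1)) : ℝ :=
  s * ∏ j : Fin m, (x i - y j) / (x i - x (i.succAbove j))

/-- The numbers `r_i` in the partial fraction expansion
`∏ (z - x_j) / ∏ (z - y_i) = z - a - ∑ r_i / (z - y_i)`. -/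
def dualResidue {m : ℕ} (x : Fin (m + 1) → ℝ) (y : Fin m → ℝ) (i : Fin m) : ℝ :=
  -((∏ j, (y i - x j)) / ∏ j ∈ Finset.univ.erase i, (y i - y j))

/-- The number `a` in the partial fraction expansion
`∏ (z - x_j) / ∏ (z - y_i) = z - a - ∑ r_i / (z - y_i)`. -/
def dualShift {m : ℕ} (x : Fin (m + 1) → ℝ) (y : Fin m → ℝ) : ℝ := ∑ i, x i - ∑ i, y i

lemma prod_erase_eq_prod_succAbove {M : Type*} [CommMonoid M] {m : ℕ} (i : Fin (m + 1))
    (f : Fin (m + 1) → M) :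
    ∏ j ∈ Finset.univ.erase i, f j = ∏ j : Fin m, f (i.succAbove j) := by
  have h : (Finset.univ : Finset (Fin (m + 1))).erase i =
      Finset.univ.map i.succAboveEmb := by
    rw [Fin.univ_succAbove m i, Finset.erase_cons]
  rw [h, Finset.prod_map]; rfl

/-! ### Interlacing sequences -/

section Interlacing

variable {m : ℕ} {x : Fin (m + 1) → ℝ} {y : Fin m → ℝ}

lemma Interlace.strictMono_left (h : Interlace x y) : StrictMono x :=
  Fin.strictMono_iff_lt_succ.2 fun i => (h i).1.trans (h i).2

lemma Interlace.strictMono_right (h : Interlace x y) : StrictMono y := fun i j hij =>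
  ((h i).2.trans_le (h.strictMono_left.monotone (by
    rw [Fin.le_def]; simpa using hij))).trans (h j).1

lemma Interlace.lt_of_lt (h : Interlace x y) {i : Fin (m + 1)} {j : Fin m}
    (hij : j.castSucc < i) : y j < x i :=
  (h j).2.trans_le (h.strictMono_left.monotone (Fin.castSucc_lt_iff_succ_le.1 hij))

lemma Interlace.lt_of_le (h : Interlace x y) {i : Fin (m + 1)} {j : Fin m}
    (hij : i ≤ j.castSucc) : x i < y j :=
  (h.strictMono_left.monotone hij).trans_lt (h j).1

lemma Interlace.ne (h : Interlace x y) (i : Fin (m + 1)) (j : Fin m) : x i - y j ≠ 0 := by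
  rcases lt_or_ge j.castSucc i with hij | hij
  · exact (sub_pos.2 (h.lt_of_lt hij)).ne'
  · exact (sub_neg.2 (h.lt_of_le hij)).ne

lemma Interlace.residue_pos (h : Interlace x y) {s : ℝ} (hs : 0 < s) (i : Fin (m + 1)) :
    0 < residue x y s i := by
  refine mul_pos hs (Finset.prod_pos fun j _ => ?_)
  rcases lt_or_ge j.castSucc i with hij | hij
  · rw [Fin.succAbove_of_castSucc_lt _ _ hij]
    exact div_pos (sub_pos.2 (h.lt_of_lt hij)) (sub_pos.2 (h.strictMono_left hij))
  · rw [Fin.succAbove_of_le_castSucc _ _ hij]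
    exact div_pos_of_neg_of_neg (sub_neg.2 (h.lt_of_le hij))
      (sub_neg.2 (h.strictMono_left (hij.trans_lt (Fin.castSucc_lt_succ (i := j)))))

lemma Interlace.dualResidue_pos (h : Interlace x y) (i : Fin m) : 0 < dualResidue x y i := by
  -- the factors at `x_i` and `x_{i+1}` have opposite signs; the others pair up with `y_i - y_j`
  rw [dualResidue, Fin.prod_univ_succAbove _ i.castSucc,
    ← Finset.mul_prod_erase Finset.univ _ (Finset.mem_univ i), ← mul_assoc, mul_div_assoc,
    ← Finset.prod_div_distrib, ← neg_mul]
  refine mul_pos ?_ (Finset.prod_pos fun j hj => ?_)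
  · rw [Fin.succAbove_castSucc_self]
    have := (h i).1
    have := (h i).2
    nlinarith
  · rcases lt_or_gt_of_ne (Finset.ne_of_mem_erase hj) with hij | hij
    · rw [Fin.succAbove_of_castSucc_lt _ _ (by simpa using hij)]
      exact div_pos (sub_pos.2 ((h.strictMono_left (by simpa using hij)).trans (h i).1))
        (sub_pos.2 (h.strictMono_right hij))
    · rw [Fin.succAbove_of_le_castSucc _ _ (by simpa using hij.le)]
      exact div_pos_of_neg_of_neg
        (sub_neg.2 ((h i).2.trans (h.strictMono_left (by simpa using hij))))
        (sub_neg.2 (h.strictMono_right hij))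

end Interlacing

/-! ### Partial fractions through Lagrange interpolation -/

section Polynomials

open Polynomial

lemma eval_rootPoly {n : ℕ} (x : Fin n → ℝ) (z : ℝ) : (rootPoly x).eval z = ∏ i, (z - x i) := by
  simp [rootPoly, eval_prod]

lemma rootPoly_monic {n : ℕ} (x : Fin n → ℝ) : (rootPoly x).Monic :=
  monic_prod_of_monic _ _ fun i _ => monic_X_sub_C (x i)

lemma degree_rootPoly {n : ℕ} (x : Fin n → ℝ) : (rootPoly x).degree = n := by
  simp [rootPoly, degree_prod]

lemma coeff_rootPoly {n : ℕ} (x : Fin n → ℝ) : (rootPoly x).coeff n = 1 := by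
  have h := rootPoly_monic x
  rwa [Monic, leadingCoeff, natDegree_eq_of_degree_eq_some (degree_rootPoly x)] at h

/-- The three leading coefficients of `∏ (X - x_i)` in terms of power sums. The polynomial is
multiplied by `2 X²` to avoid truncated exponents. -/
lemma rootPoly_leading {n : ℕ} (x : Fin n → ℝ) :
    ∃ R : ℝ[X], R.degree < n ∧ C 2 * X ^ 2 * rootPoly x =
      C 2 * X ^ (n + 2) - C (2 * ∑ i, x i) * X ^ (n + 1) +
        C ((∑ i, x i) ^ 2 - ∑ i, x i ^ 2) * X ^ n + R := by
  induction n with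
  | zero => exact ⟨0, by simp, by simp [rootPoly]⟩
  | succ n ih =>
    obtain ⟨R, hR, h⟩ := ih (fun i => x i.castSucc)
    set e := ∑ i : Fin n, x i.castSucc
    set p := ∑ i : Fin n, x i.castSucc ^ 2
    refine ⟨(X - C (x (Fin.last n))) * R - C (x (Fin.last n) * (e ^ 2 - p)) * X ^ n, ?_, ?_⟩
    · have h1 : ((X - C (x (Fin.last n))) * R).degree < ((n + 1 : ℕ) : WithBot ℕ) := by
        rw [degree_mul, degree_X_sub_C]
        rcases eq_or_ne R 0 with rfl | hR0
        · simp
        · rw [degree_eq_natDegree hR0] at hR ⊢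
          have := Nat.cast_lt.1 hR
          exact_mod_cast (by omega : 1 + R.natDegree < n + 1)
      refine (degree_sub_le _ _).trans_lt (max_lt h1 ?_)
      exact (degree_C_mul_X_pow_le _ _).trans_lt (by exact_mod_cast Nat.lt_succ_self n)
    · have h2 : rootPoly x = rootPoly (fun i => x i.castSucc) * (X - C (x (Fin.last n))) := by
        simp [rootPoly, Fin.prod_univ_castSucc]
      have h3 : ∑ i, x i = e + x (Fin.last n) := Fin.sum_univ_castSucc _
      have h4 : ∑ i, x i ^ 2 = p + x (Fin.last n) ^ 2 := Fin.sum_univ_castSucc _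
      have h5 : (C 2 : ℝ[X]) = 2 := map_ofNat C 2
      rw [h2, ← mul_assoc, h, h3, h4]
      simp only [C_sub, C_mul, C_add, C_pow, h5]
      ring

/-- If two monic polynomials of degree `m + 1` have roots with the same sum, their difference has
degree less than `m`, and its coefficient of `X ^ (m - 1)` is given by the sums of squares. -/
lemma rootPoly_sub_rootPoly {m : ℕ} {x x' : Fin (m + 1) → ℝ} (h : ∑ i, x i = ∑ i, x' i) :
    (rootPoly x - rootPoly x').degree < m ∧
      ∀ k, k + 1 = m → (rootPoly x - rootPoly x').coeff k =
        (∑ i, x' i ^ 2 - ∑ i, x i ^ 2) / 2 := by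
  obtain ⟨R, hR, h1⟩ := rootPoly_leading x
  obtain ⟨R', hR', h1'⟩ := rootPoly_leading x'
  have key : C 2 * X ^ 2 * (rootPoly x - rootPoly x') =
      C (∑ i, x' i ^ 2 - ∑ i, x i ^ 2) * X ^ (m + 1) + (R - R') := by
    rw [mul_sub, h1, h1', h]; simp only [C_sub]; ring
  have hRR : (R - R').degree < (m + 1 : ℕ) := (degree_sub_le _ _).trans_lt (max_lt hR hR')
  have hc : ∀ k, m ≤ k + 1 → 2 * (rootPoly x - rootPoly x').coeff k =
      (if k + 1 = m then ∑ i, x' i ^ 2 - ∑ i, x i ^ 2 else 0) := by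
    intro k hk
    have := congrArg (fun P => coeff P (k + 2)) key
    rw [mul_assoc] at this
    simp only [coeff_C_mul, coeff_add, coeff_X_pow_mul, coeff_X_pow] at this
    rw [this, coeff_eq_zero_of_degree_lt (hRR.trans_le (by exact_mod_cast (by omega)))]
    by_cases hkm : k + 1 = m
    · simp [hkm, show k + 2 = m + 1 by omega]
    · simp [hkm, show k + 2 ≠ m + 1 by omega]
  constructor
  · rw [degree_lt_iff_coeff_zero]
    intro k hk
    have := hc k (by omega)
    rw [if_neg (by omega)] at this
    linarith
  · intro k hk
    have := hc k (by omega)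
    rw [if_pos hk] at this
    linarith

lemma eval_eq_sum_lagrange {m : ℕ} {x : Fin (m + 1) → ℝ} (hx : Function.Injective x) {P : ℝ[X]}
    (hP : P.degree < (m + 1 : ℕ)) (z : ℝ) :
    P.eval z = ∑ i, P.eval (x i) / (∏ j, (x i - x (i.succAbove j))) *
      ∏ j, (z - x (i.succAbove j)) := by
  have h := congrArg (eval z) (Lagrange.eq_interpolate (s := Finset.univ) (v := x) (f := P)
    hx.injOn (by simpa using hP))
  rw [h, Lagrange.interpolate_eq_sum]
  simp [eval_finsetSum, eval_prod, prod_erase_eq_prod_succAbove]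

lemma coeff_eq_sum_lagrange {m : ℕ} {x : Fin (m + 1) → ℝ} (hx : Function.Injective x) {P : ℝ[X]}
    (hP : P.degree < (m + 1 : ℕ)) :
    P.coeff m = ∑ i, P.eval (x i) / (∏ j, (x i - x (i.succAbove j))) := by
  have := Lagrange.coeff_eq_sum (s := Finset.univ) (v := x) hx.injOn (P := P) (by simpa using hP)
  simpa [prod_erase_eq_prod_succAbove] using this

lemma eq_of_forall_prod_sub_eq {n : ℕ} {x x' : Fin n → ℝ} (hx : StrictMono x)
    (hx' : StrictMono x') (h : ∀ z, ∏ i, (z - x i) = ∏ i, (z - x' i)) : x = x' := by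
  have aux : ∀ {x x' : Fin n → ℝ}, (∀ z, ∏ i, (z - x i) = ∏ i, (z - x' i)) →
      Set.range x ⊆ Set.range x' := by
    rintro x x' h _ ⟨i, rfl⟩
    have h0 := h (x i)
    rw [Finset.prod_eq_zero (Finset.mem_univ i) (sub_self _), eq_comm,
      Finset.prod_eq_zero_iff] at h0
    obtain ⟨j, _, hj⟩ := h0
    exact ⟨j, (sub_eq_zero.1 hj).symm⟩
  exact (hx.range_inj hx').1 ((aux h).antisymm (aux fun z => (h z).symm))

variable {m : ℕ}

lemma degree_C_mul_rootPoly_lt (s : ℝ) (y : Fin m → ℝ) :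
    (C s * rootPoly y).degree < (m + 1 : ℕ) := by
  rw [C_mul']
  refine (degree_smul_le _ _).trans_lt ?_
  rw [degree_rootPoly]
  exact_mod_cast Nat.lt_succ_self m

lemma residue_eq (x : Fin (m + 1) → ℝ) (y : Fin m → ℝ) (s : ℝ) (i : Fin (m + 1)) :
    residue x y s i = (C s * rootPoly y).eval (x i) / ∏ j, (x i - x (i.succAbove j)) := by
  rw [residue, Finset.prod_div_distrib, eval_mul, eval_C, eval_rootPoly, mul_div_assoc]

lemma sum_residue_mul_prod {x : Fin (m + 1) → ℝ} (hx : Function.Injective x) (y : Fin m → ℝ)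
    (s z : ℝ) :
    ∑ i, residue x y s i * ∏ j, (z - x (i.succAbove j)) = s * ∏ j, (z - y j) := by
  simp_rw [residue_eq]
  rw [← eval_eq_sum_lagrange hx (degree_C_mul_rootPoly_lt s y), eval_mul, eval_C, eval_rootPoly]

lemma sum_residue {x : Fin (m + 1) → ℝ} (hx : Function.Injective x) (y : Fin m → ℝ) (s : ℝ) :
    ∑ i, residue x y s i = s := by
  simp_rw [residue_eq]
  rw [← coeff_eq_sum_lagrange hx (degree_C_mul_rootPoly_lt s y), coeff_C_mul, coeff_rootPoly,
    mul_one]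

lemma sum_residue_div {x : Fin (m + 1) → ℝ} (hx : Function.Injective x) (y : Fin m → ℝ)
    (s : ℝ) {z : ℝ} (hz : ∀ i, z - x i ≠ 0) :
    ∑ i, residue x y s i / (z - x i) = s * (∏ j, (z - y j)) / ∏ i, (z - x i) := by
  rw [eq_div_iff (Finset.prod_ne_zero_iff.2 fun i _ => hz i), ← sum_residue_mul_prod hx,
    Finset.sum_mul]
  refine Finset.sum_congr rfl fun i _ => ?_
  rw [Fin.prod_univ_succAbove _ i]
  field_simp [hz i]

lemma rootPoly_cons (a : ℝ) (y : Fin m → ℝ) :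
    rootPoly (Fin.cons a y : Fin (m + 1) → ℝ) = (X - C a) * rootPoly y := by
  simp [rootPoly, Fin.prod_univ_succ]

lemma sum_cons_dualShift (x : Fin (m + 1) → ℝ) (y : Fin m → ℝ) :
    ∑ i, x i = ∑ i, (Fin.cons (dualShift x y) y : Fin (m + 1) → ℝ) i := by
  simp [Fin.sum_univ_succ, dualShift]

lemma dualResidue_eq (x : Fin (m + 1) → ℝ) (y : Fin m → ℝ) (a : ℝ) (i : Fin m) :
    -dualResidue x y i = (rootPoly x - rootPoly (Fin.cons a y : Fin (m + 1) → ℝ)).eval (y i) /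
      ∏ j ∈ Finset.univ.erase i, (y i - y j) := by
  rw [dualResidue, rootPoly_cons, eval_sub, eval_mul, eval_rootPoly y,
    Finset.prod_eq_zero (Finset.mem_univ i) (sub_self (y i)), mul_zero, sub_zero, eval_rootPoly,
    neg_neg]

/-- The partial fraction expansion that defines `dualShift` and `dualResidue`, with denominators
cleared. -/
lemma prod_sub_eq_dual (x : Fin (m + 1) → ℝ) {y : Fin m → ℝ} (hy : Function.Injective y) (z : ℝ) :
    ∏ i, (z - x i) = (z - dualShift x y) * ∏ j, (z - y j) -
      ∑ i, dualResidue x y i * ∏ j ∈ Finset.univ.erase i, (z - y j) := by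
  have hd := (rootPoly_sub_rootPoly (sum_cons_dualShift x y)).1
  have h := congrArg (eval z) (Lagrange.eq_interpolate (s := Finset.univ) (v := y) hy.injOn
    (by simpa using hd))
  rw [Lagrange.interpolate_eq_sum] at h
  simp only [eval_finsetSum, eval_mul, eval_C, eval_prod, ← dualResidue_eq] at h
  rw [eval_sub, rootPoly_cons, eval_mul, eval_rootPoly, eval_rootPoly] at h
  simp only [eval_sub, eval_X, eval_C, neg_mul, Finset.sum_neg_distrib] at h
  linarith

lemma prod_sub_div_eq_dual (x : Fin (m + 1) → ℝ) {y : Fin m → ℝ} (hy : Function.Injective y)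
    {z : ℝ} (hz : ∀ i, z - y i ≠ 0) :
    (∏ i, (z - x i)) / ∏ j, (z - y j) =
      z - dualShift x y - ∑ i, dualResidue x y i / (z - y i) := by
  rw [div_eq_iff (Finset.prod_ne_zero_iff.2 fun i _ => hz i), prod_sub_eq_dual x hy,
    sub_mul (z - dualShift x y), Finset.sum_mul]
  congr 1
  refine Finset.sum_congr rfl fun i _ => ?_
  rw [← Finset.mul_prod_erase Finset.univ _ (Finset.mem_univ i)]
  field_simp [hz i]

/-- The trace of the square of the tridiagonal model, read off from the coefficient of degree `m - 1`
in `∏ (z - x_i)`. -/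
lemma sum_sq_eq_dual (x : Fin (m + 1) → ℝ) {y : Fin m → ℝ} (hy : Function.Injective y) :
    ∑ i, x i ^ 2 = dualShift x y ^ 2 + 2 * ∑ i, dualResidue x y i + ∑ i, y i ^ 2 := by
  rcases m with _ | m
  · simp [dualShift]
  obtain ⟨hd, hc⟩ := rootPoly_sub_rootPoly (sum_cons_dualShift x y)
  have h := Lagrange.coeff_eq_sum (s := Finset.univ) (v := y) hy.injOn (by simpa using hd)
  simp only [← dualResidue_eq] at h
  rw [Finset.card_univ, Fintype.card_fin, Nat.add_sub_cancel, hc m rfl] at h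
  simp only [Finset.sum_neg_distrib] at h
  rw [Fin.sum_univ_succ (n := m + 1)] at h
  simp only [Fin.cons_zero, Fin.cons_succ] at h
  linarith

end Polynomials

/-! ### Solving for the interlacing points -/

section Existence

variable {m : ℕ}

/-- For increasing nodes, the products `∏_{j ≠ i} (x_i - x_j)` alternate in sign. -/
lemma prod_succAbove_mul_neg {x : Fin (m + 1) → ℝ} (hx : StrictMono x) (i : Fin m) :
    (∏ j, (x i.castSucc - x (i.castSucc.succAbove j))) *
      ∏ j, (x i.succ - x (i.succ.succAbove j)) < 0 := by
  rw [← Finset.prod_mul_distrib, ← Finset.mul_prod_erase Finset.univ _ (Finset.mem_univ i)]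
  refine mul_neg_of_neg_of_pos ?_ (Finset.prod_pos fun j hj => ?_)
  · rw [Fin.succAbove_castSucc_self, Fin.succAbove_succ_self]
    have := hx (Fin.castSucc_lt_succ (i := i))
    nlinarith
  · rcases lt_or_gt_of_ne (Finset.ne_of_mem_erase hj) with hij | hij
    · rw [Fin.succAbove_of_castSucc_lt _ _ (by simpa using hij),
        Fin.succAbove_of_castSucc_lt _ _ (by
          rw [Fin.lt_def] at hij ⊢; simp only [Fin.val_castSucc, Fin.val_succ]; omega)]
      exact mul_pos (sub_pos.2 (hx (by simpa using hij))) (sub_pos.2 (hx (by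
          rw [Fin.lt_def] at hij ⊢; simp only [Fin.val_castSucc, Fin.val_succ]; omega)))
    · rw [Fin.succAbove_of_le_castSucc _ _ (by simpa using hij.le),
        Fin.succAbove_of_le_castSucc _ _ (by
          rw [Fin.lt_def] at hij; rw [Fin.le_def]
          simp only [Fin.val_castSucc, Fin.val_succ]; omega)]
      exact mul_pos_of_neg_of_neg (sub_neg.2 (hx (by
          rw [Fin.lt_def] at hij ⊢; simp only [Fin.val_castSucc, Fin.val_succ]; omega)))
        (sub_neg.2 (hx (by simpa using hij)))

open Polynomial in
/-- A rational function `∑ w_i / (z - x_i)` with positive residues has zeros interlacing its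
poles. -/
lemma exists_interlace_of_pos {x : Fin (m + 1) → ℝ} (hx : StrictMono x) {w : Fin (m + 1) → ℝ}
    (hw : ∀ i, 0 < w i) :
    ∃ y : Fin m → ℝ, Interlace x y ∧ ∀ z,
      ∑ i, w i * ∏ j, (z - x (i.succAbove j)) = (∑ i, w i) * ∏ j, (z - y j) := by
  set q : ℝ[X] := ∑ i, C (w i) * ∏ j, (X - C (x (i.succAbove j))) with hq
  have hqz : ∀ z, q.eval z = ∑ i, w i * ∏ j, (z - x (i.succAbove j)) := by
    intro z; simp [hq, eval_finsetSum, eval_prod]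
  have hqx : ∀ i, q.eval (x i) = w i * ∏ j, (x i - x (i.succAbove j)) := by
    intro i
    rw [hqz]
    refine Finset.sum_eq_single_of_mem i (Finset.mem_univ i) fun k _ hk => ?_
    obtain ⟨j, hj⟩ := Fin.exists_succAbove_eq hk.symm
    rw [Finset.prod_eq_zero (Finset.mem_univ j) (by rw [hj, sub_self]), mul_zero]
  have hdeg : q.degree < (m + 1 : ℕ) := by
    refine (degree_sum_le _ _).trans_lt ((Finset.sup_lt_iff (WithBot.bot_lt_coe _)).2 fun i _ => ?_)
    rw [C_mul']
    refine (degree_smul_le _ _).trans_lt ?_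
    rw [degree_prod]
    simp only [degree_X_sub_C, Finset.sum_const, Finset.card_univ, Fintype.card_fin, nsmul_eq_mul,
      mul_one]
    exact_mod_cast Nat.lt_succ_self m
  have hroot : ∀ i : Fin m, ∃ y, (x i.castSucc < y ∧ y < x i.succ) ∧ q.eval y = 0 := by
    intro i
    have hlt := hx (Fin.castSucc_lt_succ (i := i))
    have hneg : q.eval (x i.castSucc) * q.eval (x i.succ) < 0 := by
      rw [hqx, hqx]
      have := mul_pos (hw i.castSucc) (hw i.succ)
      have := mul_neg_of_pos_of_neg this (prod_succAbove_mul_neg hx i)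
      linarith
    rcases mul_neg_iff.1 hneg with ⟨h1, h2⟩ | ⟨h1, h2⟩
    · obtain ⟨y, hy, hy0⟩ := intermediate_value_Ioo' hlt.le q.continuous.continuousOn
        (Set.mem_Ioo.2 ⟨h2, h1⟩)
      exact ⟨y, hy, hy0⟩
    · obtain ⟨y, hy, hy0⟩ := intermediate_value_Ioo hlt.le q.continuous.continuousOn
        (Set.mem_Ioo.2 ⟨h1, h2⟩)
      exact ⟨y, hy, hy0⟩
  choose y hy hy0 using hroot
  have hI : Interlace x y := hy
  refine ⟨y, hI, fun z => ?_⟩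
  have hcoeff : q.coeff m = ∑ i, w i := by
    rw [coeff_eq_sum_lagrange hx.injective hdeg]
    refine Finset.sum_congr rfl fun i _ => ?_
    rw [hqx, mul_div_assoc, div_self, mul_one]
    exact Finset.prod_ne_zero_iff.2 fun j _ =>
      sub_ne_zero.2 fun h => Fin.succAbove_ne i j (hx.injective h).symm
  have hzero : q - C (∑ i, w i) * rootPoly y = 0 := by
    refine eq_zero_of_degree_lt_of_eval_index_eq_zero (s := Finset.univ) (v := y)
      hI.strictMono_right.injective.injOn ?_ fun i _ => ?_
    · rw [Finset.card_univ, Fintype.card_fin, degree_lt_iff_coeff_zero]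
      intro k hk
      rcases eq_or_lt_of_le hk with rfl | hk
      · rw [coeff_sub, hcoeff, coeff_C_mul, coeff_rootPoly, mul_one, sub_self]
      · exact coeff_eq_zero_of_degree_lt (((degree_sub_le _ _).trans_lt
          (max_lt hdeg (degree_C_mul_rootPoly_lt _ y))).trans_le (by exact_mod_cast hk))
    · rw [eval_sub, hy0, eval_mul, eval_rootPoly,
        Finset.prod_eq_zero (Finset.mem_univ i) (sub_self _), mul_zero, sub_zero]
  rw [← hqz, sub_eq_zero.1 hzero, eval_mul, eval_C, eval_rootPoly]

lemma exists_residue_eq {x : Fin (m + 1) → ℝ} (hx : StrictMono x) {w : Fin (m + 1) → ℝ}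
    (hw : ∀ i, 0 < w i) : ∃ y : Fin m → ℝ, Interlace x y ∧ ∀ i, residue x y (∑ i, w i) i = w i := by
  obtain ⟨y, hy, h⟩ := exists_interlace_of_pos hx hw
  refine ⟨y, hy, fun i => ?_⟩
  have hne : ∏ j, (x i - x (i.succAbove j)) ≠ 0 := Finset.prod_ne_zero_iff.2 fun j _ =>
      sub_ne_zero.2 fun h => Fin.succAbove_ne i j (hx.injective h).symm
  rw [residue, Finset.prod_div_distrib, ← mul_div_assoc, ← h, div_eq_iff hne]
  refine Finset.sum_eq_single_of_mem i (Finset.mem_univ i) fun k _ hk => ?_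
  obtain ⟨j, hj⟩ := Fin.exists_succAbove_eq hk.symm
  rw [Finset.prod_eq_zero (Finset.mem_univ j) (by rw [hj, sub_self]), mul_zero]

lemma residue_injective {x : Fin (m + 1) → ℝ} {y y' : Fin m → ℝ} {s s' : ℝ} (hs : 0 < s)
    (h : Interlace x y) (h' : Interlace x y') (heq : residue x y s = residue x y' s') :
    s = s' ∧ y = y' := by
  have hx := h.strictMono_left.injective
  have hss : s = s' := by rw [← sum_residue hx y s, heq, sum_residue hx]
  refine ⟨hss, eq_of_forall_prod_sub_eq h.strictMono_right h'.strictMono_right fun z => ?_⟩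
  refine mul_left_cancel₀ hs.ne' ?_
  rw [← sum_residue_mul_prod hx, heq, sum_residue_mul_prod hx, hss]

lemma strictMono_cons {f : Fin m → ℝ} (hf : StrictMono f) {a : ℝ} (ha : ∀ i, a < f i) :
    StrictMono (Fin.cons a f : Fin (m + 1) → ℝ) := by
  intro i j
  refine Fin.cases ?_ (fun i => ?_) i <;> refine Fin.cases ?_ (fun j => ?_) j
  · simp
  · simpa using ha j
  · simp
  · simpa using fun h => hf h

lemma strictMono_snoc {f : Fin m → ℝ} (hf : StrictMono f) {a : ℝ} (ha : ∀ i, f i < a) :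
    StrictMono (Fin.snoc f a : Fin (m + 1) → ℝ) := by
  intro i j
  refine Fin.lastCases ?_ (fun i => ?_) i <;> refine Fin.lastCases ?_ (fun j => ?_) j
  · simp
  · simp [Fin.lt_def, j.2.le]
  · simpa using ha i
  · simpa using fun h => hf h

open Polynomial in
/-- The function `z - a - ∑ r_i / (z - y_i)` with positive `r_i` has `m + 1` zeros interlacing its
poles. -/
lemma exists_dualResidue_eq {y : Fin m → ℝ} (hy : StrictMono y) {r : Fin m → ℝ}
    (hr : ∀ i, 0 < r i) (a : ℝ) :
    ∃ x : Fin (m + 1) → ℝ, Interlace x y ∧ dualShift x y = a ∧ dualResidue x y = r := by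
  -- `±N` are added to the nodes, with `N` so large that the function has the sign of `±N` there
  set N : ℝ := 1 + |a| + ∑ i, |y i| + ∑ i, r i with hN
  have hr0 : 0 ≤ ∑ i, r i := Finset.sum_nonneg fun i _ => (hr i).le
  have hyN : ∀ i, |y i| ≤ N - 1 := fun i => by
    have := Finset.single_le_sum (f := fun i => |y i|) (fun i _ => abs_nonneg _)
      (Finset.mem_univ i)
    have := abs_nonneg a
    linarith
  have hy1 : ∀ i, 1 ≤ N - y i := fun i => by linarith [hyN i, le_abs_self (y i)]
  have hy2 : ∀ i, 1 ≤ y i + N := fun i => by linarith [hyN i, neg_abs_le (y i)]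
  have hy0 : 0 ≤ ∑ i, |y i| := Finset.sum_nonneg fun i _ => abs_nonneg _
  have hN1 : 1 ≤ N := by linarith [abs_nonneg a]
  set Y : Fin (m + 1 + 1) → ℝ := Fin.cons (-N) (Fin.snoc y N) with hY
  have hY0 : Y 0 = -N := rfl
  have hYl : Y (Fin.last (m + 1)) = N := by
    rw [hY, ← Fin.succ_last, Fin.cons_succ, Fin.snoc_last]
  have hYm : ∀ i : Fin m, Y i.castSucc.succ = y i := fun i => by
    rw [hY, Fin.cons_succ, Fin.snoc_castSucc]
  have hYmono : StrictMono Y := by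
    refine strictMono_cons (strictMono_snoc hy fun i => by linarith [hy1 i]) fun i => ?_
    refine Fin.lastCases ?_ (fun i => ?_) i
    · rw [Fin.snoc_last]; linarith
    · rw [Fin.snoc_castSucc]; linarith [hy2 i]
  set p : ℝ[X] := (X - C a) * rootPoly y -
    ∑ i, C (r i) * ∏ j ∈ Finset.univ.erase i, (X - C (y j)) with hp
  have hpz : ∀ z, p.eval z = (z - a) * ∏ j, (z - y j) -
      ∑ i, r i * ∏ j ∈ Finset.univ.erase i, (z - y j) := by
    intro z; simp [hp, eval_finsetSum, eval_prod, rootPoly]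
  have hpy : ∀ i, p.eval (y i) = -(r i * ∏ j ∈ Finset.univ.erase i, (y i - y j)) := by
    intro i
    rw [hpz, Finset.prod_eq_zero (Finset.mem_univ i) (sub_self _), mul_zero, zero_sub, neg_inj]
    refine Finset.sum_eq_single_of_mem i (Finset.mem_univ i) fun k _ hk => ?_
    rw [Finset.prod_eq_zero (Finset.mem_erase.2 ⟨hk.symm, Finset.mem_univ i⟩) (sub_self _),
      mul_zero]
  have hpdiv : ∀ z, (∀ i, z - y i ≠ 0) →
      p.eval z = (z - a - ∑ i, r i / (z - y i)) * ∏ j, (z - y j) := by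
    intro z hz
    rw [hpz, sub_mul (z - a), Finset.sum_mul]
    congr 1
    refine Finset.sum_congr rfl fun i _ => ?_
    rw [← Finset.mul_prod_erase Finset.univ _ (Finset.mem_univ i)]
    field_simp [hz i]
  have hplow : (p - (X - C a) * rootPoly y).degree < ((m : ℕ) : WithBot ℕ) := by
    rw [hp, sub_sub_cancel_left, degree_neg]
    refine (degree_sum_le _ _).trans_lt ((Finset.sup_lt_iff (WithBot.bot_lt_coe _)).2 fun i _ => ?_)
    rw [C_mul']
    refine (degree_smul_le _ _).trans_lt ?_
    rw [degree_prod]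
    simp only [degree_X_sub_C, Finset.sum_const, nsmul_eq_mul, mul_one]
    have : (Finset.univ.erase i).card < m := by
      rw [Finset.card_erase_of_mem (Finset.mem_univ i), Finset.card_univ, Fintype.card_fin]
      have := i.pos
      omega
    exact_mod_cast this
  have hlow' : ∀ k, m ≤ k → p.coeff k = ((X - C a) * rootPoly y).coeff k := fun k hk => by
    rw [← sub_eq_zero, ← coeff_sub]
    exact coeff_eq_zero_of_degree_lt (hplow.trans_le (by exact_mod_cast hk))
  have hpdeg : p.degree < (m + 1 + 1 : ℕ) := by
    rw [degree_lt_iff_coeff_zero]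
    intro k hk
    rw [hlow' k (by omega), ← rootPoly_cons]
    refine coeff_eq_zero_of_degree_lt ?_
    rw [degree_rootPoly]
    exact_mod_cast hk
  have hplead : p.coeff (m + 1) = 1 := by
    rw [hlow' _ (by omega), ← rootPoly_cons, coeff_rootPoly]
  set W : Fin (m + 1 + 1) → ℝ := fun k => p.eval (Y k) / ∏ j, (Y k - Y (k.succAbove j)) with hW
  have hWpos : ∀ k, 0 < W k := by
    intro k
    refine Fin.cases ?_ (fun k => ?_) k
    · have hne : ∀ i, -N - y i < 0 := fun i => by linarith [hy2 i]
      have hP : (∏ i, (-N - y i)) ≠ 0 := Finset.prod_ne_zero_iff.2 fun i _ => (hne i).ne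
      have h1 : ∏ j, (Y 0 - Y ((0 : Fin (m + 1 + 1)).succAbove j)) =
          (∏ i, (-N - y i)) * (-N - N) := by
        rw [Fin.prod_univ_castSucc]
        simp only [Fin.succAbove_zero, hYm, hY0, Fin.succ_last, hYl]
      simp only [hW]
      rw [h1, hY0, hpdiv _ fun i => (hne i).ne, mul_comm, mul_div_mul_left _ _ hP]
      refine div_pos_of_neg_of_neg ?_ (by linarith)
      have h2 : -∑ i, r i / (-N - y i) ≤ ∑ i, r i := by
        rw [← Finset.sum_neg_distrib]
        refine Finset.sum_le_sum fun i _ => ?_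
        rw [← div_neg]
        exact div_le_self (hr i).le (by linarith [hy2 i])
      linarith [neg_abs_le a]
    · refine Fin.lastCases ?_ (fun i => ?_) k
      · have hne : ∀ i, 0 < N - y i := fun i => by linarith [hy1 i]
        have hP : (∏ i, (N - y i)) ≠ 0 := Finset.prod_ne_zero_iff.2 fun i _ => (hne i).ne'
        have h1 : ∏ j, (Y (Fin.last m).succ - Y ((Fin.last m).succ.succAbove j)) =
            (∏ i, (N - y i)) * (N + N) := by
          rw [Fin.prod_univ_succ, Fin.succ_last]
          simp only [Fin.succAbove_last, hYl, Fin.castSucc_zero, hY0, ← Fin.succ_castSucc, hYm]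
          ring
        simp only [hW]
        rw [h1, Fin.succ_last, hYl, hpdiv _ fun i => (hne i).ne', mul_comm,
          mul_div_mul_left _ _ hP]
        refine div_pos ?_ (by linarith)
        have h2 : ∑ i, r i / (N - y i) ≤ ∑ i, r i :=
          Finset.sum_le_sum fun i _ => div_le_self (hr i).le (hy1 i)
        linarith [le_abs_self a]
      · have hE : ∏ j ∈ Finset.univ.erase i, (y i - y j) ≠ 0 :=
          Finset.prod_ne_zero_iff.2 fun j hj =>
            sub_ne_zero.2 fun h => Finset.ne_of_mem_erase hj (hy.injective h).symm
        have h1 : ∏ j, (Y i.castSucc.succ - Y (i.castSucc.succ.succAbove j)) =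
            (∏ j ∈ Finset.univ.erase i, (y i - y j)) * ((y i + N) * (y i - N)) := by
          rw [← prod_erase_eq_prod_succAbove i.castSucc.succ
            (fun k => Y i.castSucc.succ - Y k), ← Finset.filter_ne', Finset.prod_filter,
            Fin.prod_univ_succ, Fin.prod_univ_castSucc, ← Finset.filter_ne', Finset.prod_filter]
          simp only [hYm, hY0, Fin.succ_last, hYl, Fin.succ_inj, Fin.castSucc_inj, ne_eq]
          rw [if_pos (by simp [Fin.ext_iff]), if_pos (by simp [Fin.ext_iff]; omega)]
          ring
        simp only [hW]
        rw [h1, hYm, hpy, ← neg_mul, mul_comm (-r i), mul_div_mul_left _ _ hE]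
        have := hr i
        have h3 := hy1 i
        have h4 := hy2 i
        refine div_pos_of_neg_of_neg (by linarith) ?_
        exact mul_neg_of_pos_of_neg (by linarith) (by linarith)
  obtain ⟨x, hxI, hx⟩ := exists_interlace_of_pos hYmono hWpos
  have hWsum : ∑ k, W k = 1 := by
    rw [← hplead, coeff_eq_sum_lagrange hYmono.injective hpdeg]
  have hpx : ∀ z, p.eval z = ∏ i, (z - x i) := by
    intro z
    rw [eval_eq_sum_lagrange hYmono.injective hpdeg, ← one_mul (∏ i, (z - x i)), ← hWsum, ← hx]
  have hI : Interlace x y := fun i => by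
    have h1 := hxI i.castSucc
    have h2 := hxI i.succ
    rw [hYm] at h1
    rw [← Fin.succ_castSucc, hYm] at h2
    exact ⟨h1.2, h2.1⟩
  have hres : dualResidue x y = r := by
    funext i
    have hE : ∏ j ∈ Finset.univ.erase i, (y i - y j) ≠ 0 :=
      Finset.prod_ne_zero_iff.2 fun j hj =>
        sub_ne_zero.2 fun h => Finset.ne_of_mem_erase hj (hy.injective h).symm
    rw [dualResidue, ← hpx, hpy, neg_div, neg_neg, mul_div_cancel_right₀ _ hE]
  refine ⟨x, hI, ?_, hres⟩
  have h1 := prod_sub_eq_dual x hy.injective N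
  rw [← hpx, hpz, hres, sub_left_inj] at h1
  have h2 := mul_right_cancel₀ (Finset.prod_ne_zero_iff.2 fun i _ => by linarith [hy1 i]) h1
  linarith

lemma dual_injective {x x' : Fin (m + 1) → ℝ} {y : Fin m → ℝ} (h : Interlace x y)
    (h' : Interlace x' y) (ha : dualShift x y = dualShift x' y)
    (hr : dualResidue x y = dualResidue x' y) : x = x' := by
  refine eq_of_forall_prod_sub_eq h.strictMono_left h'.strictMono_left fun z => ?_
  have hy := h.strictMono_right.injective
  rw [prod_sub_eq_dual x hy, prod_sub_eq_dual x' hy, ha, hr]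

end Existence

/-! ### The bordered Cauchy determinant -/

section Determinant

variable {m : ℕ}

/-- The absolute value `∏_{i < j} |x_i - x_j|` of the Vandermonde determinant. -/
def vdm {n : ℕ} (x : Fin n → ℝ) : ℝ := ∏ i, ∏ j ∈ Finset.Ioi i, |x i - x j|

/-- The product `∏_{i, j} |x_i - y_j|`. -/
def crossProd {n m : ℕ} (x : Fin n → ℝ) (y : Fin m → ℝ) : ℝ := ∏ i, ∏ j, |x i - y j|

lemma vdm_pos {n : ℕ} {x : Fin n → ℝ} (hx : Function.Injective x) : 0 < vdm x :=
  Finset.prod_pos fun _ _ => Finset.prod_pos fun _ hj =>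
    abs_pos.2 (sub_ne_zero.2 fun h => (Finset.mem_Ioi.1 hj).ne (hx h))

lemma abs_det_vandermonde {n : ℕ} (x : Fin n → ℝ) : |(Matrix.vandermonde x).det| = vdm x := by
  rw [Matrix.det_vandermonde, Finset.abs_prod, vdm]
  refine Finset.prod_congr rfl fun i _ => ?_
  rw [Finset.abs_prod]
  exact Finset.prod_congr rfl fun j _ => abs_sub_comm _ _

/-- Each unordered pair occurs twice on the left. -/
lemma prod_prod_erase {n : ℕ} (x : Fin n → ℝ) :
    ∏ i, ∏ j ∈ Finset.univ.erase i, |x i - x j| = vdm x ^ 2 := by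
  have h : ∀ i : Fin n, ∏ j ∈ Finset.univ.erase i, |x i - x j| =
      (∏ j ∈ Finset.Ioi i, |x i - x j|) * ∏ j ∈ Finset.Iio i, |x i - x j| := by
    intro i
    rw [← Finset.prod_union (Finset.disjoint_left.2 fun j h1 h2 =>
      lt_asymm (Finset.mem_Ioi.1 h1) (Finset.mem_Iio.1 h2))]
    refine Finset.prod_congr ?_ fun _ _ => rfl
    ext j
    simp only [Finset.mem_erase, Finset.mem_univ, and_true, Finset.mem_union, Finset.mem_Ioi,
      Finset.mem_Iio]
    rw [ne_comm, lt_or_lt_iff_ne]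
  simp_rw [h]
  rw [Finset.prod_mul_distrib, sq, vdm]
  congr 1
  rw [Finset.prod_comm' (s' := fun j => Finset.Ioi j) (t' := Finset.univ) (by simp)]
  exact Finset.prod_congr rfl fun i _ => Finset.prod_congr rfl fun j _ => abs_sub_comm _ _

/-- The Cauchy matrix `1 / (x_i - y_j)`, bordered by a column of ones. -/
def borderedCauchy (x : Fin (m + 1) → ℝ) (y : Fin m → ℝ) : Matrix (Fin (m + 1)) (Fin (m + 1)) ℝ :=
  Matrix.of fun i => Fin.cons 1 fun j => (x i - y j)⁻¹

open Polynomial in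
/-- Clearing denominators in the bordered Cauchy matrix gives the values at the `x_i` of `m + 1`
polynomials of degree at most `m`. Their coefficient matrix is evaluated by means of the values of
the same polynomials at the `y_j`. -/
lemma abs_det_borderedCauchy {x : Fin (m + 1) → ℝ} {y : Fin m → ℝ} (hy : Function.Injective y)
    (hxy : ∀ i j, x i - y j ≠ 0) :
    |(borderedCauchy x y).det| * crossProd x y = vdm x * vdm y := by
  set P : Fin (m + 1) → ℝ[X] := Fin.cons (rootPoly y)
    fun j => ∏ k ∈ Finset.univ.erase j, (X - C (y k)) with hP
  have hdeg' : ∀ j : Fin m, (P j.succ).degree < ((m : ℕ) : WithBot ℕ) := by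
    intro j
    rw [hP, Fin.cons_succ, degree_prod]
    simp only [degree_X_sub_C, Finset.sum_const, nsmul_eq_mul, mul_one]
    have : (Finset.univ.erase j).card < m := by
      rw [Finset.card_erase_of_mem (Finset.mem_univ j), Finset.card_univ, Fintype.card_fin]
      have := j.pos
      omega
    exact_mod_cast this
  have hdeg : ∀ c, (P c).natDegree < m + 1 := by
    intro c
    refine Fin.cases ?_ (fun j => ?_) c
    · rw [hP, Fin.cons_zero, natDegree_eq_of_degree_eq_some (degree_rootPoly y)]
      exact Nat.lt_succ_self m
    · exact Nat.lt_succ_of_le (natDegree_le_of_degree_le (hdeg' j).le)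
  set K : Matrix (Fin (m + 1)) (Fin (m + 1)) ℝ := Matrix.of fun k c => (P c).coeff k with hK
  set K' : Matrix (Fin m) (Fin m) ℝ := Matrix.of fun k j => (P j.succ).coeff k with hK'
  have h1 : Matrix.of (fun i c => (∏ j, (x i - y j)) * borderedCauchy x y i c) =
      Matrix.vandermonde x * K := by
    ext i c
    have h2 : (Matrix.vandermonde x * K) i c = (P c).eval (x i) := by
      rw [eval_eq_sum_range' (hdeg c), Finset.sum_range, Matrix.mul_apply]
      exact Finset.sum_congr rfl fun k _ => by
        rw [Matrix.vandermonde_apply, hK, Matrix.of_apply, mul_comm]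
    rw [h2, Matrix.of_apply, borderedCauchy, Matrix.of_apply]
    refine Fin.cases ?_ (fun j => ?_) c
    · rw [Fin.cons_zero, mul_one, hP, Fin.cons_zero, eval_rootPoly]
    · rw [Fin.cons_succ, hP, Fin.cons_succ, eval_prod,
        ← Finset.mul_prod_erase Finset.univ _ (Finset.mem_univ j), mul_comm, ← mul_assoc,
        inv_mul_cancel₀ (hxy i j), one_mul]
      simp
  have h3 : |K'.det| = vdm y := by
    have h4 : Matrix.vandermonde y * K' =
        Matrix.diagonal fun i => ∏ j ∈ Finset.univ.erase i, (y i - y j) := by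
      ext i j
      have h5 : (Matrix.vandermonde y * K') i j = (P j.succ).eval (y i) := by
        rw [eval_eq_sum_range' (n := m) ?_, Finset.sum_range, Matrix.mul_apply]
        · exact Finset.sum_congr rfl fun k _ => by
            rw [Matrix.vandermonde_apply, hK', Matrix.of_apply, mul_comm]
        · have := hdeg' j
          by_cases h0 : P j.succ = 0
          · rw [h0, natDegree_zero]; exact j.pos
          · exact (natDegree_lt_iff_degree_lt h0).2 this
      rw [h5, hP, Fin.cons_succ, eval_prod]
      simp only [eval_sub, eval_X, eval_C]
      rcases eq_or_ne i j with rfl | hij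
      · rw [Matrix.diagonal_apply_eq]
      · rw [Matrix.diagonal_apply_ne _ hij]
        exact Finset.prod_eq_zero (Finset.mem_erase.2 ⟨hij, Finset.mem_univ i⟩) (sub_self _)
    have h6 := congrArg (fun A : Matrix (Fin m) (Fin m) ℝ => |A.det|) h4
    simp only [Matrix.det_mul, Matrix.det_diagonal, abs_mul, Finset.abs_prod,
      abs_det_vandermonde, prod_prod_erase, sq] at h6
    exact mul_left_cancel₀ (vdm_pos hy).ne' h6
  have h7 : |K.det| = vdm y := by
    rw [Matrix.det_succ_row K (Fin.last m), Finset.sum_eq_single_of_mem 0 (Finset.mem_univ 0)]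
    · have h8 : K.submatrix (Fin.last m).succAbove (0 : Fin (m + 1)).succAbove = K' := by
        ext k j
        simp [hK, hK']
      have h9 : K (Fin.last m) 0 = 1 := by
        simp [hK, hP, coeff_rootPoly]
      rw [h8, h9, abs_mul, abs_mul, abs_pow, abs_neg, abs_one, one_pow, one_mul, one_mul, h3]
    · intro c _ hc
      obtain ⟨j, rfl⟩ := Fin.exists_succ_eq.2 hc
      have h8 : K (Fin.last m) j.succ = 0 := by
        rw [hK, Matrix.of_apply, Fin.val_last]
        exact coeff_eq_zero_of_degree_lt (hdeg' j)
      rw [h8, mul_zero, zero_mul]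
  have h10 := congrArg (fun A : Matrix (Fin (m + 1)) (Fin (m + 1)) ℝ => |A.det|) h1
  simp only [Matrix.det_mul, abs_mul, abs_det_vandermonde, h7] at h10
  rw [Matrix.det_mul_column, abs_mul, Finset.abs_prod] at h10
  rw [← h10, crossProd, mul_comm]
  congr 1
  exact Finset.prod_congr rfl fun i _ => (Finset.abs_prod _ _).symm

lemma crossProd_pos {x : Fin (m + 1) → ℝ} {y : Fin m → ℝ} (h : Interlace x y) :
    0 < crossProd x y :=
  Finset.prod_pos fun i _ => Finset.prod_pos fun j _ => abs_pos.2 (h.ne i j)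

lemma prod_residue {x : Fin (m + 1) → ℝ} {y : Fin m → ℝ} (h : Interlace x y) {s : ℝ}
    (hs : 0 < s) : ∏ i, residue x y s i = s ^ (m + 1) * crossProd x y / vdm x ^ 2 := by
  have h1 : ∀ i, residue x y s i =
      s * ((∏ j, |x i - y j|) / ∏ j ∈ Finset.univ.erase i, |x i - x j|) := by
    intro i
    rw [prod_erase_eq_prod_succAbove i (fun j => |x i - x j|), ← Finset.prod_div_distrib,
      ← abs_of_pos (h.residue_pos hs i), residue, abs_mul, abs_of_pos hs, Finset.abs_prod]
    simp only [abs_div]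
  simp_rw [h1]
  rw [Finset.prod_mul_distrib, Finset.prod_div_distrib, prod_prod_erase, Finset.prod_const,
    Finset.card_univ, Fintype.card_fin, mul_div_assoc]
  rfl

lemma prod_dualResidue {x : Fin (m + 1) → ℝ} {y : Fin m → ℝ} (h : Interlace x y) :
    ∏ i, dualResidue x y i = crossProd x y / vdm y ^ 2 := by
  have h1 : ∀ i, dualResidue x y i =
      (∏ j, |x j - y i|) / ∏ j ∈ Finset.univ.erase i, |y i - y j| := by
    intro i
    rw [← abs_of_pos (h.dualResidue_pos i), dualResidue, abs_neg, abs_div, Finset.abs_prod,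
      Finset.abs_prod]
    simp only [abs_sub_comm (y i) (x _)]
  simp_rw [h1]
  rw [Finset.prod_div_distrib, prod_prod_erase, Finset.prod_comm]
  rfl

end Determinant

/-! ### Weights as functions of the interlacing points -/

section ChangeOfVariables

variable {m : ℕ}

lemma hasFDerivAt_of_matrix {n : ℕ} {F : (Fin n → ℝ) → Fin n → ℝ} {J : Matrix (Fin n) (Fin n) ℝ}
    {u : Fin n → ℝ}
    (h : ∀ i, HasFDerivAt (fun u => F u i)
      (∑ c, J i c • ContinuousLinearMap.proj (R := ℝ) (φ := fun _ : Fin n => ℝ) c) u) :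
    HasFDerivAt F (LinearMap.toContinuousLinearMap (Matrix.toLin' J)) u := by
  rw [hasFDerivAt_pi']
  intro i
  refine (h i).congr_fderiv ?_
  ext v
  simp [Matrix.mulVec, dotProduct]

lemma hasFDerivAt_prod_of_ne_zero {ι E : Type*} [Fintype ι] [NormedAddCommGroup E]
    [NormedSpace ℝ E] {g : ι → E → ℝ} {g' : ι → E →L[ℝ] ℝ} {u : E}
    (hg : ∀ i, HasFDerivAt (g i) (g' i) u) (h0 : ∀ i, g i u ≠ 0) :
    HasFDerivAt (fun u => ∏ i, g i u) ((∏ i, g i u) • ∑ i, (g i u)⁻¹ • g' i) u := by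
  classical
  refine (HasFDerivAt.finsetProd (u := Finset.univ) (fun i _ => hg i)).congr_fderiv ?_
  rw [Finset.smul_sum]
  refine Finset.sum_congr rfl fun i _ => ?_
  rw [smul_smul, ← Finset.mul_prod_erase Finset.univ _ (Finset.mem_univ i), mul_right_comm,
    mul_inv_cancel₀ (h0 i), one_mul]

lemma measurableSet_interlace :
    MeasurableSet {p : (Fin (m + 1) → ℝ) × (Fin m → ℝ) | Interlace p.1 p.2} := by
  have h : {p : (Fin (m + 1) → ℝ) × (Fin m → ℝ) | Interlace p.1 p.2} =
      ⋂ i : Fin m, ({p | p.1 i.castSucc < p.2 i} ∩ {p | p.2 i < p.1 i.succ}) := by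
    ext p; simp [Interlace]
  rw [h]
  exact MeasurableSet.iInter fun i => (measurableSet_lt (by fun_prop) (by fun_prop)).inter
    (measurableSet_lt (by fun_prop) (by fun_prop))

lemma measurableSet_interlace_left (x : Fin (m + 1) → ℝ) :
    MeasurableSet {y : Fin m → ℝ | Interlace x y} :=
  measurableSet_interlace.preimage (measurable_const.prodMk measurable_id)

lemma measurableSet_interlace_right (y : Fin m → ℝ) :
    MeasurableSet {x : Fin (m + 1) → ℝ | Interlace x y} :=
  measurableSet_interlace.preimage (measurable_id.prodMk measurable_const)

lemma measurableSet_pos (n : ℕ) : MeasurableSet {w : Fin n → ℝ | ∀ i, 0 < w i} := by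
  simp only [Set.ofPred_forall]
  exact MeasurableSet.iInter fun i => measurableSet_lt (by fun_prop) (by fun_prop)

lemma measurableSet_strictMono (n : ℕ) : MeasurableSet {x : Fin n → ℝ | StrictMono x} := by
  simp only [StrictMono, Set.ofPred_forall]
  exact MeasurableSet.iInter fun i => MeasurableSet.iInter fun j => MeasurableSet.iInter fun _ =>
    measurableSet_lt (by fun_prop) (by fun_prop)

lemma lintegral_fin_cons {G : (Fin (m + 1) → ℝ) → ENNReal} (hG : Measurable G) :
    ∫⁻ u, G u = ∫⁻ y : Fin m → ℝ, ∫⁻ s : ℝ, G (Fin.cons s y) := by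
  have h := (volume_preserving_piFinSuccAbove (fun _ : Fin (m + 1) => ℝ) 0).symm
  rw [← h.lintegral_comp hG, Measure.volume_eq_prod, lintegral_prod_symm]
  · simp [MeasurableEquiv.piFinSuccAbove, Fin.insertNthEquiv]
  · exact (hG.comp h.measurable).aemeasurable

/-- The Jacobian of `(s, y) ↦ residue x y s`. -/
lemma hasFDerivAt_residue {x : Fin (m + 1) → ℝ} {u : Fin (m + 1) → ℝ} (hu : u 0 ≠ 0)
    (hx : Function.Injective x) (hxu : ∀ i j, x i - Fin.tail u j ≠ 0) :
    HasFDerivAt (fun u : Fin (m + 1) → ℝ => residue x (Fin.tail u) (u 0))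
      (LinearMap.toContinuousLinearMap (Matrix.toLin' (Matrix.of fun i c =>
        residue x (Fin.tail u) (u 0) i * Matrix.of (fun i c =>
          (Fin.cons (u 0)⁻¹ (fun _ => -1) : Fin (m + 1) → ℝ) c *
            borderedCauchy x (Fin.tail u) i c) i c))) u := by
  refine hasFDerivAt_of_matrix fun i => ?_
  have hne : ∀ j, x i - x (i.succAbove j) ≠ 0 := fun j =>
    sub_ne_zero.2 fun h => Fin.succAbove_ne i j (hx h).symm
  have h1 : ∀ j : Fin m, HasFDerivAt
      (fun u : Fin (m + 1) → ℝ => (x i - Fin.tail u j) / (x i - x (i.succAbove j)))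
      ((x i - x (i.succAbove j))⁻¹ •
        -ContinuousLinearMap.proj (R := ℝ) (φ := fun _ : Fin (m + 1) => ℝ) j.succ) u := by
    intro j
    have := ((hasFDerivAt_apply (𝕜 := ℝ) (F' := fun _ : Fin (m + 1) => ℝ) j.succ u).const_sub
      (x i)).const_mul (x i - x (i.succAbove j))⁻¹
    simp only [div_eq_inv_mul]
    exact this
  have h2 := (hasFDerivAt_apply (𝕜 := ℝ) (F' := fun _ : Fin (m + 1) => ℝ) 0 u).mul
    (hasFDerivAt_prod_of_ne_zero h1 fun j => div_ne_zero (hxu i j) (hne j))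
  refine h2.congr_fderiv ?_
  ext v
  simp only [add_apply, smul_apply,
    sum_apply, ContinuousLinearMap.proj_apply, neg_apply,
    smul_eq_mul, Matrix.of_apply, Fin.sum_univ_succ, borderedCauchy, Fin.cons_zero, Fin.cons_succ,
    residue]
  rw [add_comm]
  congr 1
  · field_simp
  · rw [← mul_assoc, Finset.mul_sum]
    refine Finset.sum_congr rfl fun j _ => ?_
    have := hne j
    have := hxu i j
    field_simp

lemma residue_image {x : Fin (m + 1) → ℝ} (hx : StrictMono x) :
    (fun u : Fin (m + 1) → ℝ => residue x (Fin.tail u) (u 0)) ''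
      {u | 0 < u 0 ∧ Interlace x (Fin.tail u)} = {w | ∀ i, 0 < w i} := by
  ext w
  constructor
  · rintro ⟨u, ⟨h0, hI⟩, rfl⟩
    exact fun i => hI.residue_pos h0 i
  · intro hw
    obtain ⟨y, hy, h⟩ := exists_residue_eq hx hw
    refine ⟨Fin.cons (∑ i, w i) y, ⟨?_, by rwa [Fin.tail_cons]⟩, funext fun i => ?_⟩
    · exact Finset.sum_pos (fun i _ => hw i) Finset.univ_nonempty
    · simpa [Fin.tail_cons] using h i

lemma measurable_residue_tail (x : Fin (m + 1) → ℝ) :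
    Measurable fun u : Fin (m + 1) → ℝ => residue x (Fin.tail u) (u 0) := by
  unfold residue Fin.tail; fun_prop

/-- Integration over positive weights `w` at fixed `x`, in the coordinates `(y, s)` for which
`s * ∏ (z - y_j) / ∏ (z - x_i) = ∑ w_i / (z - x_i)`. -/
lemma lintegral_residue {x : Fin (m + 1) → ℝ} (hx : StrictMono x)
    {F : (Fin (m + 1) → ℝ) → ENNReal} (hF : Measurable F) :
    ∫⁻ w in {w | ∀ i, 0 < w i}, F w =
      ∫⁻ y in {y | Interlace x y}, ∫⁻ s in Set.Ioi 0,
        ENNReal.ofReal ((∏ i, residue x y s i) * s⁻¹ * (vdm x * vdm y / crossProd x y)) *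
          F (residue x y s) := by
  have hS : MeasurableSet {u : Fin (m + 1) → ℝ | 0 < u 0 ∧ Interlace x (Fin.tail u)} := by
    exact (measurableSet_lt measurable_const (measurable_pi_apply 0)).inter
      ((measurableSet_interlace_left x).preimage (by unfold Fin.tail; fun_prop))
  rw [← residue_image hx, lintegral_image_eq_lintegral_abs_det_fderiv_mul volume hS
    (fun u hu => (hasFDerivAt_residue hu.1.ne' hx.injective hu.2.ne).hasFDerivWithinAt)]
  swap
  · intro u hu u' hu' h
    obtain ⟨h1, h2⟩ := residue_injective hu.1 hu.2 hu'.2 h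
    rw [← Fin.cons_self_tail u, ← Fin.cons_self_tail u', h1, h2]
  have hdet : ∀ u ∈ {u : Fin (m + 1) → ℝ | 0 < u 0 ∧ Interlace x (Fin.tail u)},
      |(LinearMap.toContinuousLinearMap (Matrix.toLin' (Matrix.of fun i c =>
        residue x (Fin.tail u) (u 0) i * Matrix.of (fun i c =>
          (Fin.cons (u 0)⁻¹ (fun _ => -1) : Fin (m + 1) → ℝ) c *
            borderedCauchy x (Fin.tail u) i c) i c))).det| =
      (∏ i, residue x (Fin.tail u) (u 0) i) * (u 0)⁻¹ *
        (vdm x * vdm (Fin.tail u) / crossProd x (Fin.tail u)) := by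
    rintro u ⟨h0, hI⟩
    rw [ContinuousLinearMap.det, LinearMap.coe_toContinuousLinearMap, LinearMap.det_toLin',
      Matrix.det_mul_column, Matrix.det_mul_row, abs_mul, abs_mul,
      abs_of_pos (Finset.prod_pos fun i _ => hI.residue_pos h0 i), mul_assoc]
    congr 2
    · rw [Fin.prod_univ_succ, Fin.cons_zero]
      simp [abs_mul, abs_of_pos h0]
    · rw [eq_div_iff (crossProd_pos hI).ne']
      exact abs_det_borderedCauchy hI.strictMono_right.injective hI.ne
  rw [setLIntegral_congr_fun hS fun u hu => by
    simp only [hdet u hu]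
    rfl]
  rw [← lintegral_indicator hS, lintegral_fin_cons, ← lintegral_indicator
    (measurableSet_interlace_left x)]
  · refine lintegral_congr fun y => ?_
    by_cases hy : Interlace x y
    · rw [Set.indicator_of_mem (by exact hy), ← lintegral_indicator measurableSet_Ioi]
      refine lintegral_congr fun s => ?_
      simp [Set.indicator, Fin.tail_cons, hy]
    · rw [Set.indicator_of_notMem (by exact hy)]
      simp [Set.indicator, Fin.tail_cons, hy]
  · refine Measurable.indicator ?_ hS
    refine Measurable.mul ?_ (hF.comp (measurable_residue_tail x))
    refine Measurable.ennreal_ofReal ?_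
    unfold residue vdm crossProd Fin.tail
    fun_prop

end ChangeOfVariables

/-! ### Points as functions of the shift and the dual weights -/

section DualChangeOfVariables

variable {m : ℕ}

/-- The Jacobian of `x ↦ (dualShift x y, dualResidue x y)`. -/
lemma hasFDerivAt_dual {x : Fin (m + 1) → ℝ} {y : Fin m → ℝ} (hxy : ∀ i j, x i - y j ≠ 0) :
    HasFDerivAt (fun x : Fin (m + 1) → ℝ =>
        (Fin.cons (dualShift x y) (dualResidue x y) : Fin (m + 1) → ℝ))
      (LinearMap.toContinuousLinearMap (Matrix.toLin' (Matrix.of fun c j =>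
        (Fin.cons 1 (dualResidue x y) : Fin (m + 1) → ℝ) c *
          (borderedCauchy x y).transpose c j))) x := by
  refine hasFDerivAt_of_matrix fun c => ?_
  refine Fin.cases ?_ (fun i => ?_) c
  · simp only [Fin.cons_zero, Matrix.of_apply, Matrix.transpose_apply, borderedCauchy, mul_one,
      one_smul, dualShift]
    exact (HasFDerivAt.fun_sum fun i _ =>
      hasFDerivAt_apply (𝕜 := ℝ) (F' := fun _ : Fin (m + 1) => ℝ) i x).sub_const _
  · simp only [Fin.cons_succ, Matrix.of_apply, Matrix.transpose_apply, borderedCauchy]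
    have hyx : ∀ j, y i - x j ≠ 0 := fun j h => hxy j i (by linarith)
    have h1 : ∀ j : Fin (m + 1), HasFDerivAt (fun x : Fin (m + 1) → ℝ => y i - x j)
        (-ContinuousLinearMap.proj (R := ℝ) (φ := fun _ : Fin (m + 1) => ℝ) j) x := fun j =>
      (hasFDerivAt_apply (𝕜 := ℝ) (F' := fun _ : Fin (m + 1) => ℝ) j x).const_sub (y i)
    have h2 := (hasFDerivAt_prod_of_ne_zero h1 hyx).const_mul
      (-(∏ j ∈ Finset.univ.erase i, (y i - y j))⁻¹)
    have h3 : (fun x : Fin (m + 1) → ℝ => dualResidue x y i) = fun x =>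
        -(∏ j ∈ Finset.univ.erase i, (y i - y j))⁻¹ * ∏ j, (y i - x j) := by
      funext x
      rw [dualResidue, div_eq_inv_mul, neg_mul]
    rw [h3]
    refine h2.congr_fderiv ?_
    rw [smul_smul, ← congrFun h3 x, Finset.smul_sum]
    refine Finset.sum_congr rfl fun j _ => ?_
    rw [smul_neg, ← neg_smul, ← inv_neg, neg_sub, smul_smul]

lemma dual_image {y : Fin m → ℝ} (hy : StrictMono y) :
    (fun x : Fin (m + 1) → ℝ =>
        (Fin.cons (dualShift x y) (dualResidue x y) : Fin (m + 1) → ℝ)) '' {x | Interlace x y} =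
      {v | ∀ i, 0 < Fin.tail v i} := by
  ext v
  constructor
  · rintro ⟨x, hI, rfl⟩ i
    rw [Fin.tail_cons]
    exact hI.dualResidue_pos i
  · intro hv
    obtain ⟨x, hx, ha, hr⟩ := exists_dualResidue_eq hy hv (v 0)
    exact ⟨x, hx, by simp only [ha, hr, Fin.cons_self_tail]⟩

/-- Integration over points `x` interlacing with fixed `y`, in the coordinates `(a, r)` for which
`∏ (z - x_j) / ∏ (z - y_i) = z - a - ∑ r_i / (z - y_i)`. -/
lemma lintegral_dual {y : Fin m → ℝ} (hy : StrictMono y) {F : ℝ → (Fin m → ℝ) → ENNReal}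
    (hF : Measurable (Function.uncurry F)) :
    ∫⁻ x in {x | Interlace x y},
        ENNReal.ofReal ((∏ i, dualResidue x y i) * (vdm x * vdm y / crossProd x y)) *
          F (dualShift x y) (dualResidue x y) =
      ∫⁻ r in {r : Fin m → ℝ | ∀ i, 0 < r i}, ∫⁻ a, F a r := by
  have hS := measurableSet_interlace_right y
  have hG : Measurable fun v : Fin (m + 1) → ℝ => F (v 0) (Fin.tail v) :=
    hF.comp (g := Function.uncurry F) (by unfold Fin.tail; fun_prop :
      Measurable fun v : Fin (m + 1) → ℝ => (v 0, Fin.tail v))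
  have hT : MeasurableSet {v : Fin (m + 1) → ℝ | ∀ i, 0 < Fin.tail v i} :=
    (measurableSet_pos m).preimage (by unfold Fin.tail; fun_prop)
  have h1 : ∫⁻ v in {v : Fin (m + 1) → ℝ | ∀ i, 0 < Fin.tail v i}, F (v 0) (Fin.tail v) =
      ∫⁻ r in {r : Fin m → ℝ | ∀ i, 0 < r i}, ∫⁻ a, F a r := by
    rw [← lintegral_indicator hT, lintegral_fin_cons (hG.indicator hT),
      ← lintegral_indicator (measurableSet_pos m)]
    refine lintegral_congr fun r => ?_
    by_cases hr : ∀ i, 0 < r i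
    · rw [Set.indicator_of_mem (by exact hr)]
      refine lintegral_congr fun a => ?_
      rw [Set.indicator_of_mem (by simpa [Fin.tail_cons] using hr), Fin.cons_zero, Fin.tail_cons]
    · rw [Set.indicator_of_notMem (by exact hr)]
      simp [Set.indicator, Fin.tail_cons, hr]
  rw [← h1, ← dual_image hy, lintegral_image_eq_lintegral_abs_det_fderiv_mul volume hS
    (fun x hx => (hasFDerivAt_dual (Interlace.ne hx)).hasFDerivWithinAt)]
  · refine setLIntegral_congr_fun hS fun x hx => ?_
    have hI : Interlace x y := hx
    simp only [Fin.cons_zero, Fin.tail_cons]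
    congr 2
    rw [ContinuousLinearMap.det, LinearMap.coe_toContinuousLinearMap, LinearMap.det_toLin',
      Matrix.det_mul_column, Matrix.det_transpose, abs_mul, Fin.prod_univ_succ, Fin.cons_zero,
      one_mul]
    simp only [Fin.cons_succ]
    rw [abs_of_pos (Finset.prod_pos fun i _ => hI.dualResidue_pos i)]
    congr 1
    rw [div_eq_iff (crossProd_pos hI).ne']
    exact (abs_det_borderedCauchy hI.strictMono_right.injective hI.ne).symm
  · intro x hx x' hx' h
    obtain ⟨h1, h2⟩ := Fin.cons_injective2 h
    exact dual_injective hx hx' h1 h2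

end DualChangeOfVariables

/-! ### The recursion in the size of the ensemble -/

section Recursion

/-- The density of the gamma distribution of shape `k β / 2` and rate `β / 2`, up to a constant. -/
def gammaWeight (β k w : ℝ) : ℝ := w ^ (k * β / 2 - 1) * Real.exp (-(β / 2) * w)

lemma weight_eq (β : ℝ) (n : ℕ) (x : Fin n → ℝ) :
    weight β n x = vdm x ^ β * Real.exp (-(β / 4) * ∑ k, x k ^ 2) := by
  rw [weight, vdm, ← Real.finsetProd_rpow _ _ fun i _ => Finset.prod_nonneg fun j _ => abs_nonneg _]
  congr 1
  refine Finset.prod_congr rfl fun i _ => ?_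
  rw [← Real.finsetProd_rpow _ _ fun j _ => abs_nonneg _]

variable {m : ℕ}

lemma prod_gammaWeight {n : ℕ} {w : Fin n → ℝ} (hw : ∀ i, 0 < w i) (β : ℝ) :
    ∏ i, gammaWeight β 1 (w i) =
      (∏ i, w i) ^ (β / 2) / (∏ i, w i) * Real.exp (-(β / 2) * ∑ i, w i) := by
  simp only [gammaWeight]
  rw [Finset.prod_mul_distrib, ← Real.exp_sum, ← Finset.mul_sum,
    Real.finsetProd_rpow _ _ fun i _ => (hw i).le, one_mul,
    Real.rpow_sub_one (Finset.prod_pos fun i _ => hw i).ne']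

/-- The joint density, up to a constant, of the points `x`, the interlacing points `y` and the total
weight `s`. It is reached from the densities of `(x, w)` and of `(y, r, a, s)`. -/
def interlaceDensity (β : ℝ) (x : Fin (m + 1) → ℝ) (y : Fin m → ℝ) (s : ℝ) : ℝ :=
  vdm x * vdm y * crossProd x y ^ (β / 2 - 1) * Real.exp (-(β / 4) * ∑ k, x k ^ 2) *
    gammaWeight β (m + 1) s

lemma weight_mul_residue_jacobian {x : Fin (m + 1) → ℝ} {y : Fin m → ℝ} (h : Interlace x y)
    {s : ℝ} (hs : 0 < s) (β : ℝ) :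
    weight β (m + 1) x * (∏ i, gammaWeight β 1 (residue x y s i)) *
      ((∏ i, residue x y s i) * s⁻¹ * (vdm x * vdm y / crossProd x y)) =
    interlaceDensity β x y s := by
  have hv := vdm_pos h.strictMono_left.injective
  have hv' := vdm_pos h.strictMono_right.injective
  have hX := crossProd_pos h
  have h1 : (s ^ (m + 1) * crossProd x y / vdm x ^ 2) ^ (β / 2) =
      s ^ ((m + 1 : ℝ) * β / 2) * crossProd x y ^ (β / 2) / vdm x ^ β := by
    rw [Real.div_rpow (by positivity) (by positivity), Real.mul_rpow (by positivity) hX.le,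
      ← Real.rpow_natCast, ← Real.rpow_mul hs.le, ← Real.rpow_natCast (vdm x),
      ← Real.rpow_mul hv.le]
    push_cast
    congr 3 <;> ring
  rw [prod_gammaWeight (fun i => h.residue_pos hs i), sum_residue h.strictMono_left.injective,
    prod_residue h hs, weight_eq, h1, interlaceDensity, gammaWeight, Real.rpow_sub_one hs.ne',
    Real.rpow_sub_one hX.ne']
  have := (Real.rpow_pos_of_pos hv β).ne'
  field_simp

lemma weight_mul_dual_jacobian {x : Fin (m + 1) → ℝ} {y : Fin m → ℝ} (h : Interlace x y)
    (s β : ℝ) :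
    weight β m y * (∏ i, gammaWeight β 1 (dualResidue x y i)) *
      Real.exp (-(β / 4) * dualShift x y ^ 2) * gammaWeight β (m + 1) s *
      ((∏ i, dualResidue x y i) * (vdm x * vdm y / crossProd x y)) =
    interlaceDensity β x y s := by
  have hv := vdm_pos h.strictMono_left.injective
  have hv' := vdm_pos h.strictMono_right.injective
  have hX := crossProd_pos h
  have h1 : (crossProd x y / vdm y ^ 2) ^ (β / 2) = crossProd x y ^ (β / 2) / vdm y ^ β := by
    rw [Real.div_rpow hX.le (by positivity), ← Real.rpow_natCast (vdm y), ← Real.rpow_mul hv'.le]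
    push_cast
    congr 2; ring
  have h2 : Real.exp (-(β / 4) * ∑ k, x k ^ 2) = Real.exp (-(β / 4) * ∑ k, y k ^ 2) *
      Real.exp (-(β / 2) * ∑ i, dualResidue x y i) * Real.exp (-(β / 4) * dualShift x y ^ 2) := by
    rw [sum_sq_eq_dual x h.strictMono_right.injective, ← Real.exp_add, ← Real.exp_add]
    congr 1; ring
  rw [prod_gammaWeight (fun i => h.dualResidue_pos i), prod_dualResidue h, weight_eq, h1,
    interlaceDensity, h2, Real.rpow_sub_one hX.ne']
  have := (Real.rpow_pos_of_pos hv' β).ne'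
  field_simp

@[fun_prop]
lemma measurable_weight (β : ℝ) (n : ℕ) : Measurable (weight β n) := by
  unfold weight; fun_prop

@[fun_prop]
lemma measurable_gammaWeight (β k : ℝ) : Measurable (gammaWeight β k) := by
  unfold gammaWeight; fun_prop

lemma measurable_interlaceDensity (β : ℝ) :
    Measurable fun p : ((Fin (m + 1) → ℝ) × (Fin m → ℝ)) × ℝ =>
      interlaceDensity β p.1.1 p.1.2 p.2 := by
  unfold interlaceDensity vdm crossProd; fun_prop

lemma measurable_dual :
    Measurable fun p : (Fin (m + 1) → ℝ) × (Fin m → ℝ) =>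
      ((p.2, dualResidue p.1 p.2), dualShift p.1 p.2) := by
  have h1 : Measurable fun p : (Fin (m + 1) → ℝ) × (Fin m → ℝ) => dualResidue p.1 p.2 := by
    unfold dualResidue; fun_prop
  have h2 : Measurable fun p : (Fin (m + 1) → ℝ) × (Fin m → ℝ) => dualShift p.1 p.2 := by
    unfold dualShift; fun_prop
  fun_prop

/-- One step of the reduction of the ensemble to independent Gaussian and gamma variables. The
points `x`, distributed as the ensemble of size `m + 1`, carry independent gamma weights; in the
coordinates `(y, r, a, s)`, the points `y` are distributed as the ensemble of size `m` with
independent gamma weights `r`, while `a` is an independent Gaussian and `s` an independent gamma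
variable. -/
theorem lintegral_weight_succ {β : ℝ} {F : (Fin (m + 1) → ℝ) → (Fin (m + 1) → ℝ) → ENNReal}
    (hF : ∀ x, Measurable (F x))
    {F' : (Fin m → ℝ) → (Fin m → ℝ) → ℝ → ℝ → ENNReal}
    (hF' : Measurable fun p : (((Fin m → ℝ) × (Fin m → ℝ)) × ℝ) × ℝ => F' p.1.1.1 p.1.1.2 p.1.2 p.2)
    (hFF' : ∀ x y s, 0 < s → Interlace x y →
      F x (residue x y s) = F' y (dualResidue x y) (dualShift x y) s) :
    ∫⁻ x in {x : Fin (m + 1) → ℝ | StrictMono x}, ∫⁻ w in {w : Fin (m + 1) → ℝ | ∀ i, 0 < w i},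
        ENNReal.ofReal (weight β (m + 1) x * ∏ i, gammaWeight β 1 (w i)) * F x w =
      ∫⁻ y in {y : Fin m → ℝ | StrictMono y}, ∫⁻ r in {r : Fin m → ℝ | ∀ i, 0 < r i}, ∫⁻ a,
        ∫⁻ s in Set.Ioi 0, ENNReal.ofReal (weight β m y * (∏ i, gammaWeight β 1 (r i)) *
          Real.exp (-(β / 4) * a ^ 2) * gammaWeight β (m + 1) s) * F' y r a s := by
  set H : (Fin (m + 1) → ℝ) → (Fin m → ℝ) → ENNReal := fun x y => ∫⁻ s in Set.Ioi 0,
    ENNReal.ofReal (interlaceDensity β x y s) * F' y (dualResidue x y) (dualShift x y) s with hH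
  have hHm : Measurable (Function.uncurry H) := by
    refine Measurable.lintegral_prod_right' (f := fun p : ((Fin (m + 1) → ℝ) × (Fin m → ℝ)) × ℝ =>
      ENNReal.ofReal (interlaceDensity β p.1.1 p.1.2 p.2) *
        F' p.1.2 (dualResidue p.1.1 p.1.2) (dualShift p.1.1 p.1.2) p.2) ?_
    exact (measurable_interlaceDensity β).ennreal_ofReal.mul
      (hF'.comp ((measurable_dual.comp measurable_fst).prodMk measurable_snd))
  have hL : ∀ x : Fin (m + 1) → ℝ, StrictMono x →
      ∫⁻ w in {w : Fin (m + 1) → ℝ | ∀ i, 0 < w i},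
        ENNReal.ofReal (weight β (m + 1) x * ∏ i, gammaWeight β 1 (w i)) * F x w =
      ∫⁻ y in {y | Interlace x y}, H x y := by
    intro x hx
    rw [lintegral_residue hx]
    · refine setLIntegral_congr_fun (measurableSet_interlace_left x) fun y hy => ?_
      refine setLIntegral_congr_fun measurableSet_Ioi fun s hs => ?_
      have hI : Interlace x y := hy
      have hs0 : 0 < s := hs
      have hJ : 0 ≤ (∏ i, residue x y s i) * s⁻¹ * (vdm x * vdm y / crossProd x y) := by
        have := vdm_pos hI.strictMono_left.injective
        have := vdm_pos hI.strictMono_right.injective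
        have := crossProd_pos hI
        have := Finset.prod_pos fun i (_ : i ∈ Finset.univ) => hI.residue_pos hs0 i
        positivity
      rw [hFF' x y s hs hy, ← mul_assoc, ← ENNReal.ofReal_mul hJ, mul_comm (_ * _ * _),
        weight_mul_residue_jacobian hI hs0]
    · exact Measurable.mul (by fun_prop) (hF x)
  have hR : ∀ y : Fin m → ℝ, StrictMono y →
      ∫⁻ r in {r : Fin m → ℝ | ∀ i, 0 < r i}, ∫⁻ a,
        ∫⁻ s in Set.Ioi 0, ENNReal.ofReal (weight β m y * (∏ i, gammaWeight β 1 (r i)) *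
          Real.exp (-(β / 4) * a ^ 2) * gammaWeight β (m + 1) s) * F' y r a s =
      ∫⁻ x in {x | Interlace x y}, H x y := by
    intro y hy
    have hms : ∀ r a, Measurable fun s => F' y r a s := fun r a =>
      hF'.comp (measurable_const.prodMk measurable_id :
        Measurable fun s : ℝ => (((y, r), a), s))
    rw [← lintegral_dual hy (F := fun a r => ∫⁻ s in Set.Ioi 0,
      ENNReal.ofReal (weight β m y * (∏ i, gammaWeight β 1 (r i)) *
          Real.exp (-(β / 4) * a ^ 2) * gammaWeight β (m + 1) s) * F' y r a s)]
    · refine setLIntegral_congr_fun (measurableSet_interlace_right y) fun x hx => ?_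
      have hI : Interlace x y := hx
      have hJ : 0 ≤ (∏ i, dualResidue x y i) * (vdm x * vdm y / crossProd x y) := by
        have := vdm_pos hI.strictMono_left.injective
        have := vdm_pos hI.strictMono_right.injective
        have := crossProd_pos hI
        have := Finset.prod_pos fun i (_ : i ∈ Finset.univ) => hI.dualResidue_pos i
        positivity
      simp only [hH]
      rw [← lintegral_const_mul]
      · refine setLIntegral_congr_fun measurableSet_Ioi fun s hs => ?_
        rw [← mul_assoc, ← ENNReal.ofReal_mul hJ, mul_comm (_ * (_ / _)),
          weight_mul_dual_jacobian hI]
      · exact Measurable.mul (by fun_prop) (hms _ _)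
    · refine Measurable.lintegral_prod_right' (f := fun p : (ℝ × (Fin m → ℝ)) × ℝ =>
        ENNReal.ofReal (weight β m y * (∏ i, gammaWeight β 1 (p.1.2 i)) *
          Real.exp (-(β / 4) * p.1.1 ^ 2) * gammaWeight β (m + 1) p.2) * F' y p.1.2 p.1.1 p.2) ?_
      refine Measurable.mul (by fun_prop) ?_
      exact hF'.comp (by fun_prop :
        Measurable fun p : (ℝ × (Fin m → ℝ)) × ℝ => (((y, p.1.2), p.1.1), p.2))
  rw [setLIntegral_congr_fun (measurableSet_strictMono _) hL,
    setLIntegral_congr_fun (measurableSet_strictMono _) hR]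
  -- interlacing forces both families to be increasing, so both sides are integrals over all
  -- interlacing pairs
  have hI : Measurable (Set.indicator
      {p : (Fin (m + 1) → ℝ) × (Fin m → ℝ) | Interlace p.1 p.2} (Function.uncurry H)) :=
    hHm.indicator measurableSet_interlace
  have hswap := lintegral_lintegral_swap (μ := (volume : Measure (Fin (m + 1) → ℝ)))
    (ν := (volume : Measure (Fin m → ℝ))) (f := fun x y => Set.indicator
      {p : (Fin (m + 1) → ℝ) × (Fin m → ℝ) | Interlace p.1 p.2} (Function.uncurry H) (x, y))
      hI.aemeasurable
  have h1 : ∀ x, (∫⁻ y, Set.indicator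
      {p : (Fin (m + 1) → ℝ) × (Fin m → ℝ) | Interlace p.1 p.2} (Function.uncurry H) (x, y)) =
      Set.indicator {x | StrictMono x} (fun x => ∫⁻ y in {y | Interlace x y}, H x y) x := by
    intro x
    by_cases hx : StrictMono x
    · rw [Set.indicator_of_mem (by exact hx), ← lintegral_indicator
        (measurableSet_interlace_left x)]
      rfl
    · rw [Set.indicator_of_notMem (by exact hx)]
      refine lintegral_eq_zero_of_ae_eq_zero (Filter.Eventually.of_forall fun y => ?_)
      exact Set.indicator_of_notMem (fun h : Interlace x y => hx h.strictMono_left) _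
  have h2 : ∀ y, (∫⁻ x, Set.indicator
      {p : (Fin (m + 1) → ℝ) × (Fin m → ℝ) | Interlace p.1 p.2} (Function.uncurry H) (x, y)) =
      Set.indicator {y | StrictMono y} (fun y => ∫⁻ x in {x | Interlace x y}, H x y) y := by
    intro y
    by_cases hy : StrictMono y
    · rw [Set.indicator_of_mem (by exact hy), ← lintegral_indicator
        (measurableSet_interlace_right y)]
      rfl
    · rw [Set.indicator_of_notMem (by exact hy)]
      refine lintegral_eq_zero_of_ae_eq_zero (Filter.Eventually.of_forall fun x => ?_)
      exact Set.indicator_of_notMem (fun h : Interlace x y => hy h.strictMono_right) _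
  simp only [h1, h2] at hswap
  rwa [lintegral_indicator (measurableSet_strictMono _),
    lintegral_indicator (measurableSet_strictMono _)] at hswap

end Recursion

open ProbabilityTheory

/-! ### Reduction to increasing points -/

section Symmetry

/-- A symmetric function that vanishes on coinciding coordinates has the same integral over each of
the `n!` chambers. -/
lemma lintegral_eq_factorial_mul {n : ℕ} {G : (Fin n → ℝ) → ENNReal} (hG : Measurable G)
    (hsymm : ∀ (σ : Equiv.Perm (Fin n)) x, G (x ∘ σ) = G x)
    (hinj : ∀ x, ¬ Function.Injective x → G x = 0) :
    ∫⁻ x, G x = n.factorial * ∫⁻ x in {x | StrictMono x}, G x := by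
  classical
  have h1 : ∀ x, G x = ∑ σ : Equiv.Perm (Fin n),
      Set.indicator {x | StrictMono x} G (x ∘ σ) := by
    intro x
    by_cases hx : Function.Injective x
    · have hs : StrictMono (x ∘ Tuple.sort x) :=
        (Tuple.monotone_sort x).strictMono_of_injective (hx.comp (Equiv.injective _))
      rw [Finset.sum_eq_single_of_mem (Tuple.sort x) (Finset.mem_univ _),
        Set.indicator_of_mem (by exact hs), hsymm]
      intro σ _ hσ
      refine Set.indicator_of_notMem (fun h : StrictMono (x ∘ σ) => hσ ?_) _
      have h2 : x ∘ σ = x ∘ Tuple.sort x := by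
        rw [← h.range_inj hs, σ.surjective.range_comp, (Tuple.sort x).surjective.range_comp]
      exact Equiv.ext fun i => hx (congrFun h2 i)
    · rw [hinj x hx, eq_comm]
      refine Finset.sum_eq_zero fun σ _ => Set.indicator_of_notMem ?_ _
      intro h
      have h' : Function.Injective ((x ∘ σ) ∘ σ.symm) :=
        (StrictMono.injective h).comp σ.symm.injective
      rw [Function.comp_assoc, Equiv.self_comp_symm, Function.comp_id] at h'
      exact hx h'
  have hGi : Measurable (Set.indicator {x | StrictMono x} G) :=
    hG.indicator (measurableSet_strictMono n)
  have h3 : ∀ σ : Equiv.Perm (Fin n), MeasurePreserving (fun x : Fin n → ℝ => x ∘ σ) := by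
    intro σ
    have h := volume_measurePreserving_piCongrLeft (fun _ : Fin n => ℝ) σ.symm
    have he : ⇑(MeasurableEquiv.piCongrLeft (fun _ : Fin n => ℝ) σ.symm) =
        fun x : Fin n → ℝ => x ∘ σ := by
      funext x i
      obtain ⟨j, rfl⟩ := σ.symm.surjective i
      rw [Function.comp_apply, Equiv.apply_symm_apply]
      exact Equiv.piCongrLeft_apply_apply (fun _ : Fin n => ℝ) σ.symm x j
    rwa [he] at h
  rw [lintegral_congr h1, lintegral_finsetSum (f := fun (σ : Equiv.Perm (Fin n)) x =>
    Set.indicator {x | StrictMono x} G (x ∘ σ)) _ fun σ _ => hGi.comp (h3 σ).measurable]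
  simp only [(h3 _).lintegral_comp hGi]
  rw [Finset.sum_const, Finset.card_univ, Fintype.card_perm, Fintype.card_fin, nsmul_eq_mul,
    lintegral_indicator (measurableSet_strictMono n)]

lemma weight_comp_perm (β : ℝ) {n : ℕ} (σ : Equiv.Perm (Fin n)) (x : Fin n → ℝ) :
    weight β n (x ∘ σ) = weight β n x := by
  have h : vdm (x ∘ σ) = vdm x := by
    have h0 : ∀ x : Fin n → ℝ, 0 ≤ vdm x := fun x =>
      Finset.prod_nonneg fun _ _ => Finset.prod_nonneg fun _ _ => abs_nonneg _
    rw [← sq_eq_sq₀ (h0 _) (h0 _), ← prod_prod_erase, ← prod_prod_erase,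
      ← Equiv.prod_comp σ (fun i => ∏ j ∈ Finset.univ.erase i, |x i - x j|)]
    refine Finset.prod_congr rfl fun i _ => ?_
    refine Finset.prod_equiv σ (fun j => ?_) fun j _ => rfl
    simp
  rw [weight_eq, weight_eq, h]
  congr 3
  exact Equiv.sum_comp σ (fun i => x i ^ 2)

lemma weight_eq_zero {β : ℝ} (hβ : 0 < β) {n : ℕ} {x : Fin n → ℝ}
    (hx : ¬ Function.Injective x) : weight β n x = 0 := by
  simp only [Function.Injective, not_forall] at hx
  obtain ⟨i, j, hij, hne⟩ := hx
  have h : vdm x = 0 := by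
    rw [← sq_eq_zero_iff, ← prod_prod_erase]
    exact Finset.prod_eq_zero (Finset.mem_univ i) (Finset.prod_eq_zero
      (Finset.mem_erase.2 ⟨Ne.symm hne, Finset.mem_univ j⟩) (by rw [hij, sub_self, abs_zero]))
  rw [weight_eq, h, Real.zero_rpow hβ.ne', zero_mul]

end Symmetry

/-! ### The Markov chain of the resolvent -/

section Chain

/-- The transition operator of the chain `f_{k} = s_k / (t - a_k - f_{k-1})`, killed when the
denominator is not positive, with `a_k` Gaussian of variance `2 / β` and `s_k` gamma distributed
with shape `k β / 2` and rate `β / 2`. -/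
def chainStep (β t : ℝ) (k : ℕ) (g : ℝ → ENNReal) (f : ℝ) : ENNReal :=
  ∫⁻ a, ∫⁻ s, (if 0 < t - a - f then g (s / (t - a - f)) else 0)
    ∂(gammaMeasure (k * β / 2) (β / 2)) ∂(gaussianReal 0 (2 / β).toNNReal)

/-- The probability that the chain, in state `f` after `k` steps, survives `j` more steps. -/
def survival (β t : ℝ) : ℕ → ℕ → ℝ → ENNReal
  | _, 0 => fun _ => 1
  | k, j + 1 => chainStep β t (k + 1) (survival β t (k + 1) j)

/-- The unnormalized law of the increasing points `x` together with independent gamma weights `w`,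
integrated against `F`. -/
def weightedIntegral (β : ℝ) (n : ℕ) (F : (Fin n → ℝ) → (Fin n → ℝ) → ENNReal) : ENNReal :=
  ∫⁻ x in {x : Fin n → ℝ | StrictMono x}, ∫⁻ w in {w : Fin n → ℝ | ∀ i, 0 < w i},
    ENNReal.ofReal (weight β n x * ∏ i, gammaWeight β 1 (w i)) * F x w

open Classical in
/-- The test function `g (∑ w_i / (t - x_i))` on the event that all points are below `t`. -/
def resolventTest (t : ℝ) (n : ℕ) (g : ℝ → ENNReal) (x w : Fin n → ℝ) : ENNReal :=
  if ∀ i, x i < t then g (∑ i, w i / (t - x i)) else 0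

/-- The ratio of the normalizing constants for sizes `k` and `k - 1`. -/
def stepConst (β : ℝ) (k : ℕ) : ENNReal :=
  ENNReal.ofReal (√(2 * Real.pi * (2 / β))) *
    ENNReal.ofReal (Real.Gamma (k * β / 2) / (β / 2) ^ (k * β / 2))

lemma measurable_chainStep_integrand {t : ℝ} {g : ℝ → ENNReal} (hg : Measurable g) :
    Measurable fun p : (ℝ × ℝ) × ℝ =>
      if 0 < t - p.1.2 - p.1.1 then g (p.2 / (t - p.1.2 - p.1.1)) else 0 :=
  Measurable.ite (measurableSet_lt (by fun_prop) (by fun_prop)) (hg.comp (by fun_prop))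
    measurable_const

instance {a r : ℝ} : SFinite (gammaMeasure a r) := by unfold gammaMeasure; infer_instance

lemma measurable_chainStep (β t : ℝ) (k : ℕ) {g : ℝ → ENNReal} (hg : Measurable g) :
    Measurable (chainStep β t k g) := by
  refine Measurable.lintegral_prod_right' (f := fun p : ℝ × ℝ => ∫⁻ s, (if 0 < t - p.2 - p.1 then
    g (s / (t - p.2 - p.1)) else 0) ∂(gammaMeasure (k * β / 2) (β / 2))) ?_
  exact Measurable.lintegral_prod_right' (measurable_chainStep_integrand hg)

lemma measurable_survival (β t : ℝ) (k j : ℕ) : Measurable (survival β t k j) := by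
  induction j generalizing k with
  | zero => exact measurable_const
  | succ j ih => exact measurable_chainStep β t (k + 1) (ih (k + 1))

lemma lintegral_exp_sq {β : ℝ} (hβ : 0 < β) {G : ℝ → ENNReal} (hG : Measurable G) :
    ∫⁻ a, ENNReal.ofReal (Real.exp (-(β / 4) * a ^ 2)) * G a =
      ENNReal.ofReal (√(2 * Real.pi * (2 / β))) *
        ∫⁻ a, G a ∂(gaussianReal 0 (2 / β).toNNReal) := by
  have hv : (2 / β).toNNReal ≠ 0 := by
    rw [ne_eq, Real.toNNReal_eq_zero, not_le]; positivity
  rw [gaussianReal_of_var_ne_zero _ hv, lintegral_withDensity_eq_lintegral_mul _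
    (measurable_gaussianPDF _ _) hG, ← lintegral_const_mul _ (by fun_prop)]
  refine lintegral_congr fun a => ?_
  rw [Pi.mul_apply, ← mul_assoc, gaussianPDF, ← ENNReal.ofReal_mul (by positivity)]
  congr 2
  rw [gaussianPDFReal, Real.coe_toNNReal _ (by positivity), ← mul_assoc, mul_inv_cancel₀
    (by positivity), one_mul]
  congr 1
  field_simp
  ring

lemma lintegral_gammaWeight {β : ℝ} (hβ : 0 < β) {k : ℝ} (hk : 0 < k) {G : ℝ → ENNReal}
    (hG : Measurable G) :
    ∫⁻ s in Set.Ioi 0, ENNReal.ofReal (gammaWeight β k s) * G s =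
      ENNReal.ofReal (Real.Gamma (k * β / 2) / (β / 2) ^ (k * β / 2)) *
        ∫⁻ s, G s ∂(gammaMeasure (k * β / 2) (β / 2)) := by
  have hΓ := Real.Gamma_pos_of_pos (show 0 < k * β / 2 by positivity)
  have hm : Measurable (gammaPDF (k * β / 2) (β / 2)) := by
    unfold gammaPDF; fun_prop
  rw [gammaMeasure, lintegral_withDensity_eq_lintegral_mul _ hm hG,
    ← lintegral_const_mul _ (hm.mul hG), ← lintegral_indicator measurableSet_Ioi]
  refine lintegral_congr_ae ?_
  filter_upwards [Measure.ae_ne volume (0 : ℝ)] with s hs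
  rcases lt_or_gt_of_ne hs with h | h
  · rw [Set.indicator_of_notMem (by simpa using h.le), Pi.mul_apply, gammaPDF_of_neg h]
    simp
  · rw [Set.indicator_of_mem (by exact h), Pi.mul_apply, gammaPDF_of_nonneg h.le, ← mul_assoc,
      ← ENNReal.ofReal_mul (by positivity)]
    congr 2
    rw [gammaWeight, neg_mul]
    have : (β / 2) ^ (k * β / 2) ≠ 0 := by positivity
    field_simp

/-- All points are below `t` exactly when the interlacing points are, and the pivot is positive. -/
lemma Interlace.forall_lt_iff {m : ℕ} {x : Fin (m + 1) → ℝ} {y : Fin m → ℝ} (h : Interlace x y)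
    (t : ℝ) : (∀ i, x i < t) ↔ (∀ i, y i < t) ∧
      0 < t - dualShift x y - ∑ i, dualResidue x y i / (t - y i) := by
  have hy := h.strictMono_right.injective
  constructor
  · intro hx
    have hyt : ∀ i, y i < t := fun i => (h i).2.trans (hx _)
    refine ⟨hyt, ?_⟩
    rw [← prod_sub_div_eq_dual x hy fun i => (sub_pos.2 (hyt i)).ne']
    exact div_pos (Finset.prod_pos fun i _ => sub_pos.2 (hx i))
      (Finset.prod_pos fun i _ => sub_pos.2 (hyt i))
  · rintro ⟨hyt, hpos⟩
    rw [← prod_sub_div_eq_dual x hy fun i => (sub_pos.2 (hyt i)).ne',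
      div_pos_iff_of_pos_right (Finset.prod_pos fun i _ => sub_pos.2 (hyt i)),
      Fin.prod_univ_castSucc] at hpos
    have h1 : ∀ i : Fin m, x i.castSucc < t := fun i => (h i).1.trans (hyt i)
    intro i
    refine Fin.lastCases ?_ h1 i
    exact sub_pos.1 ((pos_iff_pos_of_mul_pos hpos).1
      (Finset.prod_pos fun i _ => sub_pos.2 (h1 i)))

/-- The recursion `lintegral_weight_succ` in terms of the probability laws of `a` and `s`. -/
lemma weightedIntegral_succ {β : ℝ} (hβ : 0 < β) {m : ℕ}
    {F : (Fin (m + 1) → ℝ) → (Fin (m + 1) → ℝ) → ENNReal} (hF : ∀ x, Measurable (F x))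
    {F' : (Fin m → ℝ) → (Fin m → ℝ) → ℝ → ℝ → ENNReal}
    (hF' : Measurable fun p : (((Fin m → ℝ) × (Fin m → ℝ)) × ℝ) × ℝ => F' p.1.1.1 p.1.1.2 p.1.2 p.2)
    (hFF' : ∀ x y s, 0 < s → Interlace x y →
      F x (residue x y s) = F' y (dualResidue x y) (dualShift x y) s) :
    weightedIntegral β (m + 1) F = stepConst β (m + 1) * weightedIntegral β m fun y r =>
      ∫⁻ a, ∫⁻ s, F' y r a s ∂(gammaMeasure ((m + 1 : ℕ) * β / 2) (β / 2))
        ∂(gaussianReal 0 (2 / β).toNNReal) := by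
  have hc : stepConst β (m + 1) ≠ ⊤ :=
    ENNReal.mul_ne_top ENNReal.ofReal_ne_top ENNReal.ofReal_ne_top
  rw [weightedIntegral, lintegral_weight_succ hF hF' hFF', weightedIntegral,
    ← lintegral_const_mul' _ _ hc]
  refine lintegral_congr fun y => ?_
  rw [← lintegral_const_mul' _ _ hc]
  refine setLIntegral_congr_fun (measurableSet_pos m) fun r hr => ?_
  have hw : 0 ≤ weight β m y * ∏ i, gammaWeight β 1 (r i) :=
    mul_nonneg (weight_nonneg _ _ _) (Finset.prod_nonneg fun i _ =>
      mul_nonneg (Real.rpow_nonneg (le_of_lt (hr i)) _) (Real.exp_pos _).le)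
  have hmF : ∀ a, Measurable fun s => F' y r a s := fun a =>
    hF'.comp (measurable_const.prodMk measurable_id : Measurable fun s : ℝ => (((y, r), a), s))
  have h1 : ∀ a, ∫⁻ s in Set.Ioi 0, ENNReal.ofReal (weight β m y *
      (∏ i, gammaWeight β 1 (r i)) * Real.exp (-(β / 4) * a ^ 2) * gammaWeight β (m + 1) s) *
        F' y r a s = ENNReal.ofReal (weight β m y * ∏ i, gammaWeight β 1 (r i)) *
      (ENNReal.ofReal (Real.exp (-(β / 4) * a ^ 2)) *
        (ENNReal.ofReal (Real.Gamma ((m + 1 : ℝ) * β / 2) / (β / 2) ^ ((m + 1 : ℝ) * β / 2)) *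
          ∫⁻ s, F' y r a s ∂(gammaMeasure ((m + 1 : ℝ) * β / 2) (β / 2)))) := by
    intro a
    rw [← lintegral_gammaWeight hβ (by positivity) (hmF a),
      ← lintegral_const_mul' _ _ ENNReal.ofReal_ne_top,
      ← lintegral_const_mul' _ _ ENNReal.ofReal_ne_top]
    refine setLIntegral_congr_fun measurableSet_Ioi fun s _ => ?_
    rw [ENNReal.ofReal_mul (by positivity), ENNReal.ofReal_mul hw]
    ring
  have hmG : Measurable fun a => ∫⁻ s, F' y r a s ∂(gammaMeasure ((m + 1 : ℝ) * β / 2) (β / 2)) :=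
    Measurable.lintegral_prod_right' (f := fun p : ℝ × ℝ => F' y r p.1 p.2)
      (hF'.comp (by fun_prop : Measurable fun p : ℝ × ℝ => (((y, r), p.1), p.2)))
  simp only [h1]
  rw [lintegral_const_mul' _ _ ENNReal.ofReal_ne_top, lintegral_exp_sq hβ (by fun_prop),
    lintegral_const_mul' _ _ ENNReal.ofReal_ne_top, stepConst]
  push_cast
  ring

/-- Adding a point to the ensemble amounts to one step of the chain of resolvents. -/
lemma weightedIntegral_resolventTest_succ {β : ℝ} (hβ : 0 < β) (t : ℝ) (m : ℕ) {g : ℝ → ENNReal}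
    (hg : Measurable g) :
    weightedIntegral β (m + 1) (resolventTest t (m + 1) g) =
      stepConst β (m + 1) * weightedIntegral β m (resolventTest t m (chainStep β t (m + 1) g)) := by
  classical
  set F' : (Fin m → ℝ) → (Fin m → ℝ) → ℝ → ℝ → ENNReal := fun y r a s =>
    if ∀ i, y i < t then
      if 0 < t - a - ∑ i, r i / (t - y i) then g (s / (t - a - ∑ i, r i / (t - y i))) else 0
    else 0 with hF'
  have hset : MeasurableSet {y : Fin m → ℝ | ∀ i, y i < t} := by
    simp only [Set.ofPred_forall]
    exact MeasurableSet.iInter fun i => measurableSet_lt (by fun_prop) (by fun_prop)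
  rw [weightedIntegral_succ hβ (F' := F')]
  · congr 2
    funext y r
    by_cases hy : ∀ i, y i < t
    · simp only [hF', if_pos hy, resolventTest, chainStep]
    · simp [hF', if_neg hy, resolventTest]
  · intro x
    unfold resolventTest
    by_cases hx : ∀ i, x i < t
    · simp only [if_pos hx]
      exact hg.comp (by fun_prop)
    · simp only [if_neg hx]
      exact measurable_const
  · refine Measurable.ite (hset.preimage (by fun_prop :
      Measurable fun p : (((Fin m → ℝ) × (Fin m → ℝ)) × ℝ) × ℝ => p.1.1.1)) ?_ measurable_const
    exact Measurable.ite (measurableSet_lt (by fun_prop) (by fun_prop)) (hg.comp (by fun_prop))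
      measurable_const
  · intro x y s hs hI
    simp only [resolventTest, hF', hI.forall_lt_iff t]
    by_cases hy : ∀ i, y i < t
    · by_cases hd : 0 < t - dualShift x y - ∑ i, dualResidue x y i / (t - y i)
      · rw [if_pos ⟨hy, hd⟩, if_pos hy, if_pos hd,
          sum_residue_div hI.strictMono_left.injective,
          ← prod_sub_div_eq_dual x hI.strictMono_right.injective fun i => (sub_pos.2 (hy i)).ne',
          div_div_eq_mul_div]
        exact fun i => (sub_pos.2 ((hI.forall_lt_iff t).2 ⟨hy, hd⟩ i)).ne'
      · rw [if_neg fun h => hd h.2, if_pos hy, if_neg hd]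
    · rw [if_neg fun h => hy h.1, if_neg hy]

lemma weightedIntegral_one_succ {β : ℝ} (hβ : 0 < β) (m : ℕ) :
    weightedIntegral β (m + 1) (fun _ _ => 1) =
      stepConst β (m + 1) * weightedIntegral β m (fun _ _ => 1) := by
  have := isProbabilityMeasure_gammaMeasure (a := (m + 1 : ℕ) * β / 2) (r := β / 2)
    (by positivity) (by positivity)
  rw [weightedIntegral_succ hβ (F' := fun _ _ _ _ => 1) (fun _ => measurable_const)
    measurable_const fun _ _ _ _ _ => rfl]
  simp only [lintegral_const, measure_univ, mul_one]

lemma stepConst_pos {β : ℝ} (hβ : 0 < β) (m : ℕ) : stepConst β (m + 1) ≠ 0 := by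
  have hΓ := Real.Gamma_pos_of_pos (show 0 < (m + 1 : ℕ) * β / 2 by positivity)
  refine mul_ne_zero ?_ ?_ <;> rw [ne_eq, ENNReal.ofReal_eq_zero, not_le] <;> positivity

lemma stepConst_ne_top (β : ℝ) (m : ℕ) : stepConst β m ≠ ⊤ :=
  ENNReal.mul_ne_top ENNReal.ofReal_ne_top ENNReal.ofReal_ne_top

lemma weightedIntegral_zero (β : ℝ) (F : (Fin 0 → ℝ) → (Fin 0 → ℝ) → ENNReal) :
    weightedIntegral β 0 F = F 0 0 := by
  have h1 : {x : Fin 0 → ℝ | StrictMono x} = Set.univ := by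
    ext x; simp [Subsingleton.strictMono]
  have h2 : {w : Fin 0 → ℝ | ∀ i, 0 < w i} = Set.univ := by
    ext x; simp
  rw [weightedIntegral, h1, h2, Measure.restrict_univ, volume_pi, Measure.pi_of_empty _ 0,
    lintegral_dirac, lintegral_dirac]
  simp [weight]

lemma weightedIntegral_one_ne {β : ℝ} (hβ : 0 < β) (n : ℕ) :
    weightedIntegral β n (fun _ _ => 1) ≠ 0 ∧ weightedIntegral β n (fun _ _ => 1) ≠ ⊤ := by
  induction n with
  | zero => rw [weightedIntegral_zero]; simp
  | succ n ih =>
    rw [weightedIntegral_one_succ hβ]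
    exact ⟨mul_ne_zero (stepConst_pos hβ n) ih.1, ENNReal.mul_ne_top (stepConst_ne_top _ _) ih.2⟩

/-- The iterated recursion, normalized by the total mass and written without division. -/
lemma weightedIntegral_resolventTest_survival {β : ℝ} (hβ : 0 < β) (t : ℝ) (m j : ℕ) :
    weightedIntegral β (m + j) (resolventTest t (m + j) fun _ => 1) *
        weightedIntegral β m (fun _ _ => 1) =
      weightedIntegral β m (resolventTest t m (survival β t m j)) *
        weightedIntegral β (m + j) (fun _ _ => 1) := by
  induction j generalizing m with
  | zero => rfl
  | succ j ih =>
    have h := ih (m + 1)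
    rw [weightedIntegral_one_succ hβ, weightedIntegral_resolventTest_succ hβ t m
      (measurable_survival β t (m + 1) j), mul_left_comm, mul_assoc,
      ENNReal.mul_right_inj (stepConst_pos hβ m) (stepConst_ne_top _ _),
      show m + 1 + j = m + (j + 1) by omega] at h
    exact h

/-- The distribution function of the largest point of the ensemble is the survival probability of
the chain started at `0`. -/
theorem ensemble_lambdaMax_lt {β : ℝ} (hβ : 0 < β) (t : ℝ) {n : ℕ} (hn : 1 ≤ n) :
    ensemble β n {x | lambdaMax x < t} = survival β t 0 n 0 := by
  have hT := weightedIntegral_one_ne hβ n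
  -- the integral over the weights factors out
  set Γw := ∫⁻ w in {w : Fin n → ℝ | ∀ i, 0 < w i},
    ENNReal.ofReal (∏ i, gammaWeight β 1 (w i)) with hΓw
  set A := ∫⁻ x in {x : Fin n → ℝ | StrictMono x}, ENNReal.ofReal (weight β n x) with hA
  have hset : {x : Fin n → ℝ | lambdaMax x < t} = {x | ∀ i, x i < t} := by
    have : Nonempty (Fin n) := ⟨⟨0, hn⟩⟩
    ext x
    simp only [lambdaMax, Set.mem_ofPred_eq]
    refine ⟨fun h i => (le_ciSup (Set.finite_range x).bddAbove i).trans_lt h, fun h => ?_⟩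
    obtain ⟨i, hi⟩ := exists_eq_ciSup_of_finite (f := x)
    rw [← hi]; exact h i
  have hms : MeasurableSet {x : Fin n → ℝ | ∀ i, x i < t} := by
    simp only [Set.ofPred_forall]
    exact MeasurableSet.iInter fun i => measurableSet_lt (by fun_prop) (by fun_prop)
  set B := ∫⁻ x in {x : Fin n → ℝ | StrictMono x},
    Set.indicator {x | ∀ i, x i < t} (fun x => ENNReal.ofReal (weight β n x)) x with hB
  have hfac : ∀ φ : (Fin n → ℝ) → ENNReal, Measurable φ →
      weightedIntegral β n (fun x _ => φ x) =
        (∫⁻ x in {x : Fin n → ℝ | StrictMono x}, ENNReal.ofReal (weight β n x) * φ x) * Γw := by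
    intro φ hφ
    rw [weightedIntegral, ← lintegral_mul_const _ (by fun_prop)]
    refine lintegral_congr fun x => ?_
    rw [hΓw, ← lintegral_const_mul _ (by fun_prop)]
    refine lintegral_congr fun w => ?_
    rw [ENNReal.ofReal_mul (weight_nonneg _ _ _)]
    ring
  have h1 : weightedIntegral β n (fun _ _ => 1) = A * Γw := by
    rw [hfac _ measurable_const]; simp [hA]
  have h2 : weightedIntegral β n (resolventTest t n fun _ => 1) = B * Γw := by
    have h : resolventTest t n (fun _ => 1) =
        fun x _ => Set.indicator {x : Fin n → ℝ | ∀ i, x i < t} (fun _ => 1) x := by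
      funext x w
      simp [resolventTest, Set.indicator]
    rw [h, hfac _ (measurable_const.indicator hms), hB]
    congr 1
    refine lintegral_congr fun x => ?_
    by_cases hx : ∀ i, x i < t
    · rw [Set.indicator_of_mem (by exact hx), Set.indicator_of_mem (by exact hx), mul_one]
    · rw [Set.indicator_of_notMem (by exact hx), Set.indicator_of_notMem (by exact hx), mul_zero]
  have h3 : B * Γw = survival β t 0 n 0 * (A * Γw) := by
    have h := weightedIntegral_resolventTest_survival hβ t 0 n
    rw [weightedIntegral_zero, weightedIntegral_zero, Nat.zero_add, mul_one, h1, h2] at h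
    simpa [resolventTest] using h
  rw [h1] at hT
  have hΓ0 : Γw ≠ 0 := right_ne_zero_of_mul hT.1
  have hA0 : A ≠ 0 := left_ne_zero_of_mul hT.1
  have hΓt : Γw ≠ ⊤ := fun h => hT.2 (by rw [h, ENNReal.mul_top hA0])
  have hAt : A ≠ ⊤ := fun h => hT.2 (by rw [h, ENNReal.top_mul hΓ0])
  have h4 : B = survival β t 0 n 0 * A := by
    rwa [← mul_assoc, ENNReal.mul_left_inj hΓ0 hΓt] at h3
  -- both sides are expressed through integrals over increasing points
  have hZ : ENNReal.ofReal (partitionFunction β n) = n.factorial * A := by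
    rw [partitionFunction, ofReal_integral_eq_lintegral_ofReal (integrable_weight hβ n)
      (Filter.Eventually.of_forall (weight_nonneg β n))]
    refine lintegral_eq_factorial_mul (by fun_prop) (fun σ x => ?_) fun x hx => ?_
    · rw [weight_comp_perm]
    · rw [weight_eq_zero hβ hx, ENNReal.ofReal_zero]
  have hN : ∫⁻ x in {x : Fin n → ℝ | ∀ i, x i < t}, ENNReal.ofReal (weight β n x) =
      n.factorial * B := by
    rw [← lintegral_indicator hms]
    refine lintegral_eq_factorial_mul (Measurable.indicator (by fun_prop) hms) (fun σ x => ?_)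
      fun x hx => ?_
    · have : (∀ i, (x ∘ σ) i < t) ↔ ∀ i, x i < t :=
        ⟨fun h i => by simpa using h (σ.symm i), fun h i => h (σ i)⟩
      by_cases hx : ∀ i, x i < t
      · rw [Set.indicator_of_mem (by exact this.2 hx), Set.indicator_of_mem (by exact hx),
          weight_comp_perm]
      · rw [Set.indicator_of_notMem (by exact fun h => hx (this.1 h)),
          Set.indicator_of_notMem (by exact hx)]
    · by_cases ht : ∀ i, x i < t
      · rw [Set.indicator_of_mem (by exact ht), weight_eq_zero hβ hx, ENNReal.ofReal_zero]
      · rw [Set.indicator_of_notMem (by exact ht)]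
  have hfact : (n.factorial : ENNReal) ≠ 0 := by exact_mod_cast n.factorial_ne_zero
  rw [hset, ensemble, withDensity_apply _ hms]
  simp only [ENNReal.ofReal_div_of_pos (partitionFunction_pos hβ n), ENNReal.div_eq_inv_mul]
  rw [lintegral_const_mul _ (by fun_prop), hN, hZ, h4, ← ENNReal.div_eq_inv_mul,
    ENNReal.mul_div_mul_left _ _ hfact (ENNReal.natCast_ne_top _),
    ENNReal.mul_div_cancel_right hA0 hAt]

end Chain

/-! ### Gaussian and gamma moments -/

section Moments

lemma lintegral_exp_gaussian {β : ℝ} (hβ : 0 < β) (c : ℝ) :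
    ∫⁻ a, ENNReal.ofReal (Real.exp (c * a)) ∂(gaussianReal 0 (2 / β).toNNReal) =
      ENNReal.ofReal (Real.exp (c ^ 2 / β)) := by
  rw [← ofReal_integral_eq_lintegral_ofReal (integrable_exp_mul_gaussianReal c)
    (Filter.Eventually.of_forall fun a => (Real.exp_pos _).le)]
  have h := congrFun (mgf_fun_id_gaussianReal (μ := 0) (v := (2 / β).toNNReal)) c
  rw [mgf] at h
  rw [h, Real.coe_toNNReal _ (by positivity)]
  congr 2
  field_simp
  ring

lemma lintegral_gammaMeasure {a r : ℝ} {G : ℝ → ENNReal} (hG : Measurable G) :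
    ∫⁻ s, G s ∂(gammaMeasure a r) = ∫⁻ s, gammaPDF a r s * G s := by
  have hm : Measurable (gammaPDF a r) := by unfold gammaPDF; fun_prop
  rw [gammaMeasure, lintegral_withDensity_eq_lintegral_mul _ hm hG]
  rfl

lemma lintegral_exp_gamma {a r c : ℝ} (ha : 0 < a) (hr : 0 < r) (hc : c < r) :
    ∫⁻ s, ENNReal.ofReal (Real.exp (c * s)) ∂(gammaMeasure a r) =
      ENNReal.ofReal ((1 - c / r) ^ (-a)) := by
  have hrc : 0 < r - c := sub_pos.2 hc
  rw [lintegral_gammaMeasure (by fun_prop), ← mul_one (ENNReal.ofReal ((1 - c / r) ^ (-a))),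
    ← lintegral_gammaPDF_eq_one ha hrc, ← lintegral_const_mul' _ _ ENNReal.ofReal_ne_top]
  refine lintegral_congr fun s => ?_
  rcases lt_or_ge s 0 with hs | hs
  · rw [gammaPDF_of_neg hs, gammaPDF_of_neg hs, zero_mul, mul_zero]
  · have h1 : 1 - c / r = (r - c) / r := by field_simp
    rw [gammaPDF_of_nonneg hs, gammaPDF_of_nonneg hs, ← ENNReal.ofReal_mul' (Real.exp_pos _).le,
      ← ENNReal.ofReal_mul (by rw [h1]; positivity), h1, Real.rpow_neg (by positivity),
      Real.div_rpow hrc.le hr.le, mul_assoc, ← Real.exp_add]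
    congr 1
    have : 0 < (r - c) ^ a := by positivity
    rw [show -(r * s) + c * s = -((r - c) * s) by ring]
    field_simp

lemma lintegral_rpow_neg_gamma {a r p : ℝ} (ha : 0 < a) (hr : 0 < r) (hp : p < a) :
    ∫⁻ s, ENNReal.ofReal (s ^ (-p)) ∂(gammaMeasure a r) =
      ENNReal.ofReal (r ^ p * Real.Gamma (a - p) / Real.Gamma a) := by
  have hap : 0 < a - p := sub_pos.2 hp
  have hΓ := Real.Gamma_pos_of_pos ha
  have hΓ' := Real.Gamma_pos_of_pos hap
  rw [lintegral_gammaMeasure (by fun_prop),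
    ← mul_one (ENNReal.ofReal (r ^ p * Real.Gamma (a - p) / Real.Gamma a)),
    ← lintegral_gammaPDF_eq_one hap hr, ← lintegral_const_mul' _ _ ENNReal.ofReal_ne_top]
  refine lintegral_congr_ae ?_
  filter_upwards [Measure.ae_ne volume (0 : ℝ)] with s hs0
  rcases lt_or_gt_of_ne hs0 with hs | hs
  · rw [gammaPDF_of_neg hs, gammaPDF_of_neg hs, zero_mul, mul_zero]
  · rw [gammaPDF_of_nonneg hs.le, gammaPDF_of_nonneg hs.le,
      ← ENNReal.ofReal_mul' (by positivity), ← ENNReal.ofReal_mul (by positivity)]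
    congr 1
    rw [show a - p - 1 = (a - 1) + -p by ring, Real.rpow_add hs, Real.rpow_sub hr]
    have : 0 < r ^ p := by positivity
    field_simp

end Moments

/-! ### The Riccati step and its exponential potential -/

section Riccati

lemma pow_three_le_exp {z : ℝ} (hz : 0 ≤ z) : z ^ 3 ≤ 384 * Real.exp (z / 4) := by
  have h := Real.pow_div_factorial_le_exp (z / 4) (by positivity) 3
  norm_num [Nat.factorial] at h
  linarith

lemma sq_le_exp {z : ℝ} (hz : 0 ≤ z) : z ^ 2 ≤ 128 * Real.exp (z / 8) := by
  have h := Real.pow_div_factorial_le_exp (z / 8) (by positivity) 2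
  norm_num [Nat.factorial] at h
  linarith

/-- A bound for the failure of the exponential potential to decrease under one Riccati step
`δ ↦ (δ + q²) / (1 + δ)`. There is no failure for `δ ≤ q`. -/
lemma exp_riccati_le {κ δ q : ℝ} (hκ : 0 < κ) (hδ : 0 < δ) (hq : 0 < q) (hq' : q ≤ 3 / 2) :
    Real.exp (-(κ * ((δ + q ^ 2) / (1 + δ)))) ≤
      Real.exp (-(κ * δ)) + 384 / (κ ^ 2 * q) * Real.exp (-(κ * q / 4)) := by
  rcases le_or_gt δ q with h | h
  · have h1 : δ ≤ (δ + q ^ 2) / (1 + δ) := by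
      rw [le_div_iff₀ (by positivity)]; nlinarith
    have h2 : Real.exp (-(κ * ((δ + q ^ 2) / (1 + δ)))) ≤ Real.exp (-(κ * δ)) :=
      Real.exp_le_exp.2 (neg_le_neg (mul_le_mul_of_nonneg_left h1 hκ.le))
    have h3 : 0 ≤ 384 / (κ ^ 2 * q) * Real.exp (-(κ * q / 4)) := by positivity
    linarith
  set u := κ * ((δ + q ^ 2) / (1 + δ)) with hu
  have hu1 : κ * (δ / (1 + δ)) ≤ u := by
    rw [hu]; gcongr; nlinarith
  rcases le_or_gt δ 1 with h1 | h1
  · have hδ2 : δ / 2 ≤ δ / (1 + δ) := by gcongr; linarith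
    have hu2 : κ * δ / 2 ≤ u := le_trans (by nlinarith) hu1
    -- `e^{-u} - e^{-v} ≤ (v - u) e^{-u}` with `v = κ δ`
    have h2 : Real.exp (-u) - Real.exp (-(κ * δ)) ≤ (κ * δ - u) * Real.exp (-u) := by
      have := Real.add_one_le_exp (u - κ * δ)
      have h3 : Real.exp (-(κ * δ)) = Real.exp (-u) * Real.exp (u - κ * δ) := by
        rw [← Real.exp_add]; congr 1; ring
      rw [h3]
      nlinarith [Real.exp_pos (-u)]
    have h4 : κ * δ - u ≤ κ * δ ^ 2 := by
      have : δ - δ ^ 2 ≤ δ / (1 + δ) := by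
        rw [le_div_iff₀ (by positivity)]; nlinarith [pow_pos hδ 3]
      nlinarith
    have h5 : (κ * δ - u) * Real.exp (-u) ≤ κ * δ ^ 2 * Real.exp (-(κ * δ / 2)) := by
      calc _ ≤ κ * δ ^ 2 * Real.exp (-u) := by gcongr
        _ ≤ _ := by gcongr
    have h6 : κ * δ ^ 2 * Real.exp (-(κ * δ / 2)) ≤
        384 / (κ ^ 2 * q) * Real.exp (-(κ * q / 4)) := by
      have h7 := pow_three_le_exp (show 0 ≤ κ * δ by positivity)
      have h8 : Real.exp (-(κ * δ / 2)) = Real.exp (-(κ * δ / 4)) * (Real.exp (κ * δ / 4))⁻¹ := by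
        rw [← Real.exp_neg, ← Real.exp_add]; congr 1; ring
      calc κ * δ ^ 2 * Real.exp (-(κ * δ / 2)) =
            (κ * δ) ^ 3 * (Real.exp (κ * δ / 4))⁻¹ / (κ ^ 2 * δ) * Real.exp (-(κ * δ / 4)) := by
            rw [h8]; field_simp
        _ ≤ 384 / (κ ^ 2 * δ) * Real.exp (-(κ * δ / 4)) := by
            gcongr
            rw [← div_eq_mul_inv, div_le_iff₀ (Real.exp_pos _)]
            exact h7
        _ ≤ _ := by gcongr
    linarith
  · have hu2 : κ / 2 ≤ u := by
      refine le_trans ?_ hu1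
      have : 1 / 2 ≤ δ / (1 + δ) := by
        rw [div_le_div_iff₀ (by norm_num) (by positivity)]; linarith
      nlinarith
    have h2 : Real.exp (-u) ≤ Real.exp (-(κ / 2)) := by gcongr
    have h3 : Real.exp (-(κ / 2)) ≤ 384 / (κ ^ 2 * q) * Real.exp (-(κ * q / 4)) := by
      have h7 := sq_le_exp hκ.le
      have h8 : Real.exp (-(κ / 2)) = Real.exp (-(κ * (3 / 2) / 4)) * (Real.exp (κ / 8))⁻¹ := by
        rw [← Real.exp_neg, ← Real.exp_add]; congr 1; ring
      rw [h8]
      calc _ ≤ Real.exp (-(κ * q / 4)) * (Real.exp (κ / 8))⁻¹ := by gcongr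
        _ ≤ Real.exp (-(κ * q / 4)) * (384 / (κ ^ 2 * q)) := by
            gcongr
            rw [inv_eq_one_div, div_le_div_iff₀ (Real.exp_pos _) (by positivity)]
            nlinarith [sq_nonneg κ]
        _ = _ := by ring
    have := Real.exp_pos (-(κ * δ))
    linarith

/-- Lower bound for the relative increment `κ (q' - q) / 4` of consecutive edge terms in units of the
error factor in `exp_riccati_le`. The two cases are the bulk `q² ≥ 1 / N`, where `q'` is comparable
to `q`, and the edge, where `q' - q` is of order `N ^ (-1/2)`. -/
lemma riccati_scale_le {κ q q' N h b : ℝ} (hN : 1 ≤ N) (hh : 0 < h) (hb : 1 ≤ b)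
    (hκ : κ = b * N * h ^ 2 / 4) (hreg : 1 ≤ b * N * h ^ 3) (hq : h ≤ q) (hlt : q < q')
    (hdiff : (q' - q) * (q' + q) = 1 / N) (h1 : 1 / 16 ≤ κ ^ 2 * q) :
    1 / 768 ≤ κ ^ 2 * q * (κ * (q' - q) / 4) := by
  have hN0 : 0 < N := by linarith
  have hb0 : 0 < b := by linarith
  have hq0 : 0 < q := by linarith
  have hq' : 0 < q' := by linarith
  have hκ0 : 0 < κ := by rw [hκ]; positivity
  have hd0 : 0 < q' - q := sub_pos.2 hlt
  rcases le_or_gt (1 / N) (q ^ 2) with hc | hc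
  · have hq2 : q' ≤ 2 * q := by nlinarith
    have h3 : 1 / (3 * N) ≤ q * (q' - q) := by
      have h4 : 1 / N ≤ (q' - q) * (3 * q) := by
        rw [← hdiff]; exact mul_le_mul_of_nonneg_left (by linarith) hd0.le
      calc 1 / (3 * N) = 1 / N / 3 := by field_simp
        _ ≤ (q' - q) * (3 * q) / 3 := by gcongr
        _ = _ := by ring
    have h5 : 1 / 64 ≤ κ ^ 3 / N := by
      have h6 : 1 ≤ (b * N * h ^ 3) ^ 2 := one_le_pow₀ hreg
      have h7 : κ ^ 3 / N = (b * N * h ^ 3) ^ 2 * b / 64 := by rw [hκ]; field_simp; ring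
      rw [h7]
      have := one_le_mul_of_one_le_of_one_le h6 hb
      linarith
    calc (1 / 768 : ℝ) = 1 / 64 / 12 := by norm_num
      _ ≤ κ ^ 3 / N / 12 := by gcongr
      _ = κ ^ 3 / 4 * (1 / (3 * N)) := by field_simp; norm_num
      _ ≤ κ ^ 3 / 4 * (q * (q' - q)) := by gcongr
      _ = κ ^ 2 * q * (κ * (q' - q) / 4) := by ring
  · set w := √N with hw
    have hw0 : 0 < w := Real.sqrt_pos.2 hN0
    have hw2 : N = w ^ 2 := (Real.sq_sqrt hN0.le).symm
    have e1 : q * w ≤ 1 := by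
      rw [hw2, lt_div_iff₀ (by positivity), ← mul_pow] at hc
      exact (abs_le_one_iff_mul_self_le_one.2 (by nlinarith)).trans' (le_abs_self _)
    have e0 : ((q' - q) * w) * ((q' + q) * w) = 1 := by
      calc _ = (q' - q) * (q' + q) * w ^ 2 := by ring
        _ = 1 := by rw [hdiff, hw2]; field_simp
    have e3 : 2 / 5 ≤ (q' - q) * w := by
      have hp : 0 < (q' - q) * w := mul_pos hd0 hw0
      have : (q' + q) * w = (q' - q) * w + 2 * (q * w) := by ring
      rw [this] at e0
      nlinarith
    have e4 : h * w ≤ 1 := le_trans (by gcongr) e1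
    have e5 : 1 ≤ b * h ^ 2 * w := by
      have h6 : b * N * h ^ 3 = b * h ^ 2 * w * (h * w) := by rw [hw2]; ring
      rw [h6] at hreg
      have hp : 0 < b * h ^ 2 * w := by positivity
      exact hreg.trans (mul_le_of_le_one_right hp.le e4)
    have e6 : κ * (q' - q) / 4 = b * h ^ 2 * w * ((q' - q) * w) / 16 := by rw [hκ, hw2]; ring
    rw [e6]
    calc (1 / 768 : ℝ) ≤ 1 / 16 * (1 * (2 / 5) / 16) := by norm_num
      _ ≤ _ := by gcongr

/-- The correction terms `exp (-(κ / 4) * √(h² + i / N))` absorb the failure in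
`exp_riccati_le`: it is at most a constant multiple of their increment. -/
lemma riccati_error_le {κ q q' N h b : ℝ} (hN : 1 ≤ N) (hh : 0 < h) (hb : 1 ≤ b)
    (hκ : κ = b * N * h ^ 2 / 4) (hreg : 1 ≤ b * N * h ^ 3) (hh1 : h ≤ 1)
    (hq : h ≤ q) (hq' : 0 < q') (hqq : q' ^ 2 = q ^ 2 + 1 / N) :
    384 / (κ ^ 2 * q) * Real.exp (-(κ * q / 4)) ≤
      1000000 * (Real.exp (-(κ * q / 4)) - Real.exp (-(κ * q' / 4))) := by
  have hN0 : 0 < N := by linarith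
  have hb0 : 0 < b := by linarith
  have hq0 : 0 < q := by linarith
  have hκ0 : 0 < κ := by rw [hκ]; positivity
  have hdiff : (q' - q) * (q' + q) = 1 / N := by linarith [hqq]
  have hlt : q < q' := by
    have h0 : 0 < 1 / N := by positivity
    rw [← hdiff] at h0
    exact sub_pos.1 (pos_of_mul_pos_left h0 (by positivity))
  have h1 : 1 / 16 ≤ κ ^ 2 * q := by
    have hκh : 1 / 4 ≤ κ * h := by
      have : κ * h = b * N * h ^ 3 / 4 := by rw [hκ]; ring
      linarith
    calc (1 / 16 : ℝ) = (1 / 4) ^ 2 := by norm_num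
      _ ≤ (κ * h) ^ 2 := by gcongr
      _ = κ ^ 2 * (h * h) := by ring
      _ ≤ κ ^ 2 * (1 * q) := by gcongr
      _ = κ ^ 2 * q := by ring
  have h2 := riccati_scale_le hN hh hb hκ hreg hq hlt hdiff h1
  set u := κ * (q' - q) / 4 with hu
  have hu0 : 0 < u := by rw [hu]; have := sub_pos.2 hlt; positivity
  -- `1 - e^{-u} ≥ u / (1 + u)`
  have h3 : Real.exp (-(κ * q' / 4)) = Real.exp (-(κ * q / 4)) * Real.exp (-u) := by
    rw [← Real.exp_add]; congr 1; rw [hu]; ring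
  have h4 : Real.exp (-u) ≤ 1 / (1 + u) := by
    rw [Real.exp_neg, inv_eq_one_div]
    exact one_div_le_one_div_of_le (by positivity) (by linarith [Real.add_one_le_exp u])
  have h5 : 384 / (κ ^ 2 * q) ≤ 1000000 * (1 - 1 / (1 + u)) := by
    have : 1000000 * (1 - 1 / (1 + u)) = 1000000 * u / (1 + u) := by field_simp; ring
    rw [this, div_le_div_iff₀ (by positivity) (by positivity)]
    have h6 : u / 16 ≤ κ ^ 2 * q * u := by
      calc u / 16 = 1 / 16 * u := by ring
        _ ≤ _ := by gcongr
    linarith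
  rw [h3]
  calc _ ≤ 1000000 * (1 - 1 / (1 + u)) * Real.exp (-(κ * q / 4)) := by gcongr
    _ ≤ 1000000 * (1 - Real.exp (-u)) * Real.exp (-(κ * q / 4)) := by gcongr
    _ = _ := by ring

end Riccati

/-! ### The upper tail -/

section UpperTail

lemma exp_neg_add_sq_le {x : ℝ} (h0 : 0 ≤ x) (h1 : x ≤ 1 / 2) :
    Real.exp (-(x + x ^ 2)) ≤ 1 - x := by
  have h2 := Real.quadratic_le_exp_of_nonneg (show 0 ≤ x + x ^ 2 by positivity)
  rw [Real.exp_neg, inv_le_comm₀ (Real.exp_pos _) (by linarith), inv_eq_one_div,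
    div_le_iff₀ (by linarith)]
  have h3 : 1 ≤ (1 + (x + x ^ 2) + (x + x ^ 2) ^ 2 / 2) * (1 - x) := by
    have h4 : (1 + (x + x ^ 2) + (x + x ^ 2) ^ 2 / 2) * (1 - x) =
        1 + x ^ 2 * (1 - x - x ^ 2 - x ^ 3) / 2 := by ring
    have h5 : 0 ≤ 1 - x - x ^ 2 - x ^ 3 := by
      have := pow_le_pow_left₀ h0 h1 2
      have := pow_le_pow_left₀ h0 h1 3
      linarith
    rw [h4]
    have := mul_nonneg (sq_nonneg x) h5
    linarith
  exact h3.trans (mul_le_mul_of_nonneg_right h2 (by linarith))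

/-- The exponential moment of one step `d ↦ t - a - s / d` at `d = √n D`, compared with the
potential after the Riccati step. With `κ = β N h² / 4`, the Gaussian variable contributes
`exp (κ h² / 4)`, which turns the exponent `-κ (1 + 2 h²)` of the centering into
`-κ (1 + 7 / 4 * h²)`. The second factor is the moment of the gamma variable. -/
lemma exp_mul_rpow_le {β κ N h k D : ℝ} (hβ : 1 ≤ β) (hN : 1 ≤ N) (hh : 0 < h) (hh1 : h ≤ 1)
    (hκ : κ = β * N * h ^ 2 / 4) (hk : 0 ≤ k) (hkN : k ≤ N) (hD : 1 < D) :
    Real.exp (-(κ * (1 + 7 / 4 * h ^ 2))) * (1 - h ^ 2 / (2 * D)) ^ (-(k * β / 2)) ≤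
      Real.exp (-(κ * ((D - 1 + (1 + h ^ 2 - k / N)) / D))) := by
  have hN0 : 0 < N := by linarith
  have hβ0 : 0 < β := by linarith
  have hD0 : 0 < D := by linarith
  have hκ0 : 0 < κ := by rw [hκ]; positivity
  have hh2 : h ^ 2 ≤ 1 := pow_le_one₀ hh.le hh1
  set x := h ^ 2 / (2 * D) with hx
  have hx0 : 0 ≤ x := by positivity
  have hxh : x ≤ h ^ 2 / 2 := by rw [hx]; gcongr; linarith
  have hx1 : x ≤ 1 / 2 := by linarith
  have h1 : (1 - x) ^ (-(k * β / 2)) ≤ Real.exp (k * β / 2 * (x + x ^ 2)) := by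
    have h2 : Real.exp (k * β / 2 * (x + x ^ 2)) =
        (Real.exp (-(x + x ^ 2))) ^ (-(k * β / 2)) := by
      rw [← Real.exp_mul]; congr 1; ring
    rw [h2]
    exact Real.rpow_le_rpow_of_nonpos (Real.exp_pos _) (exp_neg_add_sq_le hx0 hx1)
      (neg_nonpos.2 (by positivity))
  refine (mul_le_mul_of_nonneg_left h1 (Real.exp_pos _).le).trans ?_
  rw [← Real.exp_add]
  refine Real.exp_le_exp.2 ?_
  set ρ := k / N with hρ
  have hρ0 : 0 ≤ ρ := by positivity
  have hρ1 : ρ ≤ 1 := (div_le_one hN0).2 hkN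
  have h3 : k * β / 2 * (x + x ^ 2) = κ * (ρ * (1 + x) / D) := by
    rw [hκ, hρ, hx]; field_simp; ring
  have h4 : ρ * x / D ≤ h ^ 2 / 2 := by
    calc ρ * x / D ≤ 1 * x / 1 := by gcongr
      _ ≤ _ := by linarith
  have h5 : h ^ 2 / D ≤ h ^ 2 := div_le_self (sq_nonneg h) hD.le
  have h6 : (D - 1 + (1 + h ^ 2 - ρ)) / D = 1 + h ^ 2 / D - ρ / D := by field_simp; ring
  have h7 : ρ * (1 + x) / D = ρ / D + ρ * x / D := by ring
  rw [h3, h6, h7]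
  have h8 : κ * (ρ / D + ρ * x / D + (1 + h ^ 2 / D - ρ / D)) ≤ κ * (1 + 7 / 4 * h ^ 2) := by
    exact mul_le_mul_of_nonneg_left (by linarith [sq_nonneg h]) hκ0.le
  linarith

/-- The correction terms `exp (-(κ / 4) * √(h² + (n - k) / n))`, increasing in `k`. -/
def edgeTerm (κ h : ℝ) (n k : ℕ) : ℝ := Real.exp (-(κ * √(h ^ 2 + (1 - k / n)) / 4))

lemma riccati_step_le {β κ h : ℝ} {n k : ℕ} (hβ : 1 ≤ β) (hn : 1 ≤ n) (hh : 0 < h) (hh1 : h ≤ 1)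
    (hκ : κ = β * n * h ^ 2 / 4) (hreg : 1 ≤ β * n * h ^ 3) (hkn : k + 1 ≤ n) {D : ℝ}
    (hD : 1 < D) :
    Real.exp (-(κ * (1 + 7 / 4 * h ^ 2))) * (1 - h ^ 2 / (2 * D)) ^ (-((k + 1 : ℕ) * β / 2)) ≤
      Real.exp (-(κ * (D - 1))) +
        1000000 * (edgeTerm κ h n (k + 1) - edgeTerm κ h n k) := by
  have hN : (1 : ℝ) ≤ n := by exact_mod_cast hn
  have hN0 : (0 : ℝ) < n := by linarith
  have hkN : ((k + 1 : ℕ) : ℝ) ≤ n := by exact_mod_cast hkn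
  have hκ0 : 0 < κ := by rw [hκ]; positivity
  have hh2 : h ^ 2 ≤ 1 := pow_le_one₀ hh.le hh1
  have hy1 : 0 ≤ 1 - ((k + 1 : ℕ) : ℝ) / n := sub_nonneg.2 ((div_le_one hN0).2 hkN)
  have hρ0 : 0 ≤ ((k + 1 : ℕ) : ℝ) / n := by positivity
  set q := √(h ^ 2 + (1 - ((k + 1 : ℕ) : ℝ) / n)) with hq
  set q' := √(h ^ 2 + (1 - (k : ℝ) / n)) with hq'
  have hqsq : q ^ 2 = h ^ 2 + (1 - ((k + 1 : ℕ) : ℝ) / n) := Real.sq_sqrt (by positivity)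
  have hk1 : ((k + 1 : ℕ) : ℝ) / n = k / n + 1 / n := by push_cast; ring
  have h1n : 0 < 1 / (n : ℝ) := by positivity
  have hq'arg : 0 < h ^ 2 + (1 - (k : ℝ) / n) := by
    have : 0 < h ^ 2 := by positivity
    linarith
  have hq'sq : q' ^ 2 = h ^ 2 + (1 - (k : ℝ) / n) := Real.sq_sqrt hq'arg.le
  have hhq : h ≤ q := Real.le_sqrt_of_sq_le (by linarith)
  have hq32 : q ≤ 3 / 2 := by
    rw [hq]
    refine (Real.sqrt_le_sqrt (by linarith : _ ≤ (3 / 2 : ℝ) ^ 2)).trans ?_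
    rw [Real.sqrt_sq (by norm_num)]
  refine (exp_mul_rpow_le hβ hN hh hh1 hκ (by positivity) hkN hD).trans ?_
  have h1 := exp_riccati_le (δ := D - 1) hκ0 (by linarith) (hh.trans_le hhq) hq32
  rw [hqsq, show 1 + (D - 1) = D by ring,
    show h ^ 2 + (1 - ((k + 1 : ℕ) : ℝ) / n) = 1 + h ^ 2 - ((k + 1 : ℕ) : ℝ) / n by ring] at h1
  refine h1.trans (add_le_add_right ?_ _)
  exact riccati_error_le hN hh hβ hκ hreg hh1 hhq (Real.sqrt_pos.2 hq'arg)
    (by rw [hqsq, hq'sq, hk1]; ring)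

lemma edgeTerm_mono {κ h : ℝ} (hκ : 0 ≤ κ) {n k l : ℕ} (hkl : k ≤ l) :
    edgeTerm κ h n k ≤ edgeTerm κ h n l := by
  unfold edgeTerm
  gcongr

/-- The survival probability is bounded below by means of the potential
`exp (-κ (d / √n - 1))` of the pivots `d`, which is a supermartingale up to errors absorbed by the
edge terms. -/
lemma one_le_survival_add {β κ h t : ℝ} {n : ℕ} (hβ : 1 ≤ β) (hn : 1 ≤ n) (hh : 0 < h)
    (hh1 : h ≤ 1) (hκ : κ = β * n * h ^ 2 / 4) (hreg : 1 ≤ β * n * h ^ 3)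
    (ht : t = 2 * √n * (1 + h ^ 2)) (j k : ℕ) (hjk : k + j = n) (f : ℝ) :
    1 ≤ survival β t k j f + ENNReal.ofReal
      (Real.exp (-(κ * (1 + 7 / 4 * h ^ 2))) * Real.exp (κ / √n * f) +
        1000000 * (edgeTerm κ h n n - edgeTerm κ h n k)) := by
  have hβ0 : 0 < β := by linarith
  have hN0 : (0 : ℝ) < n := by exact_mod_cast hn
  have hw0 : 0 < √(n : ℝ) := Real.sqrt_pos.2 hN0
  have hw2 : √(n : ℝ) ^ 2 = n := Real.sq_sqrt hN0.le
  have hκ0 : 0 < κ := by rw [hκ]; positivity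
  have hG : ∀ k, k ≤ n → 0 ≤ 1000000 * (edgeTerm κ h n n - edgeTerm κ h n k) := fun k hk =>
    mul_nonneg (by norm_num) (sub_nonneg.2 (edgeTerm_mono hκ0.le hk))
  induction j generalizing k f with
  | zero => exact le_add_right le_rfl
  | succ j ih =>
    have hγ := isProbabilityMeasure_gammaMeasure (a := (k + 1 : ℕ) * β / 2) (r := β / 2)
      (by positivity) (by positivity)
    set V := survival β t (k + 1) j with hV
    have hVm : Measurable V := measurable_survival β t (k + 1) j
    have hstep : ∀ a, 1 ≤ (∫⁻ s, (if 0 < t - a - f then V (s / (t - a - f)) else 0)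
        ∂(gammaMeasure ((k + 1 : ℕ) * β / 2) (β / 2))) +
        ENNReal.ofReal (Real.exp (-(κ * ((t - a - f) / √n - 1))) +
          1000000 * (edgeTerm κ h n n - edgeTerm κ h n k)) := by
      intro a
      set d := t - a - f
      rcases le_or_gt d (√n) with hd | hd
      · -- the potential alone is at least `1`
        refine le_add_left ?_
        rw [← ENNReal.ofReal_one]
        refine ENNReal.ofReal_le_ofReal ?_
        have h1 : d / √n ≤ 1 := (div_le_one hw0).2 hd
        have h2 : 1 ≤ Real.exp (-(κ * (d / √n - 1))) := Real.one_le_exp (by nlinarith)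
        linarith [hG k (by omega)]
      · have hd0 : 0 < d := hw0.trans hd
        simp only [if_pos hd0]
        set D := d / √n with hD
        have hD1 : 1 < D := (one_lt_div hw0).2 hd
        have hcr : κ / √n / d / (β / 2) = h ^ 2 / (2 * D) := by
          rw [hκ, hD]; field_simp; rw [hw2]; ring
        have hc : κ / √n / d < β / 2 := by
          have h1 : h ^ 2 / (2 * D) < 1 := by
            rw [div_lt_one (by positivity)]
            have : h ^ 2 ≤ 1 := pow_le_one₀ hh.le hh1
            linarith
          rwa [← hcr, div_lt_one (by positivity)] at h1
        have hint : ∫⁻ s, ENNReal.ofReal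
            (Real.exp (-(κ * (1 + 7 / 4 * h ^ 2))) * Real.exp (κ / √n * (s / d)) +
              1000000 * (edgeTerm κ h n n - edgeTerm κ h n (k + 1)))
            ∂(gammaMeasure ((k + 1 : ℕ) * β / 2) (β / 2)) =
            ENNReal.ofReal (Real.exp (-(κ * (1 + 7 / 4 * h ^ 2))) *
              (1 - h ^ 2 / (2 * D)) ^ (-((k + 1 : ℕ) * β / 2)) +
              1000000 * (edgeTerm κ h n n - edgeTerm κ h n (k + 1))) := by
          have hpos : 0 ≤ (1 - h ^ 2 / (2 * D)) ^ (-((k + 1 : ℕ) * β / 2)) := by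
            rw [← hcr]
            exact Real.rpow_nonneg (sub_nonneg.2 ((div_le_one (by positivity)).2 hc.le)) _
          rw [ENNReal.ofReal_add (mul_nonneg (Real.exp_pos _).le hpos) (hG (k + 1) (by omega)),
            ENNReal.ofReal_mul (Real.exp_pos _).le, ← hcr,
            ← lintegral_exp_gamma (by positivity) (by positivity) hc,
            ← lintegral_const_mul' _ _ ENNReal.ofReal_ne_top]
          have hone : ENNReal.ofReal
              (1000000 * (edgeTerm κ h n n - edgeTerm κ h n (k + 1))) =
              ∫⁻ _, ENNReal.ofReal (1000000 * (edgeTerm κ h n n - edgeTerm κ h n (k + 1)))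
                ∂(gammaMeasure ((k + 1 : ℕ) * β / 2) (β / 2)) := by
            rw [lintegral_const, measure_univ, mul_one]
          rw [hone, ← lintegral_add_right _ measurable_const]
          refine lintegral_congr fun s => ?_
          rw [ENNReal.ofReal_add (by positivity) (hG (k + 1) (by omega)),
            ENNReal.ofReal_mul (Real.exp_pos _).le]
          congr 4
          ring
        calc (1 : ENNReal) = ∫⁻ _, 1 ∂(gammaMeasure ((k + 1 : ℕ) * β / 2) (β / 2)) := by
              rw [lintegral_const, measure_univ, mul_one]
          _ ≤ ∫⁻ s, (V (s / d) + ENNReal.ofReal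
              (Real.exp (-(κ * (1 + 7 / 4 * h ^ 2))) * Real.exp (κ / √n * (s / d)) +
              1000000 * (edgeTerm κ h n n - edgeTerm κ h n (k + 1))))
              ∂(gammaMeasure ((k + 1 : ℕ) * β / 2) (β / 2)) :=
            lintegral_mono fun s => ih (k + 1) (by omega) (s / d)
          _ = (∫⁻ s, V (s / d) ∂(gammaMeasure ((k + 1 : ℕ) * β / 2) (β / 2))) +
              ENNReal.ofReal (Real.exp (-(κ * (1 + 7 / 4 * h ^ 2))) *
              (1 - h ^ 2 / (2 * D)) ^ (-((k + 1 : ℕ) * β / 2)) +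
              1000000 * (edgeTerm κ h n n - edgeTerm κ h n (k + 1))) := by
            rw [lintegral_add_right _ (by fun_prop), hint]
          _ ≤ _ := by
            refine add_le_add_right (ENNReal.ofReal_le_ofReal ?_) _
            have := riccati_step_le hβ hn hh hh1 hκ hreg (show k + 1 ≤ n by omega) hD1
            linarith
    have hint : ∫⁻ a, ENNReal.ofReal (Real.exp (-(κ * ((t - a - f) / √n - 1))) +
          1000000 * (edgeTerm κ h n n - edgeTerm κ h n k))
          ∂(gaussianReal 0 (2 / β).toNNReal) =
        ENNReal.ofReal
          (Real.exp (-(κ * (1 + 7 / 4 * h ^ 2))) * Real.exp (κ / √n * f) +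
            1000000 * (edgeTerm κ h n n - edgeTerm κ h n k)) := by
      have hsplit : Real.exp (-(κ * (1 + 7 / 4 * h ^ 2))) * Real.exp (κ / √n * f) =
          Real.exp (-(κ * ((t - f) / √n - 1))) * Real.exp ((κ / √n) ^ 2 / β) := by
        rw [← Real.exp_add, ← Real.exp_add]
        congr 1
        rw [div_pow, hw2, ht]
        have : κ ^ 2 / n / β = κ * (h ^ 2 / 4) := by rw [hκ]; field_simp
        rw [this]
        field_simp
        ring
      rw [hsplit, ENNReal.ofReal_add (by positivity) (hG k (by omega)),
        ENNReal.ofReal_mul (Real.exp_pos _).le, ← lintegral_exp_gaussian hβ0,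
        ← lintegral_const_mul' _ _ ENNReal.ofReal_ne_top]
      have hone : ENNReal.ofReal (1000000 * (edgeTerm κ h n n - edgeTerm κ h n k)) =
          ∫⁻ _, ENNReal.ofReal (1000000 * (edgeTerm κ h n n - edgeTerm κ h n k))
            ∂(gaussianReal 0 (2 / β).toNNReal) := by
        rw [lintegral_const, measure_univ, mul_one]
      rw [hone, ← lintegral_add_right _ measurable_const]
      refine lintegral_congr fun a => ?_
      rw [ENNReal.ofReal_add (by positivity) (hG k (by omega)),
        ← ENNReal.ofReal_mul (Real.exp_pos _).le, ← Real.exp_add]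
      congr 3
      ring
    calc (1 : ENNReal) = ∫⁻ _, 1 ∂(gaussianReal 0 (2 / β).toNNReal) := by
          rw [lintegral_const, measure_univ, mul_one]
      _ ≤ ∫⁻ a, ((∫⁻ s, (if 0 < t - a - f then V (s / (t - a - f)) else 0)
            ∂(gammaMeasure ((k + 1 : ℕ) * β / 2) (β / 2))) +
          ENNReal.ofReal (Real.exp (-(κ * ((t - a - f) / √n - 1))) +
          1000000 * (edgeTerm κ h n n - edgeTerm κ h n k)))
          ∂(gaussianReal 0 (2 / β).toNNReal) := lintegral_mono hstep
      _ = _ := by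
        rw [lintegral_add_right _ (by fun_prop), hint]
        rfl

lemma measurableSet_lambdaMax_lt (n : ℕ) (t : ℝ) :
    MeasurableSet {x : Fin n → ℝ | lambdaMax x < t} := by
  refine measurableSet_lt ?_ measurable_const
  unfold lambdaMax
  exact Measurable.iSup fun i => measurable_pi_apply i

/-- The upper tail bound, with `ε = h²`, in the range where its exponent is not small. -/
theorem right_tail_of_one_le {β h : ℝ} {n : ℕ} (hβ : 1 ≤ β) (hn : 1 ≤ n) (hh : 0 < h)
    (hh1 : h ≤ 1) (hreg : 1 ≤ β * n * h ^ 3) :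
    (ensemble β n).real {x | 2 * √n * (1 + h ^ 2) ≤ lambdaMax x} ≤
      1000001 * Real.exp (-(β * n * h ^ 3 / 16)) := by
  have hβ0 : 0 < β := by linarith
  have hN0 : (0 : ℝ) < n := by exact_mod_cast hn
  have := isProbabilityMeasure_ensemble hβ0 n
  set t := 2 * √n * (1 + h ^ 2) with ht
  set κ := β * n * h ^ 2 / 4 with hκ
  have hκ0 : 0 < κ := by rw [hκ]; positivity
  have h1 := one_le_survival_add hβ hn hh hh1 hκ hreg ht n 0 (by omega) 0
  rw [← ensemble_lambdaMax_lt hβ0 t hn] at h1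
  have hset : {x : Fin n → ℝ | t ≤ lambdaMax x} = {x | lambdaMax x < t}ᶜ := by
    ext x; simp
  have hE : edgeTerm κ h n n = Real.exp (-(β * n * h ^ 3 / 16)) := by
    rw [edgeTerm, div_self hN0.ne', sub_self, add_zero, Real.sqrt_sq hh.le, hκ]
    congr 1; ring
  have hE0 : 0 < edgeTerm κ h n 0 := Real.exp_pos _
  have hEn : edgeTerm κ h n 0 ≤ edgeTerm κ h n n := edgeTerm_mono hκ0.le (Nat.zero_le n)
  have hA : Real.exp (-(κ * (1 + 7 / 4 * h ^ 2))) ≤ Real.exp (-(β * n * h ^ 3 / 16)) := by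
    rw [Real.exp_le_exp, neg_le_neg_iff]
    have : β * n * h ^ 3 / 16 = κ * (h / 4) := by rw [hκ]; ring
    rw [this]
    gcongr
    nlinarith [sq_nonneg h]
  rw [hset, probReal_compl_eq_one_sub (measurableSet_lambdaMax_lt n t)]
  have h2 : (1 : ℝ) ≤ (ensemble β n).real {x | lambdaMax x < t} +
      (Real.exp (-(κ * (1 + 7 / 4 * h ^ 2))) * Real.exp (κ / √n * 0) +
        1000000 * (edgeTerm κ h n n - edgeTerm κ h n 0)) := by
    have h3 := ENNReal.toReal_mono (ENNReal.add_ne_top.2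
      ⟨measure_ne_top _ _, ENNReal.ofReal_ne_top⟩) h1
    rw [ENNReal.toReal_add (measure_ne_top _ _) ENNReal.ofReal_ne_top, ENNReal.toReal_ofReal
      (add_nonneg (by positivity) (by nlinarith)), ENNReal.toReal_one] at h3
    exact h3
  rw [mul_zero, Real.exp_zero, mul_one] at h2
  linarith

end UpperTail

/-! ### Exponential moments along a test vector -/

section TestVector

lemma ae_pos_gammaMeasure (a r : ℝ) : ∀ᵐ s ∂(gammaMeasure a r), 0 < s := by
  have hm : Measurable (gammaPDF a r) := by unfold gammaPDF; fun_prop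
  rw [gammaMeasure, ae_withDensity_iff hm]
  filter_upwards [Measure.ae_ne volume (0 : ℝ)] with s hs h
  rcases lt_or_gt_of_ne hs with h1 | h1
  · exact absurd (gammaPDF_of_neg h1) h
  · exact h1

/-- The factor contributed by one step to the exponential upper bound for the survival
probability with test vector `v`. -/
def stepFactor (β t θ : ℝ) (v : ℕ → ℝ) (i : ℕ) : ENNReal :=
  ENNReal.ofReal (Real.exp (θ * t * v i ^ 2 + (θ * v i ^ 2) ^ 2 / β)) *
    ∫⁻ s, ENNReal.ofReal (Real.exp (-(2 * θ * v i * v (i + 1) * √s)))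
      ∂(gammaMeasure (i * β / 2) (β / 2))

/-- On survival, the quadratic form of `t` minus the tridiagonal matrix is positive at the test
vector `v`, and Markov's inequality is applied to its exponential. Step by step this uses
`d v² + v'² s / d ≥ 2 √s v v'`. -/
lemma survival_le {β t θ : ℝ} (hβ : 0 < β) (hθ : 0 ≤ θ) {v : ℕ → ℝ} {n : ℕ} (hv : v (n + 1) = 0)
    (j k : ℕ) (hjk : k + j = n) (f : ℝ) :
    survival β t k j f ≤ (∏ i ∈ Finset.Ico (k + 1) (n + 1), stepFactor β t θ v i) *
      ENNReal.ofReal (Real.exp (-(θ * v (k + 1) ^ 2 * f))) := by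
  induction j generalizing k f with
  | zero =>
    obtain rfl : k = n := by omega
    simp [survival, hv]
  | succ j ih =>
    rw [Finset.prod_eq_prod_Ico_succ_bot (by omega)]
    set P := ∏ i ∈ Finset.Ico (k + 1 + 1) (n + 1), stepFactor β t θ v i
    set u := v (k + 1)
    set u' := v (k + 1 + 1)
    set γ := gammaMeasure ((k + 1 : ℕ) * β / 2) (β / 2)
    set I := ∫⁻ s, ENNReal.ofReal (Real.exp (-(2 * θ * u * u' * √s))) ∂γ with hI
    have h1 : ∀ a, (∫⁻ s, (if 0 < t - a - f then survival β t (k + 1) j (s / (t - a - f)) else 0)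
        ∂γ) ≤ P * I * ENNReal.ofReal (Real.exp (θ * u ^ 2 * (t - a - f))) := by
      intro a
      set d := t - a - f
      rcases le_or_gt d 0 with hd | hd
      · simp [not_lt.2 hd]
      simp only [if_pos hd]
      rw [mul_right_comm, hI, ← lintegral_const_mul _ (by fun_prop)]
      refine lintegral_mono_ae ?_
      filter_upwards [ae_pos_gammaMeasure ((k + 1 : ℕ) * β / 2) (β / 2)] with s hs
      refine (ih (k + 1) (by omega) (s / d)).trans ?_
      rw [mul_assoc P, ← ENNReal.ofReal_mul (Real.exp_pos _).le, ← Real.exp_add]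
      refine mul_le_mul_right (ENNReal.ofReal_le_ofReal (Real.exp_le_exp.2 ?_)) P
      have h2 : 0 ≤ (d * u - √s * u') ^ 2 / d := by positivity
      have h3 : (d * u - √s * u') ^ 2 / d = u ^ 2 * d - 2 * u * u' * √s + u' ^ 2 * (s / d) := by
        have : (d * u - √s * u') ^ 2 =
            (d * u) ^ 2 - 2 * (d * u) * (√s * u') + √s ^ 2 * u' ^ 2 := by ring
        rw [this, Real.sq_sqrt hs.le]
        field_simp
      rw [h3] at h2
      nlinarith [mul_nonneg hθ h2]
    calc survival β t k (j + 1) f ≤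
          ∫⁻ a, P * I * ENNReal.ofReal (Real.exp (θ * u ^ 2 * (t - a - f)))
            ∂(gaussianReal 0 (2 / β).toNNReal) := lintegral_mono h1
      _ = _ := by
        rw [lintegral_const_mul _ (by fun_prop)]
        have h2 : ∀ a, ENNReal.ofReal (Real.exp (θ * u ^ 2 * (t - a - f))) =
            ENNReal.ofReal (Real.exp (θ * u ^ 2 * (t - f))) *
              ENNReal.ofReal (Real.exp (-(θ * u ^ 2) * a)) := by
          intro a
          rw [← ENNReal.ofReal_mul (Real.exp_pos _).le, ← Real.exp_add]
          congr 2; ring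
        simp only [h2]
        rw [lintegral_const_mul' _ _ ENNReal.ofReal_ne_top, lintegral_exp_gaussian hβ,
          ← ENNReal.ofReal_mul (Real.exp_pos _).le, ← Real.exp_add, stepFactor]
        have h3 : ENNReal.ofReal (Real.exp (θ * u ^ 2 * (t - f) + (-(θ * u ^ 2)) ^ 2 / β)) =
            ENNReal.ofReal (Real.exp (θ * t * u ^ 2 + (θ * u ^ 2) ^ 2 / β)) *
              ENNReal.ofReal (Real.exp (-(θ * u ^ 2 * f))) := by
          rw [← ENNReal.ofReal_mul (Real.exp_pos _).le, ← Real.exp_add]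
          congr 2; ring
        rw [h3]
        ring

/-- Log-convexity of the Gamma function on `[x - p - 1, x]`. -/
lemma Gamma_sub_le {x p : ℝ} (hp : 0 ≤ p) (hx : 0 < x - p - 1) :
    Real.Gamma (x - p) ≤ (x - p - 1) ^ (-p) * Real.Gamma x := by
  have hA := Real.Gamma_pos_of_pos hx
  have hB := Real.Gamma_pos_of_pos (show 0 < x - p by linarith)
  have hC := Real.Gamma_pos_of_pos (show 0 < x by linarith)
  have hp1 : 0 < 1 + p := by linarith
  have h1 := Real.convexOn_log_Gamma.2 (Set.mem_Ioi.2 hx)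
    (Set.mem_Ioi.2 (show 0 < x by linarith)) (show 0 ≤ p / (1 + p) by positivity)
    (show 0 ≤ 1 / (1 + p) by positivity) (by field_simp; ring)
  have h2 : (p / (1 + p)) • (x - p - 1) + (1 / (1 + p)) • x = x - p := by
    simp only [smul_eq_mul]
    field_simp
    ring
  have h3 : Real.log (Real.Gamma (x - p)) =
      Real.log (x - p - 1) + Real.log (Real.Gamma (x - p - 1)) := by
    rw [← Real.log_mul hx.ne' hA.ne', ← Real.Gamma_add_one hx.ne']
    congr 2; ring
  rw [h2] at h1
  simp only [Function.comp_apply, smul_eq_mul] at h1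
  have h4 : (1 + p) * Real.log (Real.Gamma (x - p)) ≤
      p * Real.log (Real.Gamma (x - p - 1)) + Real.log (Real.Gamma x) := by
    have := mul_le_mul_of_nonneg_left h1 hp1.le
    refine this.trans (le_of_eq ?_)
    field_simp
  rw [← Real.log_le_log_iff hB (mul_pos (Real.rpow_pos_of_pos hx _) hC),
    Real.log_mul (Real.rpow_pos_of_pos hx _).ne' hC.ne', Real.log_rpow hx]
  rw [h3] at h4 ⊢
  linarith

lemma exp_neg_mul_sqrt_le {k q s : ℝ} (hk : 0 < k) (hq : 0 ≤ q) (hs : 0 < s) :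
    Real.exp (-(q * √s)) ≤
      Real.exp (-(q * √k)) * k ^ (q * √k / 2) * s ^ (-(q * √k / 2)) := by
  have h1 : Real.log (s / k) ≤ 2 * (√s / √k - 1) := by
    have h := Real.log_le_sub_one_of_pos (show 0 < √s / √k by positivity)
    have h2 : Real.log (s / k) = 2 * Real.log (√s / √k) := by
      rw [← Real.sqrt_div hs.le, Real.log_sqrt (by positivity)]; ring
    linarith
  rw [Real.rpow_def_of_pos hk, Real.rpow_def_of_pos hs, ← Real.exp_add, ← Real.exp_add,
    Real.exp_le_exp]
  rw [Real.log_div hs.ne' hk.ne'] at h1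
  have h3 : √k * (Real.log s - Real.log k) ≤ 2 * (√s - √k) := by
    have := mul_le_mul_of_nonneg_left h1 (Real.sqrt_nonneg k)
    refine this.trans (le_of_eq ?_)
    field_simp
  nlinarith [mul_le_mul_of_nonneg_left h3 hq]

/-- A bound for the Laplace transform of the square root of a gamma variable of mean `k`. It comes
from replacing `√s` by its lower bound `√k (1 + log (s / k) / 2)`. -/
lemma lintegral_exp_neg_sqrt_gamma_le {k β q : ℝ} (hk : 0 < k) (hβ : 0 < β) (hq : 0 ≤ q)
    (hc : 2 * (q * √k / 2 + 1) ≤ k * β / 2) :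
    ∫⁻ s, ENNReal.ofReal (Real.exp (-(q * √s))) ∂(gammaMeasure (k * β / 2) (β / 2)) ≤
      ENNReal.ofReal (Real.exp (-(q * √k) +
        2 * (q * √k / 2) * (q * √k / 2 + 1) / (k * β / 2))) := by
  set p := q * √k / 2
  set a := k * β / 2 with ha
  have hp : 0 ≤ p := by positivity
  have ha0 : 0 < a := by positivity
  calc _ ≤ ∫⁻ s, ENNReal.ofReal (Real.exp (-(q * √k)) * k ^ p) * ENNReal.ofReal (s ^ (-p))
        ∂(gammaMeasure a (β / 2)) := by
        refine lintegral_mono_ae ?_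
        filter_upwards [ae_pos_gammaMeasure a (β / 2)] with s hs
        rw [← ENNReal.ofReal_mul (by positivity)]
        exact ENNReal.ofReal_le_ofReal (exp_neg_mul_sqrt_le hk hq hs)
    _ = ENNReal.ofReal (Real.exp (-(q * √k)) * k ^ p *
          ((β / 2) ^ p * Real.Gamma (a - p) / Real.Gamma a)) := by
        rw [lintegral_const_mul' _ _ ENNReal.ofReal_ne_top,
          lintegral_rpow_neg_gamma ha0 (by positivity) (by linarith),
          ← ENNReal.ofReal_mul (by positivity)]
    _ ≤ _ := by
        refine ENNReal.ofReal_le_ofReal ?_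
        have hx : 0 < a - p - 1 := by linarith
        have hG := Real.Gamma_pos_of_pos ha0
        have h1 : Real.Gamma (a - p) / Real.Gamma a ≤ (a - p - 1) ^ (-p) :=
          (div_le_iff₀ hG).2 (Gamma_sub_le hp hx)
        have h2 : k ^ p * (β / 2) ^ p = a ^ p := by
          rw [← Real.mul_rpow hk.le (by positivity), ha]; congr 1; ring
        set u := (p + 1) / a with hu
        have hu0 : 0 ≤ u := by positivity
        have hu1 : u ≤ 1 / 2 := by rw [hu, div_le_iff₀ ha0]; linarith
        have h3 : a ^ p * (a - p - 1) ^ (-p) = (1 - u) ^ (-p) := by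
          have h : 1 - u = (a - p - 1) / a := by rw [hu]; field_simp; ring
          rw [h, Real.div_rpow hx.le ha0.le, Real.rpow_neg ha0.le, div_inv_eq_mul, mul_comm]
        have h4 : (1 - u) ^ (-p) ≤ Real.exp (2 * p * (p + 1) / a) := by
          have h5 : Real.exp (-(2 * u)) ≤ 1 - u :=
            (Real.exp_le_exp.2 (by nlinarith)).trans (exp_neg_add_sq_le hu0 hu1)
          refine (Real.rpow_le_rpow_of_nonpos (Real.exp_pos _) h5 (by linarith)).trans
            (le_of_eq ?_)
          rw [← Real.exp_mul, hu]
          congr 1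
          ring
        calc Real.exp (-(q * √k)) * k ^ p * ((β / 2) ^ p * Real.Gamma (a - p) / Real.Gamma a)
            = Real.exp (-(q * √k)) * (k ^ p * (β / 2) ^ p) *
                (Real.Gamma (a - p) / Real.Gamma a) := by ring
          _ ≤ Real.exp (-(q * √k)) * (k ^ p * (β / 2) ^ p) * (a - p - 1) ^ (-p) :=
              mul_le_mul_of_nonneg_left h1 (by positivity)
          _ = Real.exp (-(q * √k)) * (1 - u) ^ (-p) := by rw [h2, mul_assoc, h3]
          _ ≤ _ := by
              rw [Real.exp_add]
              exact mul_le_mul_of_nonneg_left h4 (Real.exp_pos _).le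

/-- If the next coordinate of `v` vanishes, the gamma variable drops out and no condition on `i` is
needed. -/
lemma stepFactor_le {β t θ : ℝ} (hβ : 0 < β) (hθ : 0 ≤ θ) {v : ℕ → ℝ} {i : ℕ} (hi : 1 ≤ i)
    (hv : 0 ≤ v i) (hv' : 0 ≤ v (i + 1))
    (hc : v (i + 1) = 0 ∨ 2 * (θ * v i * v (i + 1) * √i + 1) ≤ i * β / 2) :
    stepFactor β t θ v i ≤ ENNReal.ofReal (Real.exp (θ * t * v i ^ 2 + θ ^ 2 * v i ^ 4 / β
      - 2 * θ * (v i * v (i + 1)) * √i + 4 * θ ^ 2 * (v i ^ 2 * v (i + 1) ^ 2) / β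
      + 4 * θ * (v i * v (i + 1)) / (β * √i))) := by
  have hi0 : (0 : ℝ) < i := by exact_mod_cast hi
  have : IsProbabilityMeasure (gammaMeasure (i * β / 2) (β / 2)) :=
    isProbabilityMeasure_gammaMeasure (by positivity) (by positivity)
  rcases hc with hc | hc
  · rw [stepFactor, hc]
    simp only [mul_zero, zero_mul, neg_zero, Real.exp_zero, ENNReal.ofReal_one, lintegral_one,
      measure_univ, mul_one]
    refine ENNReal.ofReal_le_ofReal (Real.exp_le_exp.2 (le_of_eq ?_))
    ring
  · have h := lintegral_exp_neg_sqrt_gamma_le hi0 hβ (q := 2 * θ * v i * v (i + 1))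
      (by positivity) (by convert hc using 3; ring)
    refine (mul_le_mul_right h _).trans ?_
    rw [← ENNReal.ofReal_mul (Real.exp_pos _).le, ← Real.exp_add]
    refine ENNReal.ofReal_le_ofReal (Real.exp_le_exp.2 (le_of_eq ?_))
    obtain ⟨r, hr, hr2⟩ : ∃ r : ℝ, 0 < r ∧ r ^ 2 = i :=
      ⟨√i, by positivity, Real.sq_sqrt hi0.le⟩
    rw [← hr2, Real.sqrt_sq hr.le]
    field_simp
    ring

end TestVector

/-! ### The tent function -/

section Tent

/-- The tent function on `{0, …, 2 m}` with peak `m`, extended by zero. The truncated subtraction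
gives the value `0` beyond `2 m`. -/
def tent (m l : ℕ) : ℝ := ((min l (2 * m - l) : ℕ) : ℝ)

lemma tent_zero (m : ℕ) : tent m 0 = 0 := by simp [tent]

lemma tent_nonneg (m l : ℕ) : 0 ≤ tent m l := Nat.cast_nonneg _

lemma tent_le (m l : ℕ) : tent m l ≤ m := by
  unfold tent
  exact_mod_cast (by omega : min l (2 * m - l) ≤ m)

lemma tent_eq_zero {m l : ℕ} (h : 2 * m ≤ l) : tent m l = 0 := by
  unfold tent
  exact_mod_cast (by omega : min l (2 * m - l) = 0)

lemma tent_of_le {m l : ℕ} (h : l ≤ m) : tent m l = l := by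
  unfold tent
  exact_mod_cast (by omega : min l (2 * m - l) = l)

lemma sq_tent_succ_sub_le (m l : ℕ) :
    (tent m (l + 1) - tent m l) ^ 2 ≤ if l < 2 * m then 1 else 0 := by
  split_ifs with h
  · have h1 : tent m (l + 1) ≤ tent m l + 1 := by
      unfold tent
      exact_mod_cast (by omega : min (l + 1) (2 * m - (l + 1)) ≤ min l (2 * m - l) + 1)
    have h2 : tent m l ≤ tent m (l + 1) + 1 := by
      unfold tent
      exact_mod_cast (by omega : min l (2 * m - l) ≤ min (l + 1) (2 * m - (l + 1)) + 1)
    nlinarith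
  · rw [tent_eq_zero (not_lt.1 h), tent_eq_zero (by omega)]
    norm_num

lemma sum_sq_tent_sub_le (m n : ℕ) :
    ∑ l ∈ Finset.range n, (tent m (l + 1) - tent m l) ^ 2 ≤ 2 * m := by
  refine (Finset.sum_le_sum fun l _ => sq_tent_succ_sub_le m l).trans ?_
  rw [← Finset.sum_filter, Finset.sum_const, nsmul_eq_mul, mul_one]
  have h : (Finset.filter (fun l => l < 2 * m) (Finset.range n)).card ≤ 2 * m := by
    refine (Finset.card_le_card fun l hl => ?_).trans (Finset.card_range (2 * m)).le
    exact Finset.mem_range.2 (Finset.mem_filter.1 hl).2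
  exact_mod_cast h

lemma le_sum_sq_tent {m n : ℕ} (h : m ≤ n) :
    (m : ℝ) ^ 3 / 3 ≤ ∑ l ∈ Finset.range n, tent m (l + 1) ^ 2 := by
  have h1 : ∑ l ∈ Finset.range m, ((l : ℝ) + 1) ^ 2 ≤
      ∑ l ∈ Finset.range n, tent m (l + 1) ^ 2 := by
    refine le_trans (Finset.sum_le_sum fun l hl => ?_) (Finset.sum_le_sum_of_subset_of_nonneg
      (Finset.range_mono h) fun l _ _ => sq_nonneg _)
    rw [tent_of_le (Finset.mem_range.1 hl)]
    push_cast
    exact le_rfl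
  refine le_trans ?_ h1
  clear h1 h
  induction m with
  | zero => simp
  | succ m ih =>
    rw [Finset.sum_range_succ]
    push_cast
    have : (0 : ℝ) ≤ m := Nat.cast_nonneg m
    nlinarith

/-- Summation by parts, the boundary terms being zero. -/
lemma two_mul_sum_tent_mul {m n : ℕ} (h : 2 * m ≤ n) :
    2 * ∑ l ∈ Finset.range n, tent m (l + 1) * tent m l =
      2 * ∑ l ∈ Finset.range n, tent m (l + 1) ^ 2 -
        ∑ l ∈ Finset.range n, (tent m (l + 1) - tent m l) ^ 2 := by
  have h1 : ∑ l ∈ Finset.range n, (tent m (l + 1) ^ 2 - tent m l ^ 2) = 0 := by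
    rw [Finset.sum_range_sub (fun l => tent m l ^ 2), tent_zero, tent_eq_zero h]
    ring
  have h2 : ∑ l ∈ Finset.range n, (tent m (l + 1) - tent m l) ^ 2 =
      2 * ∑ l ∈ Finset.range n, tent m (l + 1) ^ 2 -
        2 * ∑ l ∈ Finset.range n, tent m (l + 1) * tent m l -
        ∑ l ∈ Finset.range n, (tent m (l + 1) ^ 2 - tent m l ^ 2) := by
    rw [Finset.mul_sum, Finset.mul_sum, ← Finset.sum_sub_distrib, ← Finset.sum_sub_distrib]
    exact Finset.sum_congr rfl fun l _ => by ring
  rw [h2, h1]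
  ring

end Tent

/-! ### The lower tail -/

section LowerTail

/-- The exponent in `stepFactor_le` as a combination of `T²` and `T T'`. -/
lemma step_exponent_le {β t θ N r T T' M c : ℝ} (hβ : 1 ≤ β) (hθ : 0 ≤ θ) (hN : 0 < N)
    (hT : 0 ≤ T) (hTM : T ≤ M) (hT' : 0 ≤ T') (hTM' : T' ≤ M) (hc : N * c ≤ r)
    (hr : 2 / 3 * N ≤ r) :
    θ * t * T ^ 2 + θ ^ 2 * T ^ 4 / β - 2 * θ * (T * T') * r + 4 * θ ^ 2 * (T ^ 2 * T' ^ 2) / β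
        + 4 * θ * (T * T') / (β * r) ≤
      (θ * t + 5 * θ ^ 2 * M ^ 2 / β) * T ^ 2 - (2 * θ * N * c - 6 * θ / N) * (T * T') := by
  have hβ0 : 0 < β := by linarith
  have hr0 : 0 < r := by linarith
  have hTT0 : 0 ≤ T * T' := mul_nonneg hT hT'
  have hT2 : T ^ 2 ≤ M ^ 2 := pow_le_pow_left₀ hT hTM 2
  have hT2' : T' ^ 2 ≤ M ^ 2 := pow_le_pow_left₀ hT' hTM' 2
  have h1 : θ ^ 2 * T ^ 4 / β ≤ θ ^ 2 * M ^ 2 / β * T ^ 2 := by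
    have h := mul_le_mul_of_nonneg_left hT2 (show 0 ≤ θ ^ 2 * T ^ 2 / β by positivity)
    refine le_trans (le_of_eq ?_) (h.trans (le_of_eq ?_)) <;> ring
  have h2 : 4 * θ ^ 2 * (T ^ 2 * T' ^ 2) / β ≤ 4 * (θ ^ 2 * M ^ 2 / β * T ^ 2) := by
    have h := mul_le_mul_of_nonneg_left hT2' (show 0 ≤ 4 * θ ^ 2 * T ^ 2 / β by positivity)
    refine le_trans (le_of_eq ?_) (h.trans (le_of_eq ?_)) <;> ring
  have h3 : 4 * θ * (T * T') / (β * r) ≤ 6 * θ / N * (T * T') := by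
    have h4 : 4 * θ * (T * T') / (β * r) ≤ 4 * θ * (T * T') / (2 / 3 * N) :=
      div_le_div_of_nonneg_left (mul_nonneg (by positivity) hTT0) (by positivity)
        (hr.trans (le_mul_of_one_le_left hr0.le hβ))
    refine h4.trans (le_of_eq ?_)
    field_simp
    ring
  have h4 := mul_le_mul_of_nonneg_left hc (show 0 ≤ 2 * θ * (T * T') from
    mul_nonneg (by positivity) hTT0)
  have h5 : 5 * θ ^ 2 * M ^ 2 / β * T ^ 2 = 5 * (θ ^ 2 * M ^ 2 / β * T ^ 2) := by ring
  rw [add_mul, h5]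
  linarith

/-- The bound `survival_le` for the tent `v_i = tent m (n + 1 - i)`, summed over `l = n - i`. On the
support `l < 2 m`, the index `i` is at least `n - 2 m`, whence `√i ≥ √n (1 - 2 m / n)`. -/
lemma survival_le_exp_sum {β t θ N : ℝ} (hβ : 1 ≤ β) (hθ : 0 ≤ θ) {m n : ℕ} (hm : 16 * m ≤ n)
    (hn : 1 ≤ n) (hN : 0 < N) (hnN : N ^ 2 = n)
    (hc : 16 * θ * m ^ 2 * N ≤ 2 * n * β) (hc' : 16 ≤ n * β) :
    survival β t 0 n 0 ≤ ENNReal.ofReal (Real.exp (∑ l ∈ Finset.range n,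
      ((θ * t + 5 * θ ^ 2 * m ^ 2 / β) * tent m (l + 1) ^ 2 -
        (2 * θ * N * (1 - 2 * m / n) - 6 * θ / N) * (tent m (l + 1) * tent m l)))) := by
  have hβ0 : 0 < β := by linarith
  have hn0 : (0 : ℝ) < n := by exact_mod_cast hn
  have hm' : (16 : ℝ) * m ≤ n := by exact_mod_cast hm
  set v : ℕ → ℝ := fun i => tent m (n + 1 - i) with hv
  have hv0 : v (n + 1) = 0 := by simp [hv, tent_zero]
  refine (survival_le hβ0 hθ hv0 n 0 (by omega) 0).trans ?_
  rw [mul_zero, neg_zero, Real.exp_zero, ENNReal.ofReal_one, mul_one,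
    Finset.prod_Ico_eq_prod_range, ← Finset.prod_range_reflect, Real.exp_sum,
    ENNReal.ofReal_prod_of_nonneg fun _ _ => (Real.exp_pos _).le]
  refine Finset.prod_le_prod' fun l hl => ?_
  have hl := Finset.mem_range.1 hl
  have hi : 0 + 1 + (n + 1 - (0 + 1) - 1 - l) = n - l := by omega
  rw [hi]
  have hv1 : v (n - l) = tent m (l + 1) := by
    simp only [hv]; congr 1; omega
  have hv2 : v (n - l + 1) = tent m l := by
    simp only [hv]; congr 1; omega
  set T := tent m (l + 1)
  set T' := tent m l with hT'
  have hT0 : 0 ≤ T := tent_nonneg _ _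
  have hT0' : 0 ≤ T' := tent_nonneg _ _
  have hTm : T ≤ m := tent_le _ _
  have hTm' : T' ≤ m := tent_le _ _
  have hi1 : 1 ≤ n - l := by omega
  have hi0 : (0 : ℝ) < ((n - l : ℕ) : ℝ) := by exact_mod_cast hi1
  have hin : ((n - l : ℕ) : ℝ) ≤ n := by exact_mod_cast Nat.sub_le n l
  set r := √((n - l : ℕ) : ℝ) with hr
  have hr0 : 0 < r := Real.sqrt_pos.2 hi0
  have hr2 : r ^ 2 = ((n - l : ℕ) : ℝ) := Real.sq_sqrt hi0.le
  have hrN : r ≤ N := by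
    rw [← abs_of_pos hr0, ← abs_of_pos hN, ← sq_le_sq, hr2, hnN]; exact hin
  have hTT : T * T' ≤ m ^ 2 := by nlinarith
  rcases le_or_gt (2 * m) l with h | h
  · have hz : T' = 0 := tent_eq_zero h
    refine (stepFactor_le hβ0 hθ hi1 (by rw [hv1]; exact hT0) (by rw [hv2]; exact hT0')
      (Or.inl (by rw [hv2, hz]))).trans (ENNReal.ofReal_le_ofReal (Real.exp_le_exp.2 ?_))
    have hz1 : T = 0 := tent_eq_zero (by omega)
    rw [hv1, hv2, hz, hz1]
    simp
  have hnl : (n : ℝ) - 2 * m ≤ ((n - l : ℕ) : ℝ) := by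
    rw [Nat.cast_sub (by omega)]
    have : (l : ℝ) ≤ 2 * m := by exact_mod_cast h.le
    linarith
  have hrl : N * (1 - 2 * m / n) ≤ r := by
    have h1 : N * (1 - 2 * m / n) = (n - 2 * m) / N := by
      rw [← hnN]; field_simp
    rw [h1, div_le_iff₀ hN]
    nlinarith
  have hrl' : 2 / 3 * N ≤ r := by
    have h1 : 2 * (m : ℝ) / n ≤ 1 / 8 := by rw [div_le_iff₀ hn0]; linarith
    nlinarith
  refine (stepFactor_le hβ0 hθ hi1 (by rw [hv1]; exact hT0) (by rw [hv2]; exact hT0')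
    (Or.inr ?_)).trans (ENNReal.ofReal_le_ofReal (Real.exp_le_exp.2 ?_))
  · rw [hv1, hv2, ← hr]
    have h1 : θ * T * T' * r ≤ θ * m ^ 2 * N := by
      rw [mul_assoc θ]
      exact mul_le_mul (mul_le_mul_of_nonneg_left hTT hθ) hrN hr0.le (by positivity)
    have h2 : 7 / 8 * (n : ℝ) ≤ ((n - l : ℕ) : ℝ) := by linarith
    nlinarith [mul_le_mul_of_nonneg_right h2 hβ0.le]
  · rw [hv1, hv2, ← hr]
    exact step_exponent_le hβ hθ hN hT0 hTm hT0' hTm' hrl hrl'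

/-- The total exponent for `A = ∑ T²`, `B = ∑ T T'` and `D = ∑ (T - T')²`. The main terms are
`2 θ N (1 - η) A - 2 θ N B`, of order `-θ N η A`; `θ` is chosen such that the term quadratic in `θ`
is half as large, and `m` of order `n η` such that `D` and `2 m / n` are small compared with `η A`
and `η`. -/
lemma tent_exponent_le {β η N n m A B D θ : ℝ} (hβ : 0 < β) (hη : 0 < η) (hN : 0 < N)
    (hnN : N ^ 2 = n) (hnη : 24 ≤ n * η) (hm1 : m ≤ n * η / 8) (hm2 : n * η / 16 ≤ m)
    (hm0 : 0 < m) (hη1 : η ≤ 1) (hηm : 12 ≤ η * m ^ 2) (hθ0 : 0 < θ)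
    (hθm : 10 * θ * m ^ 2 = β * N * η) (hA : m ^ 3 / 3 ≤ A) (hB0 : 0 ≤ B) (hD0 : 0 ≤ D)
    (hD : D ≤ 2 * m) (hB : 2 * B = 2 * A - D) :
    (θ * (2 * N * (1 - η)) + 5 * θ ^ 2 * m ^ 2 / β) * A -
        (2 * θ * N * (1 - 2 * m / n) - 6 * θ / N) * B ≤ -(β * n ^ 2 * η ^ 3 / 1920) := by
  have hn0 : 0 < n := by rw [← hnN]; positivity
  have hA0 : 0 < A := lt_of_lt_of_le (by positivity) hA
  have hDA : D ≤ η * A / 2 := by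
    have h1 := mul_le_mul_of_nonneg_left hA hη.le
    have h2 := mul_le_mul_of_nonneg_right hηm hm0.le
    have h3 : η * (m ^ 3 / 3) = η * m ^ 2 * m / 3 := by ring
    linarith
  have hBA : B ≤ A := by linarith
  have hBA' : A * (1 - η / 4) ≤ B := by linarith
  have hmη : 1 - η / 4 ≤ 1 - 2 * m / n := by
    have : 2 * m / n ≤ η / 4 := by rw [div_le_iff₀ hn0]; linarith
    linarith
  have h1 : A * (1 - η / 2) ≤ (1 - 2 * m / n) * B := by
    have h2 : (1 - η / 4) * (A * (1 - η / 4)) ≤ (1 - 2 * m / n) * B :=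
      mul_le_mul hmη hBA' (mul_nonneg hA0.le (by linarith)) (by linarith)
    have h3 : (1 - η / 4) * (A * (1 - η / 4)) = A * (1 - η / 2) + A * η ^ 2 / 16 := by ring
    have h4 : 0 ≤ A * η ^ 2 / 16 := by positivity
    linarith
  have h2 : 6 * θ / N * B ≤ θ * N * η / 4 * A := by
    have h3 : 6 * θ / N ≤ θ * N * η / 4 := by
      rw [div_le_iff₀ hN]
      have h4 : θ * N * η / 4 * N = θ * (n * η) / 4 := by rw [← hnN]; ring
      have h5 := mul_le_mul_of_nonneg_left hnη hθ0.le
      linarith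
    exact mul_le_mul h3 hBA hB0 (by positivity)
  have h3 : 5 * θ ^ 2 * m ^ 2 / β = θ * N * η / 2 := by
    rw [div_eq_iff hβ.ne']
    linear_combination θ / 2 * hθm
  have h4 : β * n ^ 2 * η ^ 3 / 1920 ≤ θ * N * η / 4 * A := by
    have h5 : θ * N * η / 4 * (m ^ 3 / 3) = β * n * η ^ 2 * m / 120 := by
      rw [← hnN]
      linear_combination N * η * m / 120 * hθm
    have h6 : θ * N * η / 4 * (m ^ 3 / 3) ≤ θ * N * η / 4 * A :=
      mul_le_mul_of_nonneg_left hA (by positivity)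
    have h7 := mul_le_mul_of_nonneg_left hm2 (show 0 ≤ β * n * η ^ 2 / 120 by positivity)
    have h8 : β * n * η ^ 2 / 120 * (n * η / 16) = β * n ^ 2 * η ^ 3 / 1920 := by ring
    linarith
  have h5 := mul_le_mul_of_nonneg_left h1 (show 0 ≤ 2 * θ * N by positivity)
  rw [h3]
  linarith

/-- The lower tail in the range where the exponent is at least of order `β`. The test vector is a
tent of width proportional to `n η` located at the largest indices. -/
lemma survival_le_exp {β η N : ℝ} {n : ℕ} (hβ : 1 ≤ β) (hη : 0 < η) (hη1 : η ≤ 1 / 2)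
    (hN : 0 < N) (hnN : N ^ 2 = n) (hreg : 3072 ≤ (n : ℝ) ^ 2 * η ^ 3) :
    survival β (2 * N * (1 - η)) 0 n 0 ≤
      ENNReal.ofReal (Real.exp (-(β * n ^ 2 * η ^ 3 / 1920))) := by
  have hβ0 : 0 < β := by linarith
  have hn0 : (0 : ℝ) < n := by rw [← hnN]; positivity
  have hn1 : 1 ≤ n := by exact_mod_cast hn0
  have hnη : 78 ≤ n * η := by
    have h : 78 ^ 2 ≤ (n * η) ^ 2 := by
      have h1 := mul_le_mul_of_nonneg_left hη1 (show 0 ≤ (n * η) ^ 2 by positivity)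
      have h2 : (n * η) ^ 2 * η = n ^ 2 * η ^ 3 := by ring
      linarith
    exact (sq_le_sq₀ (by norm_num) (by positivity)).1 h
  have hηn : n * η ≤ n / 2 := by
    have := mul_le_mul_of_nonneg_left hη1 hn0.le
    linarith
  set m := ⌊n * η / 8⌋₊
  have hm1 : (m : ℝ) ≤ n * η / 8 := Nat.floor_le (by positivity)
  have hm2 : n * η / 16 ≤ m := by
    have := Nat.lt_floor_add_one (n * η / 8)
    linarith
  have hm0 : (0 : ℝ) < m := by linarith
  have hmn' : 16 * (m : ℝ) ≤ n := by linarith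
  have hmn : 16 * m ≤ n := by exact_mod_cast hmn'
  obtain ⟨θ, hθ0, hθm⟩ : ∃ θ : ℝ, 0 < θ ∧ 10 * θ * m ^ 2 = β * N * η :=
    ⟨β * N * η / (10 * m ^ 2), by positivity, by field_simp⟩
  have hηm : 12 ≤ η * m ^ 2 := by
    have h1 : (n * η / 16) ^ 2 ≤ (m : ℝ) ^ 2 := pow_le_pow_left₀ (by positivity) hm2 2
    have h2 := mul_le_mul_of_nonneg_left h1 hη.le
    have h3 : η * (n * η / 16) ^ 2 = n ^ 2 * η ^ 3 / 256 := by ring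
    linarith
  refine (survival_le_exp_sum (t := 2 * N * (1 - η)) hβ hθ0.le hmn hn1 hN hnN ?_ ?_).trans
    (ENNReal.ofReal_le_ofReal (Real.exp_le_exp.2 ?_))
  · have h1 : 16 * θ * m ^ 2 * N = 8 / 5 * (β * (n * η)) := by
      rw [← hnN]; linear_combination 8 / 5 * N * hθm
    have h2 := mul_le_mul_of_nonneg_left hηn hβ0.le
    have h3 := mul_pos hβ0 hn0
    linarith
  · have := mul_le_mul_of_nonneg_left hβ hn0.le
    linarith
  · rw [Finset.sum_sub_distrib, ← Finset.mul_sum, ← Finset.mul_sum]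
    exact tent_exponent_le hβ0 hη hN hnN (by linarith) hm1 hm2 hm0 (by linarith) hηm hθ0 hθm
      (le_sum_sq_tent (by omega))
      (Finset.sum_nonneg fun _ _ => mul_nonneg (tent_nonneg _ _) (tent_nonneg _ _))
      (Finset.sum_nonneg fun _ _ => sq_nonneg _) (sum_sq_tent_sub_le m n)
      (two_mul_sum_tent_mul (by omega))

/-- The lower tail bound in the range where its exponent is large. The level is raised to
`2 √n (1 - ε / 2)` in order to pass to the event of a strict inequality. -/
theorem left_tail_of_large {β ε : ℝ} {n : ℕ} (hβ : 1 ≤ β) (hn : 1 ≤ n) (hε : 0 < ε) (hε1 : ε ≤ 1)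
    (hreg : 24576 ≤ (n : ℝ) ^ 2 * ε ^ 3) :
    (ensemble β n).real {x | lambdaMax x ≤ 2 * √n * (1 - ε)} ≤
      Real.exp (-(β * n ^ 2 * ε ^ 3 / 15360)) := by
  have hβ0 : 0 < β := by linarith
  have hn0 : (0 : ℝ) < n := by exact_mod_cast hn
  have := isProbabilityMeasure_ensemble hβ0 n
  have h := survival_le_exp (η := ε / 2) (N := √n) (n := n) hβ (by positivity) (by linarith)
    (by positivity) (Real.sq_sqrt hn0.le) (by nlinarith)
  rw [← ensemble_lambdaMax_lt hβ0 _ hn] at h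
  refine ENNReal.toReal_le_of_le_ofReal (Real.exp_pos _).le ?_
  refine (measure_mono fun x hx => ?_).trans (h.trans (ENNReal.ofReal_le_ofReal
    (Real.exp_le_exp.2 (le_of_eq ?_))))
  · have h1 : 0 < √(n : ℝ) := by positivity
    refine lt_of_le_of_lt (show lambdaMax x ≤ _ from hx) ?_
    nlinarith
  · ring

end LowerTail

end BetaHermite

end

theorem theorem1 :
    ∃ C : ℝ, 0 < C ∧ ∀ (n : ℕ) (β ε : ℝ), 1 ≤ n → 1 ≤ β → 0 < ε → ε ≤ 1 →
      (BetaHermite.ensemble β n).real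
          {x | 2 * Real.sqrt n * (1 + ε) ≤ BetaHermite.lambdaMax x} ≤
        C * Real.exp (-(β * n * ε ^ (3 / 2 : ℝ)) / C) ∧
      (BetaHermite.ensemble β n).real
          {x | BetaHermite.lambdaMax x ≤ 2 * Real.sqrt n * (1 - ε)} ≤
        C ^ β * Real.exp (-(β * (n : ℝ) ^ 2 * ε ^ 3) / C) := by
  refine ⟨2000000, by norm_num, fun n β ε hn hβ hε hε1 => ?_⟩
  have hβ0 : 0 < β := by linarith
  have hn0 : (0 : ℝ) < n := by exact_mod_cast hn
  have := BetaHermite.isProbabilityMeasure_ensemble hβ0 n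
  constructor
  · obtain ⟨h, hh, rfl⟩ : ∃ h : ℝ, 0 < h ∧ ε = h ^ 2 :=
      ⟨√ε, Real.sqrt_pos.2 hε, (Real.sq_sqrt hε.le).symm⟩
    have hh1 : h ≤ 1 := by nlinarith
    have hpow : (h ^ 2) ^ (3 / 2 : ℝ) = h ^ 3 := by
      rw [← Real.rpow_natCast, ← Real.rpow_mul hh.le, ← Real.rpow_natCast]
      norm_num
    rw [hpow]
    have hq : 0 < β * n * h ^ 3 := by positivity
    rcases le_or_gt 1 (β * n * h ^ 3) with hreg | hreg
    · refine (BetaHermite.right_tail_of_one_le hβ hn hh hh1 hreg).trans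
        (mul_le_mul (by norm_num) (Real.exp_le_exp.2 ?_) (Real.exp_pos _).le (by norm_num))
      linarith
    · -- the exponent is at least `-1 / C`, and the bound exceeds `1`
      refine measureReal_le_one.trans ?_
      have := Real.add_one_le_exp (-(β * n * h ^ 3) / 2000000)
      linarith
  · rcases le_or_gt 24576 ((n : ℝ) ^ 2 * ε ^ 3) with hreg | hreg
    · refine (BetaHermite.left_tail_of_large hβ hn hε hε1 hreg).trans ?_
      have h1 : (1 : ℝ) ≤ 2000000 ^ β := Real.one_le_rpow (by norm_num) hβ0.le
      refine le_trans ?_ (le_mul_of_one_le_left (Real.exp_pos _).le h1)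
      refine Real.exp_le_exp.2 ?_
      have : 0 < β * (n : ℝ) ^ 2 * ε ^ 3 := by positivity
      linarith
    · -- the exponent is at least `-β`, which is compensated by `C ^ β ≥ exp β`
      refine measureReal_le_one.trans ?_
      have h1 : Real.exp β ≤ 2000000 ^ β := by
        rw [Real.rpow_def_of_pos (by norm_num)]
        refine Real.exp_le_exp.2 (le_mul_of_one_le_left hβ0.le ?_)
        rw [Real.le_log_iff_exp_le (by norm_num)]
        linarith [Real.exp_one_lt_three]
      refine le_trans ?_ (mul_le_mul_of_nonneg_right h1 (Real.exp_pos _).le)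
      rw [← Real.exp_add]
      refine Real.one_le_exp ?_
      nlinarith
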